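/- \textbf{Setting.} Let $\mathbb X^d_\ell=(\mathbb R^d)^\ell$ ($\ell\ge 1$) be the set of polygonal curves with $\ell$ vertices in $\mathbb R^d$ (Euclidean norm). The Fréchet distance of two curves $P,Q:[0,1]\to\mathbb R^d$ is $d_F(P,Q)=\inf_\gamma\sup_{x\in[0,1]}\|P(\gamma(x))-Q(x)\|$, where $\gamma$ ranges over the strictly increasing bijections of $[0,1]$. An $\ell$-simplification of $P$ is a curve $Q\in\mathbb X^d_\ell$ with $d_F(P,Q)\le d_F(P,Q')$ for all $Q'\in\mathbb X^d_\ell$. Let $P:[0,1]\to\mathbb R^d$ be a polygonal curve with vertices $p_1,\dots,p_n$, $n\ge1$, given together with parameters $0=s_1\le\dots\le s_n\le 1$ (with $s_n=1$ if $n\ge 2$, and $p_i=p_j$ whenever $s_i=s_j$) such that $P(s_i)=p_i$ and $P$ is affine on every $[s_i,s_{i+1}]$ (constant if $n=1$), and with $m\ge 2$ breakpoints $0=t_1<\dots<t_m=1$. For $i<j$ let $P[t_i,t_j]$ denote the subcurve from $P(t_i)$ to $P(t_j)$, reparametrized over $[0,1]$. For $C\subseteq\mathbb X^d_\ell$ let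 $$\phi(P,C)=\min_I\ \max_{(i,j)\in I}\ \inf_{q\in C}d_F(P[t_i,t_j],q),$$ where $I$ ranges over the sets of pairs $1\le i<j\le m$ with $\bigcup_{(i,j)\in I}[t_i,t_j]=[0,1]$. \textbf{Machine model.} Algorithms are fixed finite deterministic programs (assignments, sequencing, case distinctions, while loops) for a unit-cost real RAM. It has arrays of natural numbers and arrays of real numbers, indexed by tuples of computed natural numbers; on natural numbers it has addition, truncated subtraction and comparison, on real numbers $+,-,\cdot,/,\sqrt{\phantom{x}}$ and comparison. The input consists of $n,m,\ell,\Delta$, the $p_i$, the $s_i$ and the $t_i$. In addition there is a deterministic subroutine which, called with a pair $i<j$, returns the vertices of an $\ell$-simplification of $P[t_i,t_j]$; let $T_S(n,\ell)$ be an upper bound on the running time of these calls. A call is charged its running time and one further step for each of the $\ell d$ returned numbers (besides the $O(1)$ steps for the arguments). \textbf{Theorem.} There is an absolute constant $c$ such that for every $d$ there are a constant $C_d$ and an algorithm with the following property. Let $n,m,\ell\ge1$, $P$, $t_1,\dots,t_m$ be as above, let $\Delta\ge 0$, and let a simplification subroutine with time bound $T_S(n,\ell)$ be given. If there is a set $H^*\subset\mathbb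 X^d_\ell$ of size $k$ with $\phi(P,H^*)\le\Delta$, then on this input the algorithm halts after at most $$C_d\,\bigl(m^3n\ell+m^4+m^2\,T_S(n,\ell)\bigr)$$ steps and outputs a list of at most $c\,k\log m$ curves in $\mathbb X^d_\ell$, each of which is an $\ell$-simplification of some subcurve $P[t_i,t_j]$ with $i<j$, such that the set $H$ of these curves satisfies $\phi(P,H)\le 3\Delta$. -/

import Mathlib

open scoped ENNReal

noncomputable section

namespace Subtraj

/-! ### Polygonal curves and the Fréchet distance -/

/-- Points of `ℝ^d` with the Euclidean norm. -/
abbrev Pt (d : ℕ) : Type := EuclideanSpace ℝ (Fin d)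

/-- The set `𝕏^d_ℓ = (ℝ^d)^ℓ` of polygonal curves with `ℓ` vertices in `ℝ^d`. -/
abbrev PolyCurve (d ℓ : ℕ) : Type := Fin ℓ → Pt d

/-- Restriction of a real number to the unit interval. -/
def clamp (x : ℝ) : ℝ := max 0 (min 1 x)

/-- The parametrized polygonal curve with vertices `p 0, …, p (n - 1)` which passes through `p i`
at the parameter `s i` and interpolates linearly in between, written as the first vertex plus the
part of every edge that has been traversed at the parameter `x`.  For `s i = s (i + 1)` (which
occurs only if `p i = p (i + 1)`) the edge contributes `0`. -/
def polygonal {d n : ℕ} (p : Fin n → Pt d) (s : Fin n → ℝ) (x : ℝ) : Pt d :=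
  (if h : 0 < n then p ⟨0, h⟩ else 0) +
    ∑ i : Fin (n - 1),
      clamp ((x - s ⟨i, by omega⟩) / (s ⟨i + 1, by omega⟩ - s ⟨i, by omega⟩)) •
        (p ⟨i + 1, by omega⟩ - p ⟨i, by omega⟩)

/-- An element of `𝕏^d_ℓ` as a parametrized curve on `[0, 1]`, all edges taking equally long
(for `ℓ = 1` the constant curve). -/
def PolyCurve.toCurve {d ℓ : ℕ} (q : PolyCurve d ℓ) : ℝ → Pt d :=
  polygonal q fun i => (i : ℝ) / ((ℓ : ℝ) - 1)

/-- The Fréchet distance of two curves parametrized over `[0, 1]`.  The reparametrizations are the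
strictly increasing bijections of `[0, 1]`, that is, its order automorphisms. -/
def frechetDist {d : ℕ} (P Q : ℝ → Pt d) : ℝ≥0∞ :=
  ⨅ γ : Set.Icc (0 : ℝ) 1 ≃o Set.Icc (0 : ℝ) 1,
    ⨆ x : Set.Icc (0 : ℝ) 1, edist (P (γ x)) (Q x)

/-- The subcurve `P[a, b]`, reparametrized over `[0, 1]`. -/
def subcurve {d : ℕ} (P : ℝ → Pt d) (a b : ℝ) : ℝ → Pt d := fun x => P (a + x * (b - a))

/-- `Q ∈ 𝕏^d_ℓ` is an `ℓ`-simplification of `P` if no curve in `𝕏^d_ℓ` has a smaller Fréchet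
distance to `P`. -/
def IsSimplification {d ℓ : ℕ} (P : ℝ → Pt d) (Q : PolyCurve d ℓ) : Prop :=
  ∀ Q' : PolyCurve d ℓ, frechetDist P Q.toCurve ≤ frechetDist P Q'.toCurve

/-- A polygonal curve with `n` vertices in `ℝ^d`, parametrized over `[0, 1]`, with `m` breakpoints
`0 = t_1 < … < t_m = 1` (indexed from `0` here). -/
structure Trajectory (d n m : ℕ) where
  vertex : Fin n → Pt d
  param : Fin n → ℝ
  bp : Fin m → ℝ
  n_pos : 0 < n
  two_le : 2 ≤ m
  param_mono : Monotone param
  param_first : param ⟨0, n_pos⟩ = 0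
  param_last : 1 < n → param ⟨n - 1, by omega⟩ = 1
  param_consistent : ∀ i j, param i = param j → vertex i = vertex j
  bp_strictMono : StrictMono bp
  bp_first : bp ⟨0, by omega⟩ = 0
  bp_last : bp ⟨m - 1, by omega⟩ = 1

namespace Trajectory

variable {d n m : ℕ}

/-- The parametrized curve `P : [0, 1] → ℝ^d`. -/
def curve (P : Trajectory d n m) : ℝ → Pt d := polygonal P.vertex P.param

/-- The subcurve `P[t_i, t_j]` between two breakpoints. -/
def sub (P : Trajectory d n m) (i j : Fin m) : ℝ → Pt d := subcurve P.curve (P.bp i) (P.bp j)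

/-- `I` is a set of pairs `i < j` whose intervals `[t_i, t_j]` have the union `[0, 1]`. -/
def IsIntervalCover (P : Trajectory d n m) (I : Finset (Fin m × Fin m)) : Prop :=
  (∀ ij ∈ I, ij.1 < ij.2) ∧
    Set.Icc (0 : ℝ) 1 = ⋃ ij ∈ I, Set.Icc (P.bp ij.1) (P.bp ij.2)

/-- The cost `φ(P, C) = min_I max_{(i, j) ∈ I} min_{q ∈ C} d_F(P[t_i, t_j], q)`; it is `∞` if `C`
is empty. -/
def phi {ℓ : ℕ} (P : Trajectory d n m) (C : Set (PolyCurve d ℓ)) : ℝ≥0∞ :=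
  ⨅ (I : Finset (Fin m × Fin m)) (_ : P.IsIntervalCover I),
    ⨆ ij ∈ I, ⨅ q ∈ C, frechetDist (P.sub ij.1 ij.2) q.toCurve

end Trajectory

/-! ### The machine model: a real RAM with structured programs and unit costs

There are arrays of natural numbers and arrays of real numbers, each with a number as its name and
addressed by finitely many natural numbers that are themselves computed at run time (a scalar
variable is an array without indices).  On natural numbers there are addition, truncated
subtraction and comparison, on real numbers the field operations, square root and comparison.
Reals cannot be turned into natural numbers, and the only constants are natural numbers. -/

/-- The memory of the machine. -/
structure Store where
  nat : ℕ → List ℕ → ℕ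
  real : ℕ → List ℕ → ℝ

open Classical in
/-- Write to a single cell of an array of natural numbers. -/
def Store.setNat (σ : Store) (a : ℕ) (x : List ℕ) (v : ℕ) : Store :=
  { σ with nat := fun a' x' => if a' = a ∧ x' = x then v else σ.nat a' x' }

open Classical in
/-- Write to a single cell of an array of real numbers. -/
def Store.setReal (σ : Store) (a : ℕ) (x : List ℕ) (v : ℝ) : Store :=
  { σ with real := fun a' x' => if a' = a ∧ x' = x then v else σ.real a' x' }

/-- Expressions with natural values; `read a idx` is the array element `a[idx 0, …, idx (k - 1)]`. -/
inductive NExpr : Type where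
  | lit (c : ℕ) : NExpr
  | read (a : ℕ) {k : ℕ} (idx : Fin k → NExpr) : NExpr
  | add (e f : NExpr) : NExpr
  | sub (e f : NExpr) : NExpr

/-- The value of an expression. -/
def NExpr.eval (σ : Store) : NExpr → ℕ
  | .lit c => c
  | .read a idx => σ.nat a (List.ofFn fun q => (idx q).eval σ)
  | .add e f => e.eval σ + f.eval σ
  | .sub e f => e.eval σ - f.eval σ

/-- The number of steps needed to evaluate an expression: one for each operation. -/
def NExpr.cost : NExpr → ℕ
  | .lit _ => 1
  | .read _ idx => 1 + ∑ q, (idx q).cost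
  | .add e f => 1 + e.cost + f.cost
  | .sub e f => 1 + e.cost + f.cost

/-- Expressions with real values. -/
inductive RExpr : Type where
  | lit (c : ℕ) : RExpr
  | read (a : ℕ) {k : ℕ} (idx : Fin k → NExpr) : RExpr
  | add (e f : RExpr) : RExpr
  | sub (e f : RExpr) : RExpr
  | mul (e f : RExpr) : RExpr
  | div (e f : RExpr) : RExpr
  | sqrt (e : RExpr) : RExpr

/-- The value of an expression (division by `0` and the root of a negative number yield `0`). -/
def RExpr.eval (σ : Store) : RExpr → ℝ
  | .lit c => c
  | .read a idx => σ.real a (List.ofFn fun q => (idx q).eval σ)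
  | .add e f => e.eval σ + f.eval σ
  | .sub e f => e.eval σ - f.eval σ
  | .mul e f => e.eval σ * f.eval σ
  | .div e f => e.eval σ / f.eval σ
  | .sqrt e => Real.sqrt (e.eval σ)

/-- The number of steps needed to evaluate an expression. -/
def RExpr.cost : RExpr → ℕ
  | .lit _ => 1
  | .read _ idx => 1 + ∑ q, (idx q).cost
  | .add e f => 1 + e.cost + f.cost
  | .sub e f => 1 + e.cost + f.cost
  | .mul e f => 1 + e.cost + f.cost
  | .div e f => 1 + e.cost + f.cost
  | .sqrt e => 1 + e.cost

/-- Conditions. -/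
inductive BExpr : Type where
  | natLt (e f : NExpr) : BExpr
  | natEq (e f : NExpr) : BExpr
  | realLt (e f : RExpr) : BExpr
  | realLe (e f : RExpr) : BExpr
  | not (b : BExpr) : BExpr
  | and (b c : BExpr) : BExpr
  | or (b c : BExpr) : BExpr

/-- The truth of a condition. -/
def BExpr.holds (σ : Store) : BExpr → Prop
  | .natLt e f => e.eval σ < f.eval σ
  | .natEq e f => e.eval σ = f.eval σ
  | .realLt e f => e.eval σ < f.eval σ
  | .realLe e f => e.eval σ ≤ f.eval σ
  | .not b => ¬ b.holds σ
  | .and b c => b.holds σ ∧ c.holds σ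
  | .or b c => b.holds σ ∨ c.holds σ

/-- The number of steps needed to evaluate a condition. -/
def BExpr.cost : BExpr → ℕ
  | .natLt e f => 1 + e.cost + f.cost
  | .natEq e f => 1 + e.cost + f.cost
  | .realLt e f => 1 + e.cost + f.cost
  | .realLe e f => 1 + e.cost + f.cost
  | .not b => 1 + b.cost
  | .and b c => 1 + b.cost + c.cost
  | .or b c => 1 + b.cost + c.cost

/-- Programs.  `simplify i j a` calls the simplification subroutine for the subcurve between the
breakpoints with the indices `i` and `j` and stores the resulting vertices in the real array `a`. -/
inductive Program : Type where
  | skip : Program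
  | setNat (a : ℕ) {k : ℕ} (idx : Fin k → NExpr) (e : NExpr) : Program
  | setReal (a : ℕ) {k : ℕ} (idx : Fin k → NExpr) (e : RExpr) : Program
  | seq (A B : Program) : Program
  | ite (b : BExpr) (A B : Program) : Program
  | while (b : BExpr) (A : Program) : Program
  | simplify (i j : NExpr) (a : ℕ) : Program

/-- The subroutine that computes `ℓ`-simplifications of subcurves of the input: the answer to the
call with the breakpoint indices `i` and `j`, and the running time of this call. -/
structure Subroutine (d ℓ : ℕ) where
  answer : ℕ → ℕ → PolyCurve d ℓ
  time : ℕ → ℕ → ℕ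

/-- For `i < j` the answer is an `ℓ`-simplification of `P[t_i, t_j]`, computed in time at
most `T`. -/
def Subroutine.Computes {d ℓ n m : ℕ} (S : Subroutine d ℓ) (P : Trajectory d n m) (T : ℕ) : Prop :=
  ∀ i j : Fin m, i < j → IsSimplification (P.sub i j) (S.answer i j) ∧ S.time i j ≤ T

/-- The vertices of `q` are written to the array `a`: the coordinate `c` of the vertex `v` goes to
the cell `a[v, c]`. -/
def Store.setCurve {d ℓ : ℕ} (σ : Store) (a : ℕ) (q : PolyCurve d ℓ) : Store where
  nat := σ.nat
  real := fun a' x' =>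
    match x' with
    | [v, c] => if h : a' = a ∧ v < ℓ ∧ c < d then q ⟨v, h.2.1⟩ ⟨c, h.2.2⟩ else σ.real a' [v, c]
    | x' => σ.real a' x'

/-- `Runs S A σ σ' T`: with the subroutine `S`, the program `A` started on the memory `σ` halts
with the memory `σ'` after exactly `T` steps.  A call of the subroutine costs its running time and
one step for every number that it returns. -/
inductive Runs {d ℓ : ℕ} (S : Subroutine d ℓ) : Program → Store → Store → ℕ → Prop where
  | skip (σ : Store) : Runs S .skip σ σ 1
  | setNat (σ : Store) (a : ℕ) {k : ℕ} (idx : Fin k → NExpr) (e : NExpr) :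
      Runs S (.setNat a idx e) σ
        (σ.setNat a (List.ofFn fun q => (idx q).eval σ) (e.eval σ))
        (1 + ∑ q, (idx q).cost + e.cost)
  | setReal (σ : Store) (a : ℕ) {k : ℕ} (idx : Fin k → NExpr) (e : RExpr) :
      Runs S (.setReal a idx e) σ
        (σ.setReal a (List.ofFn fun q => (idx q).eval σ) (e.eval σ))
        (1 + ∑ q, (idx q).cost + e.cost)
  | seq {A B : Program} {σ₁ σ₂ σ₃ : Store} {T₁ T₂ : ℕ} :
      Runs S A σ₁ σ₂ T₁ → Runs S B σ₂ σ₃ T₂ → Runs S (.seq A B) σ₁ σ₃ (T₁ + T₂)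
  | iteTrue {b : BExpr} {A B : Program} {σ σ' : Store} {T : ℕ} :
      b.holds σ → Runs S A σ σ' T → Runs S (.ite b A B) σ σ' (b.cost + T)
  | iteFalse {b : BExpr} {A B : Program} {σ σ' : Store} {T : ℕ} :
      ¬ b.holds σ → Runs S B σ σ' T → Runs S (.ite b A B) σ σ' (b.cost + T)
  | whileTrue {b : BExpr} {A : Program} {σ₁ σ₂ σ₃ : Store} {T₁ T₂ : ℕ} :
      b.holds σ₁ → Runs S A σ₁ σ₂ T₁ → Runs S (.while b A) σ₂ σ₃ T₂ →
        Runs S (.while b A) σ₁ σ₃ (b.cost + T₁ + T₂)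
  | whileFalse {b : BExpr} {A : Program} {σ : Store} :
      ¬ b.holds σ → Runs S (.while b A) σ σ b.cost
  | simplify (σ : Store) (i j : NExpr) (a : ℕ) :
      Runs S (.simplify i j a) σ
        (σ.setCurve a (S.answer (i.eval σ) (j.eval σ)))
        (1 + i.cost + j.cost + ℓ * d + S.time (i.eval σ) (j.eval σ))

/-- The memory at the start.  The scalars `n`, `m`, `ℓ` are the natural variables `0`, `1`, `2`, the
scalar `Δ` is the real variable `0`, the vertices, their parameters and the breakpoints are in the
real arrays `1`, `2`, `3`, and all other cells are `0`. -/
def inputStore {d n m : ℕ} (P : Trajectory d n m) (ℓ : ℕ) (Δ : ℝ) : Store where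
  nat := fun a x =>
    match a, x with
    | 0, [] => n
    | 1, [] => m
    | 2, [] => ℓ
    | _, _ => 0
  real := fun a x =>
    match a, x with
    | 0, [] => Δ
    | 1, [v, c] => if h : v < n ∧ c < d then P.vertex ⟨v, h.1⟩ ⟨c, h.2⟩ else 0
    | 2, [v] => if h : v < n then P.param ⟨v, h⟩ else 0
    | 3, [j] => if h : j < m then P.bp ⟨j, h⟩ else 0
    | _, _ => 0

/-- The number of centers in the output, read from the natural variable `3`. -/
def outputCount (σ : Store) : ℕ := σ.nat 3 []

/-- The set of centers in the output: the coordinate `c` of the vertex `v` of the center `r` is read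
from the cell `[r, v, c]` of the real array `4`. -/
def outputCenters (d ℓ : ℕ) (σ : Store) : Set (PolyCurve d ℓ) :=
  Set.range fun r : Fin (outputCount σ) =>
    fun v : Fin ℓ => WithLp.toLp 2 fun c : Fin d => σ.real 4 [(r : ℕ), (v : ℕ), (c : ℕ)]

end Subtraj

end

noncomputable section

namespace Subtraj

/-! ### The Fréchet distance and monotone paths -/

/-! The problem is reduced to set cover. The elements are the `m - 1` elementary intervals between
consecutive breakpoints. The candidates are the simplifications `s` of all subcurves `P[t_a, t_b]`.
A candidate covers an element if the element lies in some `[t_i, t_j]` with `d_F(P[t_i, t_j], s) ≤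
3Δ`.

If `H*` has cost at most `Δ`, each center `h` that is within `Δ` of some subcurve is represented by
the simplification `s` of one such subcurve `P[t_a, t_b]`. By optimality `s` is within `Δ` of
`P[t_a, t_b]`, so for every `P[t_i, t_j]` within `Δ` of `h` the path through `h` and `P[t_a, t_b]`
gives distance at most `3Δ` to `s` (`Input.near_answer`). Hence `k` candidates cover everything
(`Input.exists_isCover`). The greedy rule always removes at least a `1/k` fraction of the uncovered
elements, so `O(k log m)` productive rounds suffice (`Input.IsCover.rounds_le`). Conversely,
candidates that cover all elements have cost at most `3Δ` (`Trajectory.phi_le_of_near`).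

The test `d_F ≤ δ` is decided exactly by dynamic programming in the free space diagram. Each cell
has convex free space, so it is enough to know the first reachable point on each cell side, and that
point is either the start of the scan or a root of a quadratic. Soundness turns the table into a
monotone path, which is then perturbed to strictly increasing reparametrizations
(`frechetDist_le_of_monotone`). Completeness starts from a limit of nearly optimal
reparametrizations, which is a chain total on both sides (`exists_chain_of_frechetDist_le`), and
shows that the table never misses it (`FreeSpace.Valid.complete_cell`).

For the running time, one table of `n ℓ` cells serves all ends `j` for a fixed candidate and start
`i`. With `m²` candidates and `m` starts this gives `m³ n ℓ + m⁴`, plus `m²` calls of the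
subroutine. For each candidate only the furthest end for starts up to `e` is stored, so an element
is tested in constant time and `m` greedy rounds cost `m⁴`. Programs are verified by a small
calculus: `Ok` combines termination, a time bound and a postcondition, and `Frame` tracks the arrays
that may change. -/

theorem frechetDist_comm {d : ℕ} (P Q : ℝ → Pt d) : frechetDist P Q = frechetDist Q P := by
  have key : ∀ P Q : ℝ → Pt d, frechetDist P Q ≤ frechetDist Q P := by
    intro P Q
    refine le_iInf fun γ => (iInf_le _ γ.symm).trans (iSup_le fun x => ?_)
    refine le_trans ?_ (le_iSup _ (γ.symm x))
    rw [edist_comm, OrderIso.apply_symm_apply]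
  exact le_antisymm (key P Q) (key Q P)

theorem frechetDist_triangle {d : ℕ} (P Q R : ℝ → Pt d) :
    frechetDist P R ≤ frechetDist P Q + frechetDist Q R := by
  rw [frechetDist, frechetDist, frechetDist]
  simp only [ENNReal.iInf_add, ENNReal.add_iInf]
  refine le_iInf fun γ₂ => le_iInf fun γ₁ => (iInf_le _ (γ₂.trans γ₁)).trans (iSup_le fun x => ?_)
  refine (edist_triangle _ (Q (γ₂ x)) _).trans (add_le_add ?_ ?_)
  · exact le_iSup (fun x : Set.Icc (0 : ℝ) 1 => edist (P (γ₁ x)) (Q x)) (γ₂ x)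
  · exact le_iSup (fun x : Set.Icc (0 : ℝ) 1 => edist (Q (γ₂ x)) (R x)) x

/-- `q` can be reached from `p` by a path in `F` which is monotone in both coordinates. -/
def MonoJoined (F : Set (ℝ × ℝ)) (p q : ℝ × ℝ) : Prop :=
  ∃ γ : Path p q, Monotone γ ∧ ∀ t, γ t ∈ F

theorem MonoJoined.trans {F : Set (ℝ × ℝ)} {p q r : ℝ × ℝ} (h₁ : MonoJoined F p q)
    (h₂ : MonoJoined F q r) : MonoJoined F p r := by
  obtain ⟨γ₁, m₁, f₁⟩ := h₁
  obtain ⟨γ₂, m₂, f₂⟩ := h₂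
  refine ⟨γ₁.trans γ₂, fun s t hst => ?_, fun t => ?_⟩
  · have hst' : (s : ℝ) ≤ t := hst
    rw [Path.trans_apply, Path.trans_apply]
    split_ifs with hs ht ht
    · exact m₁ (Subtype.mk_le_mk.2 (by linarith))
    · have e₁ := m₁ (show (⟨2 * s, (unitInterval.mul_pos_mem_iff zero_lt_two).2 ⟨s.2.1, hs⟩⟩ : unitInterval) ≤ 1
        from Subtype.mk_le_mk.2 (by linarith))
      have e₂ := m₂ (show (0 : unitInterval) ≤
        ⟨2 * t - 1, unitInterval.two_mul_sub_one_mem_iff.2 ⟨(not_le.1 ht).le, t.2.2⟩⟩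
        from Subtype.mk_le_mk.2 (by linarith))
      rw [Path.target] at e₁
      rw [Path.source] at e₂
      exact e₁.trans e₂
    · exact absurd (hst'.trans ht) hs
    · exact m₂ (Subtype.mk_le_mk.2 (by linarith))
  · rw [Path.trans_apply]
    split_ifs
    · exact f₁ _
    · exact f₂ _

theorem MonoJoined.of_segment {F : Set (ℝ × ℝ)} {p q : ℝ × ℝ} (h : p ≤ q)
    (hF : segment ℝ p q ⊆ F) : MonoJoined F p q := by
  refine ⟨Path.segment p q, fun s t hst => ?_, fun t => hF ?_⟩
  · have hst' : (s : ℝ) ≤ t := hst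
    rw [Path.segment_apply, Path.segment_apply]
    constructor
    · have := h.1
      simp [AffineMap.lineMap_apply]
      nlinarith
    · have := h.2
      simp [AffineMap.lineMap_apply]
      nlinarith
  · rw [← Path.range_segment]
    exact Set.mem_range_self t

/-- Monotone paths that need not be strictly monotone suffice to bound the Fréchet distance. -/
theorem frechetDist_le_of_monotone {d : ℕ} {F G : ℝ → Pt d} (hF : Continuous F)
    (hG : Continuous G) {X Y : unitInterval → unitInterval} (cX : Continuous X)
    (cY : Continuous Y) (mX : Monotone X) (mY : Monotone Y) (X0 : X 0 = 0) (X1 : X 1 = 1)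
    (Y0 : Y 0 = 0) (Y1 : Y 1 = 1) {δ : ℝ}
    (hδ : ∀ t, dist (F (X t)) (G (Y t)) ≤ δ) : frechetDist F G ≤ ENNReal.ofReal δ := by
  -- Mixing in a small multiple `η` of the identity makes a monotone map strictly monotone while
  -- moving its values by at most `η`; surjectivity follows from the intermediate value theorem.
  have iso : ∀ (Z : unitInterval → unitInterval), Continuous Z → Monotone Z → Z 0 = 0 → Z 1 = 1 →
      ∀ η : ℝ, 0 < η → η < 1 → ∃ e : unitInterval ≃o unitInterval,
        ∀ t, (e t : ℝ) = (1 - η) * Z t + η * t := by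
    intro Z cZ mZ Z0 Z1 η h0 h1
    have mem : ∀ t : unitInterval, (1 - η) * (Z t : ℝ) + η * t ∈ unitInterval := fun t =>
      ⟨by have := (Z t).2.1; have := t.2.1; have : 0 < 1 - η := by linarith
          positivity,
       by have := (Z t).2.2; have := t.2.2; nlinarith⟩
    let f : unitInterval → unitInterval := fun t => ⟨_, mem t⟩
    have sm : StrictMono f := by
      intro s t hst
      have h₁ : (Z s : ℝ) ≤ Z t := mZ hst.le
      have h₂ : (s : ℝ) < t := hst
      refine Subtype.mk_lt_mk.2 ?_
      nlinarith
    have cf : Continuous f := by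
      refine Continuous.subtype_mk ?_ _
      fun_prop
    have sf : Function.Surjective f := by
      intro y
      have h0' : f 0 = 0 := Subtype.ext (by simp [f, Z0])
      have h1' : f 1 = 1 := Subtype.ext (by simp [f, Z1])
      have := intermediate_value_univ (0 : unitInterval) 1 cf
      rw [h0', h1'] at this
      exact this ⟨y.2.1, y.2.2⟩
    exact ⟨sm.orderIsoOfSurjective f sf, fun t => rfl⟩
  have uc : ∀ H : ℝ → Pt d, Continuous H → ∀ ε > 0, ∃ η > 0, ∀ s t : unitInterval,
      |(s : ℝ) - t| < η → dist (H s) (H t) < ε := by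
    intro H hH ε hε
    have : UniformContinuous fun s : unitInterval => H s :=
      CompactSpace.uniformContinuous_of_continuous (hH.comp continuous_subtype_val)
    obtain ⟨η, h, h'⟩ := Metric.uniformContinuous_iff.1 this ε hε
    exact ⟨η, h, fun s t hst => h' (by rwa [Subtype.dist_eq, Real.dist_eq])⟩
  have hδ0 : 0 ≤ δ := dist_nonneg.trans (hδ 0)
  refine ENNReal.le_of_forall_pos_le_add fun ε hε _ => ?_
  obtain ⟨η₁, p₁, h₁⟩ := uc F hF (ε / 2) (by positivity)
  obtain ⟨η₂, p₂, h₂⟩ := uc G hG (ε / 2) (by positivity)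
  obtain ⟨η, pη, qη⟩ : ∃ η, 0 < η ∧ η < min (min η₁ η₂) 1 := exists_between (by positivity)
  have q₁ : η < η₁ := qη.trans_le ((min_le_left _ _).trans (min_le_left _ _))
  have q₂ : η < η₂ := qη.trans_le ((min_le_left _ _).trans (min_le_right _ _))
  have q₃ : η < 1 := qη.trans_le (min_le_right _ _)
  obtain ⟨a, ha⟩ := iso X cX mX X0 X1 η pη q₃
  obtain ⟨b, hb⟩ := iso Y cY mY Y0 Y1 η pη q₃
  have close : ∀ s t : unitInterval, |(1 - η) * (s : ℝ) + η * t - s| ≤ η := by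
    intro s t
    have e : (1 - η) * (s : ℝ) + η * t - s = η * (t - s) := by ring
    have : |(t : ℝ) - s| ≤ 1 := by
      rw [abs_le]
      constructor <;> linarith [s.2.1, s.2.2, t.2.1, t.2.2]
    rw [e, abs_mul, abs_of_pos pη]
    nlinarith
  -- For `x = b t` this reparametrization takes the value `a t`, so the points compared are
  -- perturbations of `X t` and `Y t`.
  refine (iInf_le _ (b.symm.trans a)).trans (iSup_le fun x => ?_)
  obtain ⟨t, rfl⟩ := b.surjective x
  have e : (b.symm.trans a) (b t) = a t := by simp
  rw [e, edist_dist]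
  have d₁ : dist (F (a t)) (F (X t)) < ε / 2 := h₁ _ _ (by
    rw [ha]
    exact (close _ _).trans_lt q₁)
  have d₂ : dist (G (b t)) (G (Y t)) < ε / 2 := h₂ _ _ (by
    rw [hb]
    exact (close _ _).trans_lt q₂)
  have : dist (F (a t)) (G (b t)) ≤ δ + ε := by
    have e₁ := dist_triangle4 (F (a t)) (F (X t)) (G (Y t)) (G (b t))
    rw [dist_comm (G (Y t))] at e₁
    linarith [hδ t]
  refine (ENNReal.ofReal_le_ofReal this).trans ?_
  rw [ENNReal.ofReal_add hδ0 ε.coe_nonneg, ENNReal.ofReal_coe_nnreal]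

/-- If the Fréchet distance is at most `δ`, then there is a chain in the free space which is total
on both sides. -/
theorem exists_chain_of_frechetDist_le {d : ℕ} {F G : ℝ → Pt d} (hF : Continuous F)
    (hG : Continuous G) {δ : ℝ} (hδ : 0 ≤ δ) (h : frechetDist F G ≤ ENNReal.ofReal δ) :
    ∃ Γ : Set (ℝ × ℝ), (∀ p ∈ Γ, p.1 ∈ Set.Icc (0 : ℝ) 1 ∧ p.2 ∈ Set.Icc (0 : ℝ) 1) ∧
      (∀ p ∈ Γ, ∀ q ∈ Γ, p ≤ q ∨ q ≤ p) ∧ (∀ p ∈ Γ, dist (F p.1) (G p.2) ≤ δ) ∧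
      (0, 0) ∈ Γ ∧ (1, 1) ∈ Γ ∧
      (∀ x ∈ Set.Icc (0 : ℝ) 1, ∃ y, (x, y) ∈ Γ) ∧
      (∀ y ∈ Set.Icc (0 : ℝ) 1, ∃ x, (x, y) ∈ Γ) := by
  have approx : ∀ k : ℕ, ∃ γ : Set.Icc (0 : ℝ) 1 ≃o Set.Icc (0 : ℝ) 1,
      ∀ x, dist (F (γ x)) (G x) ≤ δ + 1 / ((k : ℝ) + 1) := by
    intro k
    have pos : (0 : ℝ) < 1 / ((k : ℝ) + 1) := by positivity
    have lt : frechetDist F G < ENNReal.ofReal (δ + 1 / ((k : ℝ) + 1)) :=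
      h.trans_lt ((ENNReal.ofReal_lt_ofReal_iff (by linarith)).2 (by linarith))
    obtain ⟨γ, hγ⟩ := iInf_lt_iff.1 lt
    refine ⟨γ, fun x => ?_⟩
    have := (le_iSup (fun x : Set.Icc (0 : ℝ) 1 => edist (F (γ x)) (G x)) x).trans hγ.le
    rwa [edist_dist, ENNReal.ofReal_le_ofReal_iff (by linarith)] at this
  choose γ hγ using approx
  -- Nearly optimal reparametrizations need not converge to a bijection. Their graphs are passed to
  -- the limit along an ultrafilter instead; horizontal and vertical pieces may appear, so the limit
  -- is only a chain.
  let U : Ultrafilter ℕ := Filter.hyperfilter ℕ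
  have hU : (U : Filter ℕ) ≤ Filter.atTop := by
    rw [← Nat.cofinite_eq_atTop]
    exact Filter.hyperfilter_le_cofinite
  have lim : ∀ u : ℕ → Set.Icc (0 : ℝ) 1, ∃ z ∈ Set.Icc (0 : ℝ) 1,
      Filter.Tendsto (fun k : ℕ => (u k : ℝ)) U (nhds z) := by
    intro u
    obtain ⟨z, hz, hz'⟩ := (isCompact_Icc (a := (0 : ℝ)) (b := 1)).ultrafilter_le_nhds
      (U.map fun k => (u k : ℝ)) (by
        rw [Filter.le_principal_iff]
        exact Filter.Eventually.of_forall (f := (U : Filter ℕ)) fun k => (u k).2)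
    exact ⟨z, hz, hz'⟩
  refine ⟨{p | ∃ u : ℕ → Set.Icc (0 : ℝ) 1,
      Filter.Tendsto (fun k : ℕ => (γ k (u k) : ℝ)) U (nhds p.1) ∧
      Filter.Tendsto (fun k : ℕ => (u k : ℝ)) U (nhds p.2)}, ?_, ?_, ?_, ?_, ?_, ?_, ?_⟩
  · rintro p ⟨u, h₁, h₂⟩
    exact ⟨isClosed_Icc.mem_of_tendsto h₁ (Filter.Eventually.of_forall fun k => (γ k (u k)).2),
      isClosed_Icc.mem_of_tendsto h₂ (Filter.Eventually.of_forall fun k => (u k).2)⟩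
  · rintro p ⟨u, h₁, h₂⟩ q ⟨w, g₁, g₂⟩
    -- Two points on one graph are comparable, but in an order that may vary with `k`. The
    -- ultrafilter selects one of the two orders, which then passes to the limit.
    have : ∀ᶠ k : ℕ in (U : Filter ℕ), u k ≤ w k ∨ w k ≤ u k :=
      Filter.Eventually.of_forall fun k => le_total _ _
    rcases Ultrafilter.eventually_or.1 this with h | h
    · exact Or.inl ⟨le_of_tendsto_of_tendsto h₁ g₁ (h.mono fun k hk => Subtype.coe_le_coe.2 ((γ k).monotone hk)),
        le_of_tendsto_of_tendsto h₂ g₂ h⟩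
    · exact Or.inr ⟨le_of_tendsto_of_tendsto g₁ h₁ (h.mono fun k hk => Subtype.coe_le_coe.2 ((γ k).monotone hk)),
        le_of_tendsto_of_tendsto g₂ h₂ h⟩
  · rintro p ⟨u, h₁, h₂⟩
    have l₁ := ((hF.tendsto p.1).comp h₁).dist ((hG.tendsto p.2).comp h₂)
    have l₂ : Filter.Tendsto (fun k : ℕ => δ + 1 / ((k : ℝ) + 1)) U (nhds (δ + 0)) :=
      (tendsto_const_nhds.add tendsto_one_div_add_atTop_nhds_zero_nat).mono_left hU
    rw [add_zero] at l₂
    exact le_of_tendsto_of_tendsto' l₁ l₂ fun k => hγ k (u k)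
  · refine ⟨fun _ => 0, ?_, tendsto_const_nhds⟩
    have : ∀ k, γ k 0 = 0 := fun k => (γ k).map_bot
    simp [this]
  · refine ⟨fun _ => 1, ?_, tendsto_const_nhds⟩
    have : ∀ k, γ k 1 = 1 := fun k => (γ k).map_top
    simp [this]
  · intro x hx
    obtain ⟨y, -, hy⟩ := lim fun k => (γ k).symm ⟨x, hx⟩
    exact ⟨y, fun k => (γ k).symm ⟨x, hx⟩, by simp, hy⟩
  · intro y hy
    obtain ⟨x, -, hx⟩ := lim fun k => γ k ⟨y, hy⟩
    exact ⟨x, fun k => ⟨y, hy⟩, hx, by simp⟩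

/-! ### Polygonal curves are affine between knots -/

/-- The vertices of a curve, the last one being repeated for ever. -/
def vtx {d n : ℕ} (p : Fin n → Pt d) (e : ℕ) : Pt d :=
  if h : 0 < n then p ⟨min e (n - 1), by omega⟩ else 0

/-- The parameters of the vertices, followed by `last`. -/
def knot {n : ℕ} (s : Fin n → ℝ) (last : ℝ) (e : ℕ) : ℝ :=
  if h : e < n then s ⟨e, h⟩ else last

/-- The affine map with the value `P₀` at `k₀` and `P₁` at `k₁`. -/
def lineAt {d : ℕ} (k₀ k₁ : ℝ) (P₀ P₁ : Pt d) (x : ℝ) : Pt d :=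
  P₀ + ((x - k₀) / (k₁ - k₀)) • (P₁ - P₀)

theorem knot_monotone {n : ℕ} {s : Fin n → ℝ} (hs : Monotone s) {last : ℝ}
    (hl : ∀ i, s i ≤ last) : Monotone (knot s last) := by
  intro a b hab
  unfold knot
  split_ifs with h₁ h₂ h₂
  · exact hs (by simpa using hab)
  · exact hl _
  · omega
  · exact le_rfl

theorem clamp_of_nonpos {x : ℝ} (h : x ≤ 0) : clamp x = 0 := by
  rw [clamp, min_eq_right (by linarith), max_eq_left h]

theorem clamp_of_one_le {x : ℝ} (h : 1 ≤ x) : clamp x = 1 := by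
  rw [clamp, min_eq_left h, max_eq_right zero_le_one]

theorem clamp_of_mem {x : ℝ} (h₀ : 0 ≤ x) (h₁ : x ≤ 1) : clamp x = x := by
  rw [clamp, min_eq_right h₁, max_eq_right h₀]

theorem continuous_polygonal {d n : ℕ} (p : Fin n → Pt d) (s : Fin n → ℝ) :
    Continuous (polygonal p s) := by
  unfold polygonal clamp
  fun_prop

/-- Between two knots the clamped factors of earlier edges are 1 and those of later edges are 0, so
the sum telescopes to the vertex `e` plus a part of the edge `e`. On a degenerate edge the factor is
meaningless, but its end points coincide. -/
theorem polygonal_eq_lineAt {d n : ℕ} (p : Fin n → Pt d) (s : Fin n → ℝ) (hs : Monotone s)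
    (hc : ∀ i j, s i = s j → p i = p j) (last : ℝ) {e : ℕ} (he : e < n) {x : ℝ}
    (h₁ : knot s last e ≤ x) (h₂ : x ≤ knot s last (e + 1)) :
    polygonal p s x = lineAt (knot s last e) (knot s last (e + 1)) (vtx p e) (vtx p (e + 1)) x := by
  have hn : 0 < n := by omega
  set k := knot s last with hk
  set c : ℝ := (x - k e) / (k (e + 1) - k e) with hcd
  have hv : ∀ i (hi : i < n), vtx p i = p ⟨i, hi⟩ := by
    intro i hi
    rw [vtx, dif_pos hn]
    congr 2
    omega
  have hkn : ∀ i (hi : i < n), k i = s ⟨i, hi⟩ := by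
    intro i hi
    rw [hk, knot, dif_pos hi]
  let F : ℕ → Pt d := fun i => if i < e then vtx p (i + 1) - vtx p i
    else if i = e then c • (vtx p (e + 1) - vtx p e) else 0
  have hF : polygonal p s x = vtx p 0 + ∑ i : Fin (n - 1), F i := by
    rw [polygonal, dif_pos hn, hv 0 hn]
    congr 1
    refine Finset.sum_congr rfl fun i _ => ?_
    have hi : (i : ℕ) + 1 < n := by omega
    rw [← hv i (by omega), ← hv (i + 1) hi, ← hkn i (by omega), ← hkn (i + 1) hi]
    have step : k i ≤ k (i + 1) := by
      rw [hkn i (by omega), hkn (i + 1) hi]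
      exact hs (by simp)
    have deg : k i = k (i + 1) → vtx p (i + 1) - vtx p i = 0 := by
      intro h
      rw [hkn i (by omega), hkn (i + 1) hi] at h
      rw [hv i (by omega), hv (i + 1) hi, hc _ _ h, sub_self]
    rcases lt_trichotomy (i : ℕ) e with h | h | h
    · simp only [F, if_pos h]
      rcases step.eq_or_lt with h' | h'
      · rw [deg h', smul_zero]
      · have : k (i + 1) ≤ k e := by
          rw [hkn e he, hkn (i + 1) hi]
          exact hs (by simpa using h)
        rw [clamp_of_one_le, one_smul]
        rw [le_div_iff₀ (by linarith)]
        linarith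
    · simp only [F, h, lt_irrefl, if_true, if_false]
      rw [h] at step deg
      rw [← hcd, clamp_of_mem]
      · exact div_nonneg (by linarith) (by linarith)
      · exact div_le_one_of_le₀ (by linarith) (by linarith)
    · simp only [F, if_neg (not_lt.2 h.le), if_neg h.ne']
      have : k (e + 1) ≤ k i := by
        rw [hkn (e + 1) (by omega), hkn i (by omega)]
        exact hs (by simpa using h)
      rw [clamp_of_nonpos, zero_smul]
      exact div_nonpos_of_nonpos_of_nonneg (by linarith) (by linarith)
  have tele : ∀ N, ∑ i ∈ Finset.range N, F i =
      vtx p (min N e) - vtx p 0 + if e < N then c • (vtx p (e + 1) - vtx p e) else 0 := by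
    intro N
    induction N with
    | zero => simp
    | succ N ih =>
      rw [Finset.sum_range_succ, ih]
      rcases lt_trichotomy N e with h | h | h
      · have e₁ : min N e = N := by omega
        have e₂ : min (N + 1) e = N + 1 := by omega
        have e₃ : ¬ e < N := by omega
        have e₄ : ¬ e < N + 1 := by omega
        simp only [F, e₁, e₂, if_neg e₃, if_neg e₄, if_pos h]
        abel
      · subst h
        simp [F]
      · have e₁ : min N e = e := by omega
        have e₂ : min (N + 1) e = e := by omega
        have e₃ : ¬ N < e := by omega
        have e₄ : ¬ N = e := by omega
        have e₅ : e < N + 1 := by omega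
        simp [F, e₁, e₂, h, e₃, e₄, e₅]
  rw [hF, Fin.sum_univ_eq_sum_range, tele, lineAt, ← hcd]
  by_cases h : e < n - 1
  · have e₁ : min (n - 1) e = e := by omega
    rw [if_pos h, e₁]
    abel
  -- For `e = n - 1` there is no such edge in the sum; it is the constant piece from the last knot
  -- to `last`.
  · have e₁ : min (n - 1) e = e := by omega
    have e₂ : vtx p (e + 1) = vtx p e := by
      rw [vtx, vtx, dif_pos hn, dif_pos hn]
      congr 2
      omega
    rw [if_neg h, e₁, e₂]
    simp

/-! ### Reachability in the free space diagram -/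

/-- `r` is the first point of `[c, hi]` with the property `p`; if there is none, then `r > hi`.
Only the behaviour of `p` on `[lo, hi]` matters. -/
def IsFirst (p : ℝ → Prop) (lo hi c r : ℝ) : Prop :=
  (lo ≤ c → r ≤ hi → c ≤ r ∧ p r) ∧ ∀ x, lo ≤ x → c ≤ x → x ≤ hi → p x → r ≤ x

theorem IsFirst.le {p : ℝ → Prop} {c hi r lo : ℝ} (h : IsFirst p lo hi c r) (hc : lo ≤ c)
    (hlo : lo ≤ hi) : lo ≤ r := by
  rcases le_or_gt r hi with h' | h'
  · exact hc.trans (h.1 hc h').1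
  · exact hlo.trans h'.le

/-- A free space diagram, divided into cells by vertical lines at `xs e` and horizontal lines at
`ys v`, with the functions `lowR`, `lowT` that find the first free point on the right and on
the top side of a cell, and the first free points `base e` on the bottom line. -/
structure FreeSpace where
  xs : ℕ → ℝ
  ys : ℕ → ℝ
  free : Set (ℝ × ℝ)
  lowR : ℕ → ℕ → ℝ → ℝ
  lowT : ℕ → ℕ → ℝ → ℝ
  base : ℕ → ℝ

namespace FreeSpace

variable (D : FreeSpace)

/-- The first reachable point on the bottom side of the cells of column `e`, given those on the
left side. -/
def bottom (lc : ℕ → ℝ) (e : ℕ) : ℕ → ℝ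
  | 0 => D.base e
  | v + 1 => D.lowT e v (if lc v ≤ D.ys (v + 1) then D.xs e else bottom lc e v)

/-- The first reachable point on the left side of a cell. -/
def left : ℕ → ℕ → ℝ
  | 0, v => D.ys (v + 1) + 1
  | e + 1, v => D.lowR e v
      (if D.bottom (left e) e v ≤ D.xs (e + 1) then D.ys v else left e v)

/-- The first reachable point on the bottom side of a cell. -/
def bot (e v : ℕ) : ℝ := D.bottom (D.left e) e v

theorem bot_zero (e : ℕ) : D.bot e 0 = D.base e := rfl

theorem bot_succ (e v : ℕ) : D.bot e (v + 1) =
    D.lowT e v (if D.left e v ≤ D.ys (v + 1) then D.xs e else D.bot e v) := rfl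

theorem left_zero (v : ℕ) : D.left 0 v = D.ys (v + 1) + 1 := rfl

theorem left_succ (e v : ℕ) : D.left (e + 1) v =
    D.lowR e v (if D.bot e v ≤ D.xs (e + 1) then D.ys v else D.left e v) := rfl

/-- The diagram has `N` columns and `ℓ` rows of cells with convex free spaces. -/
structure Valid (N ℓ : ℕ) : Prop where
  xs_mono : Monotone D.xs
  ys_mono : Monotone D.ys
  convex : ∀ e < N, ∀ v < ℓ, Convex ℝ (D.free ∩
    Set.Icc (D.xs e) (D.xs (e + 1)) ×ˢ Set.Icc (D.ys v) (D.ys (v + 1)))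
  right : ∀ e < N, ∀ v < ℓ, ∀ c,
    IsFirst (fun y => (D.xs (e + 1), y) ∈ D.free) (D.ys v) (D.ys (v + 1)) c (D.lowR e v c)
  top : ∀ e < N, ∀ v < ℓ, ∀ c,
    IsFirst (fun x => (x, D.ys (v + 1)) ∈ D.free) (D.xs e) (D.xs (e + 1)) c (D.lowT e v c)

variable {D}
variable {N ℓ : ℕ} (hD : D.Valid N ℓ)

/-! ### Soundness: recorded points are reached by monotone paths -/

section Soundness

variable {p₀ : ℝ × ℝ}

/-- All free points above the value `r` on the left side of a cell are reachable. -/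
def SoundLeft (D : FreeSpace) (p₀ : ℝ × ℝ) (e v : ℕ) (r : ℝ) : Prop :=
  D.ys v ≤ r ∧ (r ≤ D.ys (v + 1) → (D.xs e, r) ∈ D.free) ∧
    ∀ y, r ≤ y → y ≤ D.ys (v + 1) → (D.xs e, y) ∈ D.free → MonoJoined D.free p₀ (D.xs e, y)

/-- All free points to the right of the value `r` on the bottom side of a cell are reachable. -/
def SoundBottom (D : FreeSpace) (p₀ : ℝ × ℝ) (e v : ℕ) (r : ℝ) : Prop :=
  D.xs e ≤ r ∧ (r ≤ D.xs (e + 1) → (r, D.ys v) ∈ D.free) ∧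
    ∀ x, r ≤ x → x ≤ D.xs (e + 1) → (x, D.ys v) ∈ D.free → MonoJoined D.free p₀ (x, D.ys v)

include hD

/-- By convexity the segment from the first reachable point of the bottom or left side to `z` stays
in the free space of the cell. It is monotone, because `z` is not before that entry point in the
coordinate along the side. -/
theorem Valid.monoJoined_cell {e v : ℕ} (he : e < N) (hv : v < ℓ)
    (hl : SoundLeft D p₀ e v (D.left e v)) (hb : SoundBottom D p₀ e v (D.bot e v)) {z : ℝ × ℝ}
    (hz : z ∈ D.free ∩ Set.Icc (D.xs e) (D.xs (e + 1)) ×ˢ Set.Icc (D.ys v) (D.ys (v + 1)))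
    (h : D.bot e v ≤ z.1 ∨ D.left e v ≤ z.2) : MonoJoined D.free p₀ z := by
  obtain ⟨hz₁, ⟨hz₂, hz₃⟩, hz₄, hz₅⟩ := id hz
  have mx := hD.xs_mono (Nat.le_succ e)
  have my := hD.ys_mono (Nat.le_succ v)
  rcases h with h | h
  · have f := hb.2.1 (h.trans hz₃)
    refine (hb.2.2 _ le_rfl (h.trans hz₃) f).trans (.of_segment ⟨h, hz₄⟩ ?_)
    exact ((hD.convex e he v hv).segment_subset
      ⟨f, ⟨hb.1, h.trans hz₃⟩, le_rfl, my⟩ hz).trans Set.inter_subset_left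
  · have f := hl.2.1 (h.trans hz₅)
    refine (hl.2.2 _ le_rfl (h.trans hz₅) f).trans (.of_segment ⟨hz₂, h⟩ ?_)
    exact ((hD.convex e he v hv).segment_subset
      ⟨f, ⟨le_rfl, mx⟩, hl.1, h.trans hz₅⟩ hz).trans Set.inter_subset_left

/-- An entry through the bottom side makes every free point of the right side reachable, so the scan
starts at `ys v`. Otherwise the cell can only be entered from the left, and the scan starts at the
height of that entry. -/
theorem Valid.soundLeft_succ {e v : ℕ} (he : e < N) (hv : v < ℓ)
    (hl : SoundLeft D p₀ e v (D.left e v)) (hb : SoundBottom D p₀ e v (D.bot e v)) :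
    SoundLeft D p₀ (e + 1) v (D.left (e + 1) v) := by
  have mx := hD.xs_mono (Nat.le_succ e)
  have my := hD.ys_mono (Nat.le_succ v)
  set c := if D.bot e v ≤ D.xs (e + 1) then D.ys v else D.left e v with hc
  have hcv : D.ys v ≤ c := by
    rw [hc]
    split_ifs
    · exact le_rfl
    · exact hl.1
  have first := hD.right e he v hv c
  rw [left_succ, ← hc]
  have hr := first.le hcv my
  refine ⟨hr, fun h => (first.1 hcv h).2, fun y h₁ h₂ h₃ => ?_⟩
  refine hD.monoJoined_cell he hv hl hb (z := (D.xs (e + 1), y))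
    ⟨h₃, ⟨mx, le_rfl⟩, hr.trans h₁, h₂⟩ ?_
  by_cases hB : D.bot e v ≤ D.xs (e + 1)
  · exact Or.inl hB
  · rw [if_neg hB] at hc
    exact Or.inr (hc ▸ (first.1 hcv (h₁.trans h₂)).1.trans h₁)

theorem Valid.soundBottom_succ {e v : ℕ} (he : e < N) (hv : v < ℓ)
    (hl : SoundLeft D p₀ e v (D.left e v)) (hb : SoundBottom D p₀ e v (D.bot e v)) :
    SoundBottom D p₀ e (v + 1) (D.bot e (v + 1)) := by
  have mx := hD.xs_mono (Nat.le_succ e)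
  have my := hD.ys_mono (Nat.le_succ v)
  set c := if D.left e v ≤ D.ys (v + 1) then D.xs e else D.bot e v with hc
  have hcv : D.xs e ≤ c := by
    rw [hc]
    split_ifs
    · exact le_rfl
    · exact hb.1
  have first := hD.top e he v hv c
  rw [bot_succ, ← hc]
  have hr := first.le hcv mx
  refine ⟨hr, fun h => (first.1 hcv h).2, fun x h₁ h₂ h₃ => ?_⟩
  refine hD.monoJoined_cell he hv hl hb (z := (x, D.ys (v + 1)))
    ⟨h₃, ⟨hr.trans h₁, h₂⟩, my, le_rfl⟩ ?_
  by_cases hL : D.left e v ≤ D.ys (v + 1)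
  · exact Or.inr hL
  · rw [if_neg hL] at hc
    exact Or.inl (hc ▸ (first.1 hcv (h₁.trans h₂)).1.trans h₁)

/-- Induction over the columns, and over the rows inside a column. The left sides of column 0 are
sound vacuously, since their recorded value lies beyond the side. -/
theorem Valid.sound_left_bottom (hbase : ∀ e < N, SoundBottom D p₀ e 0 (D.base e)) {e : ℕ} :
    (e ≤ N → ∀ v < ℓ, SoundLeft D p₀ e v (D.left e v)) ∧
      (e < N → ∀ v ≤ ℓ, SoundBottom D p₀ e v (D.bot e v)) := by
  have colB : ∀ e < N, (∀ v < ℓ, SoundLeft D p₀ e v (D.left e v)) →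
      ∀ v ≤ ℓ, SoundBottom D p₀ e v (D.bot e v) := by
    intro e he hl v
    induction v with
    | zero => exact fun _ => hbase e he
    | succ v ih => exact fun hv => hD.soundBottom_succ he hv (hl v hv) (ih (by omega))
  have colL : ∀ e, e ≤ N → ∀ v < ℓ, SoundLeft D p₀ e v (D.left e v) := by
    intro e
    induction e with
    | zero =>
      intro _ v _
      have my := hD.ys_mono (Nat.le_succ v)
      rw [left_zero]
      exact ⟨by linarith, fun h => absurd h (by simp), fun y h₁ h₂ => by linarith⟩
    | succ e ih =>
      intro he v hv
      exact hD.soundLeft_succ he hv (ih (by omega) v hv) (colB e he (ih (by omega)) v hv.le)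
  exact ⟨colL e, fun he => colB e he (colL e he.le)⟩

end Soundness

/-! ### Completeness: a chain in the free space is never missed -/

section Completeness

omit hD in
-- For `x < z.1` a chain point over `x` cannot dominate `z`, so it must lie below `z`. For `x = z.1`
-- the point `z` itself serves.
theorem chain_below {Γ : Set (ℝ × ℝ)} (chain : ∀ p ∈ Γ, ∀ q ∈ Γ, p ≤ q ∨ q ≤ p) {z : ℝ × ℝ}
    (hz : z ∈ Γ) {x : ℝ} (hx : x ≤ z.1) (ex : ∃ y, (x, y) ∈ Γ) : ∃ y, (x, y) ∈ Γ ∧ y ≤ z.2 := by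
  rcases hx.eq_or_lt with h | h
  · exact ⟨z.2, by rw [h]; exact hz, le_rfl⟩
  · obtain ⟨y, hy⟩ := ex
    refine ⟨y, hy, ?_⟩
    rcases chain _ hy _ hz with h' | h'
    · exact h'.2
    · exact absurd h'.1 (not_le.2 h)

omit hD in
theorem chain_left {Γ : Set (ℝ × ℝ)} (chain : ∀ p ∈ Γ, ∀ q ∈ Γ, p ≤ q ∨ q ≤ p) {z : ℝ × ℝ}
    (hz : z ∈ Γ) {y : ℝ} (hy : y ≤ z.2) (ex : ∃ x, (x, y) ∈ Γ) : ∃ x, (x, y) ∈ Γ ∧ x ≤ z.1 := by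
  rcases hy.eq_or_lt with h | h
  · exact ⟨z.1, by rw [h]; exact hz, le_rfl⟩
  · obtain ⟨x, hx⟩ := ex
    refine ⟨x, hx, ?_⟩
    rcases chain _ hx _ hz with h' | h'
    · exact h'.1
    · exact absurd h'.2 (not_le.2 h)

include hD

/-- Induction over antidiagonals of cells. The chain need not be connected; totality on both sides
replaces the argument that a path must cross the border of the cell. A chain point on the line `xs
e`, not above `z`, either lies on the left side of the cell, or lies below the row. In the latter
case the chain meets the line `ys v` not before `xs e`, hence on the bottom side. -/
theorem Valid.complete_cell {a b : ℝ} {Γ : Set (ℝ × ℝ)} (chain : ∀ p ∈ Γ, ∀ q ∈ Γ, p ≤ q ∨ q ≤ p)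
    (hΓ : ∀ p ∈ Γ, p.1 ∈ Set.Icc a b ∧ p.2 ∈ Set.Icc (D.ys 0) (D.ys ℓ))
    (hf : Γ ⊆ D.free) (tx : ∀ x ∈ Set.Icc a b, ∃ y, (x, y) ∈ Γ)
    (ty : ∀ y ∈ Set.Icc (D.ys 0) (D.ys ℓ), ∃ x, (x, y) ∈ Γ) {e₀ : ℕ}
    (h₁ : D.xs e₀ ≤ a) (h₂ : a ≤ D.xs (e₀ + 1)) (hbase : D.base e₀ = a) (k : ℕ) :
    ∀ e v : ℕ, e + v = k → e₀ ≤ e → e < N → v < ℓ → ∀ z ∈ Γ,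
      z ∈ Set.Icc (D.xs e) (D.xs (e + 1)) ×ˢ Set.Icc (D.ys v) (D.ys (v + 1)) →
      D.bot e v ≤ z.1 ∨ D.left e v ≤ z.2 := by
  induction k with
  | zero =>
    intro e v hk he _ hv z hz hc
    obtain rfl : e = e₀ := by omega
    obtain rfl : v = 0 := by omega
    rw [bot_zero, hbase]
    exact Or.inl (hΓ z hz).1.1
  | succ k ih =>
    intro e v hk he heN hv z hz hc
    obtain ⟨⟨c₁, c₂⟩, c₃, c₄⟩ := hc
    -- A chain point on the bottom side also lies on the top side of the cell below, to which the
    -- induction hypothesis applies.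
    have fromBottom : 0 < v → (∀ x, (x, D.ys v) ∈ Γ → x ≤ z.1 → D.xs e ≤ x) →
        D.bot e v ≤ z.1 := by
      intro hv0 hx
      obtain ⟨v, rfl⟩ : ∃ w, v = w + 1 := ⟨v - 1, by omega⟩
      obtain ⟨x, hx₁, hx₂⟩ := chain_left chain hz c₃
        (ty _ ⟨hD.ys_mono (Nat.zero_le _), hD.ys_mono hv.le⟩)
      have hx₃ : D.xs e ≤ x := hx _ hx₁ hx₂
      have := ih e v (by omega) he heN (by omega) _ hx₁
        ⟨⟨hx₃, hx₂.trans c₂⟩, hD.ys_mono (Nat.le_succ v), le_rfl⟩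
      refine le_trans ?_ hx₂
      rw [bot_succ]
      refine (hD.top e heN v (by omega) _).2 x hx₃ ?_ (hx₂.trans c₂) (hf hx₁)
      split_ifs with hL
      · exact hx₃
      · exact this.resolve_right hL
    -- In the starting column the whole chain lies to the right of `a`, so entries through bottom
    -- sides suffice. This is why nothing need be recorded on the left sides of column 0.
    rcases he.eq_or_lt with rfl | he'
    · rcases Nat.eq_zero_or_pos v with rfl | hv0
      · rw [bot_zero, hbase]
        exact Or.inl (hΓ z hz).1.1
      · exact Or.inl (fromBottom hv0 fun x hxy _ => h₁.trans (hΓ _ hxy).1.1)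
    · obtain ⟨y, hy₁, hy₂⟩ := chain_below chain hz c₁
        (tx _ ⟨h₂.trans (hD.xs_mono (by omega)), c₁.trans (hΓ z hz).1.2⟩)
      rcases le_or_gt (D.ys v) y with h | h
      · obtain ⟨e, rfl⟩ : ∃ w, e = w + 1 := ⟨e - 1, by omega⟩
        have := ih e v (by omega) (by omega) (by omega) hv _ hy₁
          ⟨⟨hD.xs_mono (Nat.le_succ e), le_rfl⟩, h, hy₂.trans c₄⟩
        refine Or.inr (le_trans ?_ hy₂)
        rw [left_succ]
        refine (hD.right e (by omega) v hv _).2 y h ?_ (hy₂.trans c₄) (hf hy₁)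
        split_ifs with hB
        · exact h
        · exact this.resolve_left hB
      · refine Or.inl (fromBottom ?_ fun x hx _ => ?_)
        · rcases Nat.eq_zero_or_pos v with rfl | hv0
          · exact absurd (hΓ _ hy₁).2.1 (not_le.2 h)
          · exact hv0
        · rcases chain _ hx _ hy₁ with h' | h'
          · exact absurd h'.2 (not_le.2 h)
          · exact h'.1

/-- The free space diagram decides reachability along the top line. -/
theorem Valid.bot_le_of_chain {a b : ℝ} {Γ : Set (ℝ × ℝ)}
    (chain : ∀ p ∈ Γ, ∀ q ∈ Γ, p ≤ q ∨ q ≤ p)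
    (hΓ : ∀ p ∈ Γ, p.1 ∈ Set.Icc a b ∧ p.2 ∈ Set.Icc (D.ys 0) (D.ys ℓ))
    (hf : Γ ⊆ D.free) (tx : ∀ x ∈ Set.Icc a b, ∃ y, (x, y) ∈ Γ)
    (ty : ∀ y ∈ Set.Icc (D.ys 0) (D.ys ℓ), ∃ x, (x, y) ∈ Γ) {e₀ e : ℕ}
    (h₁ : D.xs e₀ ≤ a) (h₂ : a ≤ D.xs (e₀ + 1)) (hbase : D.base e₀ = a) (he : e₀ ≤ e)
    (heN : e < N) (hℓ : 0 < ℓ) (h₃ : D.xs e ≤ b) (h₄ : b ≤ D.xs (e + 1))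
    (hb : (b, D.ys ℓ) ∈ Γ) : D.bot e ℓ ≤ b := by
  obtain ⟨v, rfl⟩ : ∃ v, ℓ = v + 1 := ⟨ℓ - 1, by omega⟩
  have := hD.complete_cell chain hΓ hf tx ty h₁ h₂ hbase _ e v rfl he heN (by omega) _ hb
    ⟨⟨h₃, h₄⟩, hD.ys_mono (Nat.le_succ v), le_rfl⟩
  rw [bot_succ]
  refine (hD.top e heN v (by omega) _).2 b h₃ ?_ h₄ (hf hb)
  split_ifs with hL
  · exact h₃
  · exact this.resolve_right hL

end Completeness

end FreeSpace

/-! ### The first free point on an edge -/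

/-- The coordinates of a point, indexed by natural numbers. -/
def coord {d : ℕ} (A : Pt d) (c : ℕ) : ℝ := if h : c < d then A ⟨c, h⟩ else 0

/-- The first root `≥ c` of the condition `α x² + 2 β x + γ ≤ 0` on `(-∞, hi]`, or `hi + 1`. -/
def firstRoot (α β γ c hi : ℝ) : ℝ :=
  open Classical in
  if c ≤ hi ∧ α * c * c + 2 * β * c + γ ≤ 0 then c
  else if (0 < α ∧ α * γ ≤ β * β) ∧ (c ≤ (0 - β - √(β * β - α * γ)) / α ∧
      (0 - β - √(β * β - α * γ)) / α ≤ hi) then (0 - β - √(β * β - α * γ)) / α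
  else hi + 1

/-- The solutions of a convex quadratic inequality form an interval. So the first solution from `c`
on is `c` itself or the smaller root. For `α = 0` the quadratic is constant by `hβ`, and only `c`
can be the answer. -/
theorem isFirst_firstRoot {α β γ : ℝ} (hα : 0 ≤ α) (hβ : α = 0 → β = 0) (c lo hi : ℝ) :
    IsFirst (fun x => α * x * x + 2 * β * x + γ ≤ 0) lo hi c (firstRoot α β γ c hi) := by
  set ρ := (0 - β - √(β * β - α * γ)) / α with hρ
  constructor
  · intro _ hr
    unfold firstRoot at hr ⊢
    rw [← hρ] at hr ⊢
    split_ifs at hr ⊢ with h₁ h₂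
    · exact ⟨le_rfl, h₁.2⟩
    · refine ⟨h₂.2.1, ?_⟩
      have hs := Real.mul_self_sqrt (show 0 ≤ β * β - α * γ by linarith [h₂.1.2])
      have e : α * ρ = 0 - β - √(β * β - α * γ) := by
        rw [hρ]
        field_simp [h₂.1.1.ne']
      have : α * (α * ρ * ρ + 2 * β * ρ + γ) = 0 := by
        have : α * (α * ρ * ρ + 2 * β * ρ + γ) =
          (α * ρ) * (α * ρ) + 2 * β * (α * ρ) + α * γ := by ring
        rw [this, e]
        linarith
      exact ((mul_eq_zero.1 this).resolve_left h₂.1.1.ne').le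
    · linarith
  · intro x _ hcx hx hp
    unfold firstRoot
    rw [← hρ]
    split_ifs with h₁ h₂
    · exact hcx
    · have e : α * ρ = 0 - β - √(β * β - α * γ) := by
        rw [hρ]
        field_simp [h₂.1.1.ne']
      by_contra hlt
      push Not at hlt
      have hs := Real.mul_self_sqrt (show 0 ≤ β * β - α * γ by linarith [h₂.1.2])
      have hs0 := Real.sqrt_nonneg (β * β - α * γ)
      have : α * x < α * ρ := by nlinarith [h₂.1.1]
      have hneg : √(β * β - α * γ) < -(α * x + β) := by linarith
      have : α * (α * x * x + 2 * β * x + γ) ≤ 0 := by nlinarith [h₂.1.1]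
      nlinarith
    · exfalso
      have hc : 0 < α * c * c + 2 * β * c + γ := by
        by_contra h
        exact h₁ ⟨hcx.trans hx, not_lt.1 h⟩
      rcases hα.eq_or_lt with h0 | h0
      · have := hβ h0.symm
        rw [← h0, this] at hp hc
        linarith
      -- After multiplication by `α` the inequality reads `(α x + β)² ≤ β² - α γ`. It holds at `x`
      -- and fails at `c ≤ x`, so `c` is left of the smaller root and the second branch would have
      -- been taken.
      · have hx' : α * (α * x * x + 2 * β * x + γ) ≤ 0 := by nlinarith
        have hc' : 0 < α * (α * c * c + 2 * β * c + γ) := by positivity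
        have hdisc : 0 ≤ β * β - α * γ := by nlinarith [mul_self_nonneg (α * x + β)]
        have hs := Real.mul_self_sqrt hdisc
        have hs0 := Real.sqrt_nonneg (β * β - α * γ)
        have e : α * ρ = 0 - β - √(β * β - α * γ) := by
          rw [hρ]
          field_simp [h0.ne']
        have g₁ : -√(β * β - α * γ) ≤ α * x + β := by
          by_contra h
          push Not at h
          nlinarith
        have g₂ : α * x + β ≤ √(β * β - α * γ) := by
          by_contra h
          push Not at h
          nlinarith
        have hcx' : α * c ≤ α * x := by nlinarith
        have g₃ : α * c + β < -√(β * β - α * γ) := by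
          by_contra h
          push Not at h
          nlinarith
        refine h₂ ⟨⟨h0, by linarith⟩, ?_, ?_⟩
        · have : α * c ≤ α * ρ := by linarith
          exact le_of_mul_le_mul_left this h0
        · have : α * ρ ≤ α * x := by linarith
          exact (le_of_mul_le_mul_left this h0).trans hx

/-- The slope of a coordinate along an edge. -/
def slope (P₀ P₁ : ℕ → ℝ) (k₀ k₁ : ℝ) (c : ℕ) : ℝ := (P₁ c - P₀ c) / (k₁ - k₀)

/-- A coordinate of the difference of the line through an edge, at the parameter `0`, and `A`. -/
def offset (A P₀ P₁ : ℕ → ℝ) (k₀ k₁ : ℝ) (c : ℕ) : ℝ := P₀ c - A c - k₀ * slope P₀ P₁ k₀ k₁ c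

/-- The leading coefficient of the squared distance to a point along an edge. -/
def quadA (d : ℕ) (P₀ P₁ : ℕ → ℝ) (k₀ k₁ : ℝ) : ℝ :=
  ∑ c ∈ Finset.range d, slope P₀ P₁ k₀ k₁ c * slope P₀ P₁ k₀ k₁ c

/-- Half of the linear coefficient of the squared distance to a point along an edge. -/
def quadB (d : ℕ) (A P₀ P₁ : ℕ → ℝ) (k₀ k₁ : ℝ) : ℝ :=
  ∑ c ∈ Finset.range d, offset A P₀ P₁ k₀ k₁ c * slope P₀ P₁ k₀ k₁ c

/-- The constant coefficient of the squared distance to a point along an edge, minus `δ²`. -/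
def quadC (d : ℕ) (δ : ℝ) (A P₀ P₁ : ℕ → ℝ) (k₀ k₁ : ℝ) : ℝ :=
  ∑ c ∈ Finset.range d, offset A P₀ P₁ k₀ k₁ c * offset A P₀ P₁ k₀ k₁ c - δ * δ

/-- The squared distance to the point `A` along an edge, minus `δ²`. -/
def quad (d : ℕ) (δ : ℝ) (A P₀ P₁ : ℕ → ℝ) (k₀ k₁ x : ℝ) : ℝ :=
  quadA d P₀ P₁ k₀ k₁ * x * x + 2 * quadB d A P₀ P₁ k₀ k₁ * x + quadC d δ A P₀ P₁ k₀ k₁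

/-- The first parameter `≥ c` on an edge at which the distance to `A` is at most `δ`. -/
def firstNear (d : ℕ) (δ : ℝ) (A P₀ P₁ : ℕ → ℝ) (k₀ k₁ c : ℝ) : ℝ :=
  firstRoot (quadA d P₀ P₁ k₀ k₁) (quadB d A P₀ P₁ k₀ k₁) (quadC d δ A P₀ P₁ k₀ k₁) c k₁

theorem quad_nonpos_iff {d : ℕ} {δ : ℝ} (hδ : 0 ≤ δ) (A P₀ P₁ : Pt d) (k₀ k₁ x : ℝ) :
    quad d δ (coord A) (coord P₀) (coord P₁) k₀ k₁ x ≤ 0 ↔ dist (lineAt k₀ k₁ P₀ P₁ x) A ≤ δ := by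
  have e : quad d δ (coord A) (coord P₀) (coord P₁) k₀ k₁ x =
      dist (lineAt k₀ k₁ P₀ P₁ x) A ^ 2 - δ ^ 2 := by
    have co : ∀ (B : Pt d) (c : Fin d), coord B c = B c := fun B c => dif_pos c.2
    rw [EuclideanSpace.dist_sq_eq, quad, quadA, quadB, quadC]
    simp only [Finset.sum_range, mul_assoc, Finset.sum_mul, Finset.mul_sum]
    rw [← add_sub_assoc, ← Finset.sum_add_distrib, ← Finset.sum_add_distrib, sq δ]
    congr 1
    refine Finset.sum_congr rfl fun c _ => ?_
    simp only [Real.dist_eq, sq_abs, offset, slope, co, lineAt, PiLp.add_apply, PiLp.smul_apply,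
      PiLp.sub_apply, smul_eq_mul]
    ring
  rw [e, sub_nonpos, sq_le_sq₀ dist_nonneg hδ]

theorem isFirst_firstNear {d : ℕ} {δ : ℝ} (hδ : 0 ≤ δ) (A P₀ P₁ : Pt d) (k₀ k₁ lo c : ℝ) :
    IsFirst (fun x => dist (lineAt k₀ k₁ P₀ P₁ x) A ≤ δ) lo k₁ c
      (firstNear d δ (coord A) (coord P₀) (coord P₁) k₀ k₁ c) := by
  simp only [← quad_nonpos_iff hδ]
  refine isFirst_firstRoot (Finset.sum_nonneg fun _ _ => mul_self_nonneg _) (fun h => ?_) _ _ _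
  -- The leading coefficient is a sum of squares of the slopes; if it vanishes, all slopes do, and
  -- with them the linear coefficient.
  have := (Finset.sum_eq_zero_iff_of_nonneg fun _ _ => mul_self_nonneg _).1 h
  refine Finset.sum_eq_zero fun i hi => ?_
  rw [mul_self_eq_zero.1 (this i hi), mul_zero]

/-! ### The free space diagram of a trajectory and a center -/

/-- `f` interpolates the points `π e` linearly between the knots `κ e`, for `e ≤ N`. -/
structure Interpolates {d : ℕ} (f : ℝ → Pt d) (κ : ℕ → ℝ) (π : ℕ → Pt d) (N : ℕ) : Prop where
  mono : Monotone κ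
  line : ∀ e < N, ∀ x, κ e ≤ x → x ≤ κ (e + 1) → f x = lineAt (κ e) (κ (e + 1)) (π e) (π (e + 1)) x
  at_knot : ∀ e ≤ N, f (κ e) = π e

theorem lineAt_left {d : ℕ} (k₀ k₁ : ℝ) (P₀ P₁ : Pt d) : lineAt k₀ k₁ P₀ P₁ k₀ = P₀ := by
  simp [lineAt]

theorem lineAt_same {d : ℕ} (k₀ k₁ : ℝ) (P₀ : Pt d) (x : ℝ) : lineAt k₀ k₁ P₀ P₀ x = P₀ := by
  simp [lineAt]

theorem vtx_last {d n : ℕ} (p : Fin n → Pt d) (hn : 0 < n) : vtx p (n - 1 + 1) = vtx p (n - 1) := by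
  rw [vtx, vtx, dif_pos hn, dif_pos hn]
  congr 2
  omega

theorem interpolates_polygonal {d n : ℕ} (p : Fin n → Pt d) (s : Fin n → ℝ) (hs : Monotone s)
    (hc : ∀ i j, s i = s j → p i = p j) {last : ℝ} (hl : ∀ i, s i ≤ last) (hn : 0 < n) :
    Interpolates (polygonal p s) (knot s last) (vtx p) n := by
  have mono := knot_monotone hs hl
  refine ⟨mono, fun e he x h₁ h₂ => polygonal_eq_lineAt p s hs hc last he h₁ h₂, fun e he => ?_⟩
  rcases he.lt_or_eq with he | rfl
  · rw [polygonal_eq_lineAt p s hs hc last he le_rfl (mono (Nat.le_succ e)), lineAt_left]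
  · have h : knot s last (e - 1 + 1) = knot s last e := by
      congr 1
      omega
    have h' : vtx p e = vtx p (e - 1 + 1) := by
      congr 1
      omega
    rw [polygonal_eq_lineAt p s hs hc last (e := e - 1) (by omega) (mono (by omega)) h.ge,
      vtx_last p hn, lineAt_same, h', vtx_last p hn]

/-- The curve `q` parametrized over `[0, ℓ]`, each edge taking one unit of time, and staying at the
last vertex from the time `ℓ - 1` on. -/
def unitCurve {d ℓ : ℕ} (q : PolyCurve d ℓ) : ℝ → Pt d := polygonal q fun i => (i : ℝ)

/-- The final knot `ℓ` appends a constant edge on `[ℓ - 1, ℓ]`. Every curve, even one with a single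
vertex, then has `ℓ` edges of unit length, and its diagram has at least one row. -/
theorem interpolates_unitCurve {d ℓ : ℕ} (q : PolyCurve d ℓ) (hℓ : 0 < ℓ) :
    Interpolates (unitCurve q) (fun v => (v : ℝ)) (vtx q) ℓ := by
  have h := interpolates_polygonal q (fun i => (i : ℝ)) (fun i j h => by simpa using h)
    (fun i j h => by rw [Fin.ext (Nat.cast_injective (R := ℝ) h)]) (last := (ℓ : ℝ))
    (fun i => by exact_mod_cast i.2.le) hℓ
  have e : ∀ v ≤ ℓ, knot (fun i : Fin ℓ => (i : ℝ)) (ℓ : ℝ) v = v := by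
    intro v hv
    unfold knot
    split_ifs with h
    · rfl
    · congr 1
      omega
  refine ⟨Nat.mono_cast, fun v hv x h₁ h₂ => ?_, fun v hv => ?_⟩
  · have := h.line v hv x
    rw [e v hv.le, e (v + 1) hv] at this
    exact this h₁ h₂
  · have := h.at_knot v hv
    rwa [e v hv] at this

theorem unitCurve_of_last {d ℓ : ℕ} (q : PolyCurve d ℓ) (hℓ : 0 < ℓ) {y : ℝ}
    (h₁ : (ℓ : ℝ) - 1 ≤ y) (h₂ : y ≤ ℓ) : unitCurve q y = vtx q ℓ := by
  have e₁ : ((ℓ - 1 : ℕ) : ℝ) = (ℓ : ℝ) - 1 := by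
    rw [Nat.cast_sub hℓ, Nat.cast_one]
  have e₂ : ℓ - 1 + 1 = ℓ := by omega
  have := (interpolates_unitCurve q hℓ).line (ℓ - 1) (by omega) y (by rw [e₁]; exact h₁)
    (by rw [e₂]; exact h₂)
  rw [this, vtx_last q hℓ, lineAt_same, ← vtx_last q hℓ, e₂]

theorem toCurve_eq_unitCurve {d ℓ : ℕ} (q : PolyCurve d ℓ) (y : ℝ) :
    q.toCurve y = unitCurve q (((ℓ : ℝ) - 1) * y) := by
  unfold PolyCurve.toCurve unitCurve polygonal
  congr 1
  refine Finset.sum_congr rfl fun i _ => ?_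
  -- An edge index exists only for `ℓ ≥ 2`; for `ℓ = 1` both sums are empty and the division by 0
  -- does not matter.
  have h : (0 : ℝ) < (ℓ : ℝ) - 1 := by
    have h₀ : 1 < ℓ := by have := i.2; omega
    have : (1 : ℝ) < ℓ := by exact_mod_cast h₀
    linarith
  congr 2
  push_cast
  field_simp

namespace Trajectory

variable {d n m ℓ : ℕ} (P : Trajectory d n m)

/-- The parameters of the vertices, followed by `1`. -/
def xs : ℕ → ℝ := knot P.param 1

/-- The breakpoints, indexed by natural numbers. -/
def time (j : ℕ) : ℝ := if h : j < m then P.bp ⟨j, h⟩ else 0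

open Classical in
/-- The last edge that starts not after the breakpoint `j`. -/
def col (j : ℕ) : ℕ := Nat.findGreatest (fun e => P.xs e ≤ P.time j) (n - 1)

/-- The squared distance of `P` at the parameter `x` on the edge `e` to a point, minus `δ²`. -/
def edgeQuad (δ : ℝ) (A : Pt d) (e : ℕ) (x : ℝ) : ℝ :=
  quad d δ (coord A) (coord (vtx P.vertex e)) (coord (vtx P.vertex (e + 1)))
    (P.xs e) (P.xs (e + 1)) x

open Classical in
/-- The free space diagram of the part of `P` that starts at the breakpoint `i` and of `q`. -/
def diagram (q : PolyCurve d ℓ) (δ : ℝ) (i : ℕ) : FreeSpace where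
  xs := P.xs
  ys v := v
  free := {p | dist (P.curve p.1) (unitCurve q p.2) ≤ δ}
  lowR e v c := firstNear d δ (coord (vtx P.vertex (e + 1))) (coord (vtx q v))
    (coord (vtx q (v + 1))) v (v + 1 : ℕ) c
  lowT e v c := firstNear d δ (coord (vtx q (v + 1))) (coord (vtx P.vertex e))
    (coord (vtx P.vertex (e + 1))) (P.xs e) (P.xs (e + 1)) c
  base e := if e = P.col i ∧ P.edgeQuad δ (vtx q 0) e (P.time i) ≤ 0 then P.time i
    else P.xs (e + 1) + 1

/-- The test whether the subcurve between the breakpoints `i` and `j` has distance at most `δ`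
to `q`. -/
def Near (q : PolyCurve d ℓ) (δ : ℝ) (i j : ℕ) : Prop :=
  (P.diagram q δ i).bot (P.col j) ℓ ≤ P.time j ∧ P.edgeQuad δ (vtx q ℓ) (P.col j) (P.time j) ≤ 0

theorem param_le_one (i : Fin n) : P.param i ≤ 1 := by
  rcases Nat.lt_or_ge 1 n with h | h
  · rw [← P.param_last h]
    exact P.param_mono (Fin.mk_le_mk.2 (by omega))
  · have : i = ⟨0, P.n_pos⟩ := Fin.ext (by simp; omega)
    rw [this, P.param_first]
    exact zero_le_one

theorem interpolates_curve : Interpolates P.curve P.xs (vtx P.vertex) n :=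
  interpolates_polygonal P.vertex P.param P.param_mono P.param_consistent P.param_le_one P.n_pos

theorem xs_zero : P.xs 0 = 0 := by
  rw [xs, knot, dif_pos P.n_pos, P.param_first]

theorem xs_last : P.xs n = 1 := by
  rw [xs, knot, dif_neg (lt_irrefl n)]

theorem time_mem (j : ℕ) : 0 ≤ P.time j ∧ P.time j ≤ 1 := by
  unfold time
  split_ifs with h
  · rw [← P.bp_first, ← P.bp_last]
    exact ⟨P.bp_strictMono.monotone (Fin.mk_le_mk.2 (by omega)),
      P.bp_strictMono.monotone (Fin.mk_le_mk.2 (by omega))⟩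
  · exact ⟨le_rfl, zero_le_one⟩

theorem time_lt {i j : ℕ} (hij : i < j) (hj : j < m) : P.time i < P.time j := by
  rw [time, time, dif_pos hj, dif_pos (hij.trans hj)]
  exact P.bp_strictMono (Fin.mk_lt_mk.2 hij)

theorem col_lt (j : ℕ) : P.col j < n := by
  classical
  have := Nat.findGreatest_le (P := fun e => P.xs e ≤ P.time j) (n - 1)
  have := P.n_pos
  unfold col
  omega

theorem xs_col_le (j : ℕ) : P.xs (P.col j) ≤ P.time j := by
  classical
  refine Nat.findGreatest_spec (P := fun e => P.xs e ≤ P.time j) (Nat.zero_le (n - 1)) ?_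
  rw [xs_zero]
  exact (P.time_mem j).1

theorem le_xs_col (j : ℕ) : P.time j ≤ P.xs (P.col j + 1) := by
  classical
  by_contra h
  push Not at h
  rcases Nat.lt_or_ge (P.col j + 1) n with h' | h'
  · have := Nat.le_findGreatest (P := fun e => P.xs e ≤ P.time j) (n := n - 1) (by omega) h.le
    unfold col at this
    omega
  · have : P.col j + 1 = n := le_antisymm (P.col_lt j) h'
    rw [this, xs_last] at h
    exact absurd (P.time_mem j).2 (not_le.2 h)

theorem col_mono {i j : ℕ} (h : P.time i ≤ P.time j) : P.col i ≤ P.col j := by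
  classical
  refine Nat.le_findGreatest ?_ ((P.xs_col_le i).trans h)
  have := P.col_lt i
  omega

theorem edgeQuad_nonpos_iff {δ : ℝ} (hδ : 0 ≤ δ) (A : Pt d) (j : ℕ) :
    P.edgeQuad δ A (P.col j) (P.time j) ≤ 0 ↔ dist (P.curve (P.time j)) A ≤ δ := by
  rw [edgeQuad, quad_nonpos_iff hδ, P.interpolates_curve.line _ (P.col_lt j) _
    (P.xs_col_le j) (P.le_xs_col j)]

/-- On a cell both curves are affine, so their difference is an affine function of the two
parameters and its norm is convex. On a side of the cell one of the two curves rests at a vertex,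
which leads to the point-to-edge problem solved by `firstNear`. -/
theorem valid_diagram (q : PolyCurve d ℓ) (hℓ : 0 < ℓ) {δ : ℝ} (hδ : 0 ≤ δ) (i : ℕ) :
    (P.diagram q δ i).Valid n ℓ := by
  have hP := P.interpolates_curve
  have hq := interpolates_unitCurve q hℓ
  refine ⟨hP.mono, hq.mono, ?_, ?_, ?_⟩
  · intro e he v hv
    rintro p ⟨p₁, ⟨p₂, p₃⟩, p₄, p₅⟩ r ⟨r₁, ⟨r₂, r₃⟩, r₄, r₅⟩ a b ha hb hab
    have cx := convex_Icc (P.xs e) (P.xs (e + 1)) ⟨p₂, p₃⟩ ⟨r₂, r₃⟩ ha hb hab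
    have cy := convex_Icc (v : ℝ) ((v + 1 : ℕ) : ℝ) ⟨p₄, p₅⟩ ⟨r₄, r₅⟩ ha hb hab
    refine ⟨?_, cx, cy⟩
    simp only [diagram, Set.mem_ofPred_eq, dist_eq_norm] at p₁ r₁ ⊢
    rw [hP.line e he _ p₂ p₃, hq.line v hv _ p₄ p₅] at p₁
    rw [hP.line e he _ r₂ r₃, hq.line v hv _ r₄ r₅] at r₁
    have e₁ := hP.line e he _ cx.1 cx.2
    have e₂ := hq.line v hv _ cy.1 cy.2
    have aff : ∀ (k₀ k₁ x y : ℝ) (P₀ P₁ : Pt d), lineAt k₀ k₁ P₀ P₁ (a • x + b • y) =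
        a • lineAt k₀ k₁ P₀ P₁ x + b • lineAt k₀ k₁ P₀ P₁ y := by
      intro k₀ k₁ x y P₀ P₁
      have hb' : b = 1 - a := by linarith
      subst hb'
      have : (a • x + (1 - a) • y - k₀) / (k₁ - k₀) =
          a * ((x - k₀) / (k₁ - k₀)) + (1 - a) * ((y - k₀) / (k₁ - k₀)) := by
        simp only [smul_eq_mul]
        ring
      rw [lineAt, lineAt, lineAt, this]
      module
    change ‖P.curve (a • p.1 + b • r.1) - unitCurve q (a • p.2 + b • r.2)‖ ≤ δ
    rw [e₁, e₂, aff, aff, add_sub_add_comm, ← smul_sub, ← smul_sub]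
    refine (norm_add_le _ _).trans ?_
    rw [norm_smul, norm_smul, Real.norm_of_nonneg ha, Real.norm_of_nonneg hb]
    calc _ ≤ a * δ + b * δ := by gcongr
      _ = δ := by rw [← add_mul, hab, one_mul]
  · intro e he v hv c
    have h := isFirst_firstNear hδ (vtx P.vertex (e + 1)) (vtx q v) (vtx q (v + 1)) v
      ((v + 1 : ℕ) : ℝ) v c
    have hk := hP.at_knot (e + 1) he
    refine ⟨fun hc hr => ?_, fun y h₁ h₂ h₃ h₄ => ?_⟩
    · obtain ⟨g₁, g₂⟩ := h.1 hc hr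
      refine ⟨g₁, ?_⟩
      simp only [diagram, Set.mem_ofPred_eq]
      rwa [hk, hq.line v hv _ (hc.trans g₁) hr, dist_comm]
    · refine h.2 y h₁ h₂ h₃ ?_
      simp only [diagram, Set.mem_ofPred_eq] at h₄
      rwa [hk, hq.line v hv _ h₁ h₃, dist_comm] at h₄
  · intro e he v hv c
    have h := isFirst_firstNear hδ (vtx q (v + 1)) (vtx P.vertex e) (vtx P.vertex (e + 1)) (P.xs e)
      (P.xs (e + 1)) (P.xs e) c
    have hk := hq.at_knot (v + 1) hv
    refine ⟨fun hc hr => ?_, fun y h₁ h₂ h₃ h₄ => ?_⟩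
    · obtain ⟨g₁, g₂⟩ := h.1 hc hr
      refine ⟨g₁, ?_⟩
      simp only [diagram, Set.mem_ofPred_eq]
      rwa [hk, hP.line e he _ (hc.trans g₁) hr]
    · refine h.2 y h₁ h₂ h₃ ?_
      simp only [diagram, Set.mem_ofPred_eq] at h₄
      rwa [hk, hP.line e he _ h₁ h₃] at h₄

theorem unitCurve_zero (q : PolyCurve d ℓ) (hℓ : 0 < ℓ) : unitCurve q 0 = vtx q 0 := by
  simpa using (interpolates_unitCurve q hℓ).at_knot 0 (Nat.zero_le _)

theorem time_fin (i : Fin m) : P.time i = P.bp i := dif_pos i.2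

/-- The bottom line is seeded only in the column of the breakpoint `i`, where convexity joins the
start to every later free point of that bottom side. The remaining columns are reached through their
left sides. -/
theorem monoJoined_of_near (q : PolyCurve d ℓ) (hℓ : 0 < ℓ) {δ : ℝ} (hδ : 0 ≤ δ) {i j : ℕ}
    (h : P.Near q δ i j) :
    MonoJoined {p | dist (P.curve p.1) (unitCurve q p.2) ≤ δ} (P.time i, 0) (P.time j, ℓ) := by
  have hD := P.valid_diagram q hℓ hδ i
  have hbase : ∀ e < n, FreeSpace.SoundBottom (P.diagram q δ i) (P.time i, 0) e 0
      ((P.diagram q δ i).base e) := by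
    intro e he
    have mx := hD.xs_mono (Nat.le_succ e)
    change P.xs e ≤ P.xs (e + 1) at mx
    by_cases hc : e = P.col i ∧ P.edgeQuad δ (vtx q 0) e (P.time i) ≤ 0
    · have hb : (P.diagram q δ i).base e = P.time i := if_pos hc
      obtain ⟨rfl, hc⟩ := hc
      rw [P.edgeQuad_nonpos_iff hδ, ← unitCurve_zero q hℓ] at hc
      have hf : (P.time i, ((0 : ℕ) : ℝ)) ∈ (P.diagram q δ i).free := by
        change dist (P.curve (P.time i)) (unitCurve q ((0 : ℕ) : ℝ)) ≤ δ
        rwa [Nat.cast_zero]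
      rw [hb]
      refine ⟨P.xs_col_le i, fun _ => hf, fun x h₁ h₂ h₃ => ?_⟩
      have := (hD.convex _ (P.col_lt i) 0 hℓ).segment_subset
        (x := (P.time i, ((0 : ℕ) : ℝ))) (y := (x, ((0 : ℕ) : ℝ)))
        ⟨hf, ⟨P.xs_col_le i, P.le_xs_col i⟩, le_rfl, hD.ys_mono zero_le_one⟩
        ⟨h₃, ⟨(P.xs_col_le i).trans h₁, h₂⟩, le_rfl, hD.ys_mono zero_le_one⟩
      rw [← Nat.cast_zero]
      exact MonoJoined.of_segment ⟨h₁, le_rfl⟩ (this.trans Set.inter_subset_left)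
    · have hb : (P.diagram q δ i).base e = P.xs (e + 1) + 1 := if_neg hc
      rw [hb]
      refine ⟨?_, fun h => ?_, fun x h₁ h₂ => ?_⟩
      · change P.xs e ≤ _
        linarith
      · exact absurd h (by simp [diagram])
      · change x ≤ P.xs (e + 1) at h₂
        linarith
  have hb := (hD.sound_left_bottom hbase (e := P.col j)).2 (P.col_lt j) ℓ le_rfl
  -- All free points from `bot` on are reachable; that the end point is itself free is the second
  -- condition of `Near`.
  refine hb.2.2 _ h.1 (P.le_xs_col j) ?_
  have := (P.edgeQuad_nonpos_iff hδ _ _).1 h.2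
  rw [← (interpolates_unitCurve q hℓ).at_knot ℓ le_rfl] at this
  exact this

theorem continuous_sub (i j : Fin m) : Continuous (P.sub i j) := by
  unfold sub subcurve
  exact (continuous_polygonal _ _).comp (by fun_prop)

theorem frechetDist_le_of_near (q : PolyCurve d ℓ) (hℓ : 0 < ℓ) {δ : ℝ} (hδ : 0 ≤ δ) {i j : Fin m}
    (hij : i < j) (h : P.Near q δ i j) :
    frechetDist (P.sub i j) q.toCurve ≤ ENNReal.ofReal δ := by
  obtain ⟨γ, mγ, fγ⟩ : MonoJoined {p | dist (P.curve p.1) (unitCurve q p.2) ≤ δ}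
      (P.bp i, 0) (P.bp j, ℓ) := by
    rw [← time_fin, ← time_fin]
    exact P.monoJoined_of_near q hℓ hδ h
  have lt : P.bp i < P.bp j := P.bp_strictMono hij
  have pos : 0 < P.bp j - P.bp i := by linarith
  have hℓ' : (1 : ℝ) ≤ ℓ := by exact_mod_cast hℓ
  -- The second coordinate of the path runs over `[0, ℓ]`. It is divided by `ℓ - 1` and cut off at
  -- 1, which is harmless because the unit curve rests from `ℓ - 1` on. The maximum avoids a zero
  -- divisor for `ℓ = 1`.
  have hM : (0 : ℝ) < max 1 ((ℓ : ℝ) - 1) := lt_max_of_lt_left one_pos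
  have mem : ∀ t, P.bp i ≤ (γ t).1 ∧ (γ t).1 ≤ P.bp j ∧ 0 ≤ (γ t).2 ∧ (γ t).2 ≤ ℓ := by
    intro t
    have h₀ := mγ (show 0 ≤ t from t.2.1)
    have h₁ := mγ (show t ≤ 1 from t.2.2)
    rw [γ.source] at h₀
    rw [γ.target] at h₁
    exact ⟨h₀.1, h₁.1, h₀.2, h₁.2⟩
  have hx : ∀ t, ((γ t).1 - P.bp i) / (P.bp j - P.bp i) ∈ unitInterval := fun t =>
    ⟨div_nonneg (by linarith [(mem t).1]) pos.le,
      div_le_one_of_le₀ (by linarith [(mem t).2.1]) pos.le⟩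
  have hy : ∀ t, min 1 ((γ t).2 / max 1 ((ℓ : ℝ) - 1)) ∈ unitInterval := fun t =>
    ⟨le_min zero_le_one (div_nonneg (mem t).2.2.1 hM.le), min_le_left _ _⟩
  have tail : ∀ y, 0 ≤ y → y ≤ (ℓ : ℝ) →
      q.toCurve (min 1 (y / max 1 ((ℓ : ℝ) - 1))) = unitCurve q y := by
    intro y h₀ h₁
    rw [toCurve_eq_unitCurve]
    rcases Nat.lt_or_ge 1 ℓ with h2 | h2
    · have h2' : (2 : ℝ) ≤ ℓ := by exact_mod_cast h2
      rw [max_eq_right (by linarith)]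
      rcases le_or_gt ((ℓ : ℝ) - 1) y with h | h
      · rw [unitCurve_of_last q hℓ h h₁, min_eq_left, mul_one]
        · exact unitCurve_of_last q hℓ le_rfl (by linarith)
        · rwa [le_div_iff₀ (by linarith), one_mul]
      · rw [min_eq_right (div_le_one_of_le₀ h.le (by linarith)), mul_div_cancel₀ _ (by linarith)]
    · obtain rfl : ℓ = 1 := by omega
      rw [unitCurve_of_last q hℓ (y := y) (by simpa using h₀) h₁]
      exact unitCurve_of_last q hℓ (by simp) (by simp)
  have cγ : Continuous fun t => γ t := γ.continuous
  refine frechetDist_le_of_monotone (P.continuous_sub i j) (continuous_polygonal q _)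
    (X := fun t => ⟨_, hx t⟩) (Y := fun t => ⟨_, hy t⟩) ?_ ?_ ?_ ?_ ?_ ?_ ?_ ?_ ?_
  · refine Continuous.subtype_mk ?_ _
    fun_prop
  · refine Continuous.subtype_mk ?_ _
    fun_prop
  · intro s t hst
    have := (mγ hst).1
    refine Subtype.mk_le_mk.2 ?_
    gcongr
  · intro s t hst
    have := (mγ hst).2
    refine Subtype.mk_le_mk.2 ?_
    gcongr
  · exact Subtype.ext (by simp)
  · exact Subtype.ext (by simp [div_self pos.ne'])
  · exact Subtype.ext (by simp)
  · refine Subtype.ext ?_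
    change min 1 ((γ 1).2 / max 1 ((ℓ : ℝ) - 1)) = 1
    rw [γ.target, min_eq_left]
    rw [le_div_iff₀ hM, one_mul]
    exact max_le hℓ' (by linarith)
  · intro t
    have h := fγ t
    rw [Set.mem_ofPred_eq] at h
    change dist (P.curve (P.bp i + ((γ t).1 - P.bp i) / (P.bp j - P.bp i) * (P.bp j - P.bp i)))
      (q.toCurve _) ≤ δ
    rw [tail _ (mem t).2.2.1 (mem t).2.2.2, div_mul_cancel₀ _ pos.ne']
    simpa using h

theorem near_of_frechetDist_le (q : PolyCurve d ℓ) (hℓ : 0 < ℓ) {δ : ℝ} (hδ : 0 ≤ δ) {i j : Fin m}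
    (hij : i < j) (h : frechetDist (P.sub i j) q.toCurve ≤ ENNReal.ofReal δ) :
    P.Near q δ i j := by
  have lt : P.bp i < P.bp j := P.bp_strictMono hij
  have hD := P.valid_diagram q hℓ hδ i
  have hq := interpolates_unitCurve q hℓ
  have hℓ' : (1 : ℝ) ≤ ℓ := by exact_mod_cast hℓ
  obtain ⟨Γ, hΓ, chain, hf, h0, h1, tx, ty⟩ := exists_chain_of_frechetDist_le
    (P.continuous_sub i j) (continuous_polygonal q _) hδ h
  have free : ∀ p ∈ Γ, dist (P.curve (P.bp i + p.1 * (P.bp j - P.bp i)))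
      (unitCurve q (((ℓ : ℝ) - 1) * p.2)) ≤ δ := by
    intro p hp
    have := hf p hp
    change dist (P.sub i j p.1) (q.toCurve p.2) ≤ δ at this
    rwa [toCurve_eq_unitCurve] at this
  have free_last : ∀ y, (ℓ : ℝ) - 1 ≤ y → y ≤ ℓ → dist (P.curve (P.bp j)) (unitCurve q y) ≤ δ := by
    intro y h₁ h₂
    have := free _ h1
    rw [mul_one, unitCurve_of_last q hℓ le_rfl (by linarith)] at this
    rw [unitCurve_of_last q hℓ h₁ h₂]
    simpa using this
  -- The rescaled chain ends at height `ℓ - 1`. The vertical segment at `t_j`, along which the unit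
  -- curve rests, continues it to the top line of the diagram.
  let Γ' : Set (ℝ × ℝ) := (fun p : ℝ × ℝ => (P.bp i + p.1 * (P.bp j - P.bp i), ((ℓ : ℝ) - 1) * p.2)) '' Γ ∪
    {p | p.1 = P.bp j ∧ (ℓ : ℝ) - 1 ≤ p.2 ∧ p.2 ≤ ℓ}
  have below : ∀ p ∈ Γ, P.bp i + p.1 * (P.bp j - P.bp i) ≤ P.bp j ∧ ((ℓ : ℝ) - 1) * p.2 ≤ ℓ - 1 := by
    intro p hp
    obtain ⟨⟨a₁, a₂⟩, a₃, a₄⟩ := hΓ p hp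
    constructor <;> nlinarith
  have e₀ : (P.diagram q δ i).ys 0 = 0 := Nat.cast_zero
  have e₁ : (P.diagram q δ i).ys ℓ = ℓ := rfl
  have hbase : (P.diagram q δ i).base (P.col i) = P.bp i := by
    rw [← time_fin]
    refine if_pos ⟨rfl, (P.edgeQuad_nonpos_iff hδ _ _).2 ?_⟩
    have := free _ h0
    rw [time_fin, ← unitCurve_zero q hℓ]
    simpa using this
  constructor
  · rw [time_fin]
    refine hD.bot_le_of_chain (Γ := Γ') (a := P.bp i) (e₀ := P.col i) ?_ ?_ ?_ ?_ ?_ ?_ ?_ hbase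
      ?_ (P.col_lt j) hℓ ?_ ?_ ?_
    · rintro _ (⟨p, hp, rfl⟩ | hp) _ (⟨r, hr, rfl⟩ | hr)
      · rcases chain p hp r hr with h | h
        · refine Or.inl ⟨?_, ?_⟩
          · have := h.1
            dsimp only
            nlinarith
          · have := h.2
            dsimp only
            nlinarith
        · refine Or.inr ⟨?_, ?_⟩
          · have := h.1
            dsimp only
            nlinarith
          · have := h.2
            dsimp only
            nlinarith
      · exact Or.inl ⟨(below p hp).1.trans hr.1.ge, (below p hp).2.trans hr.2.1⟩
      · exact Or.inr ⟨(below r hr).1.trans hp.1.ge, (below r hr).2.trans hp.2.1⟩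
      · exact (le_total _ _).imp (fun h => ⟨(hp.1.trans hr.1.symm).le, h⟩)
          fun h => ⟨(hr.1.trans hp.1.symm).le, h⟩
    · rw [e₀, e₁]
      rintro _ (⟨p, hp, rfl⟩ | hp)
      · obtain ⟨⟨a₁, a₂⟩, a₃, a₄⟩ := hΓ p hp
        have := below p hp
        refine ⟨⟨?_, this.1⟩, ?_, ?_⟩
        · dsimp only
          nlinarith
        · dsimp only
          nlinarith
        · linarith [this.2]
      · refine ⟨⟨?_, hp.1.le⟩, ?_, hp.2.2⟩
        · rw [hp.1]
          exact lt.le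
        · linarith [hp.2.1]
    · rintro _ (⟨p, hp, rfl⟩ | ⟨hp, hp'⟩)
      · exact free p hp
      · change dist _ _ ≤ δ
        rw [hp]
        exact free_last _ hp'.1 hp'.2
    · intro x hx
      have pos : 0 < P.bp j - P.bp i := by linarith
      obtain ⟨y, hy⟩ := tx ((x - P.bp i) / (P.bp j - P.bp i))
        ⟨div_nonneg (by linarith [hx.1]) pos.le, div_le_one_of_le₀ (by linarith [hx.2]) pos.le⟩
      refine ⟨_, Or.inl ⟨_, hy, Prod.ext ?_ rfl⟩⟩
      dsimp only
      rw [div_mul_cancel₀ _ pos.ne']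
      ring
    · rw [e₀, e₁]
      intro y hy
      rcases le_or_gt ((ℓ : ℝ) - 1) y with h | h
      · exact ⟨P.bp j, Or.inr ⟨rfl, h, hy.2⟩⟩
      · have pos : 0 < (ℓ : ℝ) - 1 := by linarith [hy.1]
        obtain ⟨x, hx⟩ := ty (y / ((ℓ : ℝ) - 1))
          ⟨div_nonneg hy.1 pos.le, div_le_one_of_le₀ h.le pos.le⟩
        refine ⟨_, Or.inl ⟨_, hx, Prod.ext rfl ?_⟩⟩
        dsimp only
        rw [mul_div_cancel₀ _ pos.ne']
    · rw [← time_fin]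
      exact P.xs_col_le i
    · rw [← time_fin]
      exact P.le_xs_col i
    · refine P.col_mono ?_
      rw [time_fin, time_fin]
      exact lt.le
    · rw [← time_fin]
      exact P.xs_col_le j
    · rw [← time_fin]
      exact P.le_xs_col j
    · exact Or.inr ⟨rfl, by rw [e₁]; linarith, le_rfl⟩
  · rw [P.edgeQuad_nonpos_iff hδ, time_fin, ← hq.at_knot ℓ le_rfl]
    exact free_last _ (by linarith) le_rfl

end Trajectory

/-! ### Reasoning about programs -/

@[ext]
theorem Store.ext' {σ τ : Store} (h₁ : σ.nat = τ.nat) (h₂ : σ.real = τ.real) : σ = τ := by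
  cases σ
  cases τ
  simp_all

@[simp]
theorem Store.setNat_nat_self (σ : Store) (a : ℕ) (x y : List ℕ) (v : ℕ) :
    (σ.setNat a x v).nat a y = if y = x then v else σ.nat a y := by
  simp [Store.setNat]

@[simp]
theorem Store.setReal_real_self (σ : Store) (a : ℕ) (x y : List ℕ) (v : ℝ) :
    (σ.setReal a x v).real a y = if y = x then v else σ.real a y := by
  simp [Store.setReal]

@[simp]
theorem Store.setNat_nat_of_ne (σ : Store) {a a' : ℕ} (h : a' ≠ a) (x : List ℕ) (v : ℕ) :
    (σ.setNat a x v).nat a' = σ.nat a' := by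
  funext y
  simp [Store.setNat, h]

@[simp]
theorem Store.setReal_real_of_ne (σ : Store) {a a' : ℕ} (h : a' ≠ a) (x : List ℕ) (v : ℝ) :
    (σ.setReal a x v).real a' = σ.real a' := by
  funext y
  simp [Store.setReal, h]

theorem Store.setCurve_real_of_ne {d ℓ : ℕ} (σ : Store) {a a' : ℕ} (h : a' ≠ a)
    (q : PolyCurve d ℓ) : (σ.setCurve a q).real a' = σ.real a' := by
  funext y
  simp only [Store.setCurve]
  split
  · rw [dif_neg (by simp [h])]
  · rfl

/-- The names of the arrays of natural numbers that a program may write. -/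
def Program.natWrites : Program → List ℕ
  | .skip => []
  | .setNat a _ _ => [a]
  | .setReal _ _ _ => []
  | .seq A B => A.natWrites ++ B.natWrites
  | .ite _ A B => A.natWrites ++ B.natWrites
  | .while _ A => A.natWrites
  | .simplify _ _ _ => []

/-- The names of the arrays of real numbers that a program may write. -/
def Program.realWrites : Program → List ℕ
  | .skip => []
  | .setNat _ _ _ => []
  | .setReal a _ _ => [a]
  | .seq A B => A.realWrites ++ B.realWrites
  | .ite _ A B => A.realWrites ++ B.realWrites
  | .while _ A => A.realWrites
  | .simplify _ _ a => [a]

/-- The two memories differ at most in the given arrays. -/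
structure Frame (ns rs : List ℕ) (σ τ : Store) : Prop where
  nat : ∀ a, a ∉ ns → τ.nat a = σ.nat a
  real : ∀ a, a ∉ rs → τ.real a = σ.real a

theorem Frame.refl (ns rs : List ℕ) (σ : Store) : Frame ns rs σ σ :=
  ⟨fun _ _ => rfl, fun _ _ => rfl⟩

theorem Frame.trans {ns rs : List ℕ} {σ τ υ : Store} (h₁ : Frame ns rs σ τ)
    (h₂ : Frame ns rs τ υ) : Frame ns rs σ υ :=
  ⟨fun a ha => (h₂.nat a ha).trans (h₁.nat a ha), fun a ha => (h₂.real a ha).trans (h₁.real a ha)⟩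

theorem Frame.mono {ns rs ns' rs' : List ℕ} {σ τ : Store} (h : Frame ns rs σ τ)
    (h₁ : ns ⊆ ns') (h₂ : rs ⊆ rs') : Frame ns' rs' σ τ :=
  ⟨fun a ha => h.nat a fun h => ha (h₁ h), fun a ha => h.real a fun h => ha (h₂ h)⟩

theorem Frame.setNat (σ : Store) {a : ℕ} {ns : List ℕ} (h : a ∈ ns) (rs : List ℕ) (x : List ℕ)
    (v : ℕ) : Frame ns rs σ (σ.setNat a x v) :=
  ⟨fun _ hb => σ.setNat_nat_of_ne (fun e => hb (by rw [e]; exact h)) x v, fun _ _ => rfl⟩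

theorem Frame.setReal (σ : Store) {a : ℕ} {rs : List ℕ} (h : a ∈ rs) (ns : List ℕ) (x : List ℕ)
    (v : ℝ) : Frame ns rs σ (σ.setReal a x v) :=
  ⟨fun _ _ => rfl, fun _ hb => σ.setReal_real_of_ne (fun e => hb (by rw [e]; exact h)) x v⟩

/-- Facts about arrays that do not occur as targets in the program text survive every run. Since the
lists of targets are computed from the text, non-membership is settled by `rfl`. -/
theorem Runs.frame {d ℓ : ℕ} {S : Subroutine d ℓ} {A : Program} {σ τ : Store} {T : ℕ}
    (h : Runs S A σ τ T) : Frame A.natWrites A.realWrites σ τ := by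
  induction h with
  | skip σ => exact Frame.refl _ _ _
  | setNat σ a idx e => exact Frame.setNat σ (by simp [Program.natWrites]) _ _ _
  | setReal σ a idx e =>
    exact ⟨fun _ _ => rfl, fun b hb => σ.setReal_real_of_ne
      (by simpa [Program.realWrites] using hb) _ _⟩
  | seq _ _ h₁ h₂ =>
    exact (h₁.mono (by simp [Program.natWrites]) (by simp [Program.realWrites])).trans
      (h₂.mono (by simp [Program.natWrites]) (by simp [Program.realWrites]))
  | iteTrue _ _ h => exact h.mono (by simp [Program.natWrites]) (by simp [Program.realWrites])
  | iteFalse _ _ h => exact h.mono (by simp [Program.natWrites]) (by simp [Program.realWrites])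
  | whileTrue _ _ _ h₁ h₂ => exact h₁.trans h₂
  | whileFalse _ => exact Frame.refl _ _ _
  | simplify σ i j a =>
    exact ⟨fun _ _ => rfl, fun b hb => σ.setCurve_real_of_ne
      (by simpa [Program.realWrites] using hb) _⟩

/-- The program halts on `σ` within `T` steps, in a memory with the property `Q`. -/
def Ok {d ℓ : ℕ} (S : Subroutine d ℓ) (A : Program) (σ : Store) (T : ℕ) (Q : Store → Prop) : Prop :=
  ∃ τ T', Runs S A σ τ T' ∧ T' ≤ T ∧ Q τ

section Ok

variable {d ℓ : ℕ} {S : Subroutine d ℓ} {A B : Program} {σ : Store} {T T' : ℕ} {Q R : Store → Prop}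

theorem Ok.mono (h : Ok S A σ T Q) (hT : T ≤ T') (hQ : ∀ τ, Q τ → R τ) : Ok S A σ T' R := by
  obtain ⟨τ, t, h₁, h₂, h₃⟩ := h
  exact ⟨τ, t, h₁, h₂.trans hT, hQ τ h₃⟩

/-- The memory after the program differs from the memory before it only in the arrays written. -/
theorem Ok.frame (h : Ok S A σ T Q) :
    Ok S A σ T fun τ => Frame A.natWrites A.realWrites σ τ ∧ Q τ := by
  obtain ⟨τ, t, h₁, h₂, h₃⟩ := h
  exact ⟨τ, t, h₁, h₂, h₁.frame, h₃⟩

theorem Ok.seq (h₁ : Ok S A σ T Q) (h₂ : ∀ τ, Frame A.natWrites A.realWrites σ τ → Q τ → Ok S B τ T' R) :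
    Ok S (.seq A B) σ (T + T') R := by
  obtain ⟨τ, t, a₁, a₂, a₃⟩ := h₁
  obtain ⟨υ, t', b₁, b₂, b₃⟩ := h₂ τ a₁.frame a₃
  exact ⟨υ, t + t', .seq a₁ b₁, add_le_add a₂ b₂, b₃⟩

theorem Ok.ite {b : BExpr} (h₁ : b.holds σ → Ok S A σ T Q) (h₂ : ¬ b.holds σ → Ok S B σ T Q) :
    Ok S (.ite b A B) σ (b.cost + T) Q := by
  by_cases hb : b.holds σ
  · obtain ⟨τ, t, a₁, a₂, a₃⟩ := h₁ hb
    exact ⟨τ, _, .iteTrue hb a₁, by omega, a₃⟩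
  · obtain ⟨τ, t, a₁, a₂, a₃⟩ := h₂ hb
    exact ⟨τ, _, .iteFalse hb a₁, by omega, a₃⟩

end Ok

/-! ### Straight-line code -/

/-- The effect of a program without loops and calls. -/
def Program.exec : Program → Store → Store
  | .skip, σ => σ
  | .setNat a idx e, σ => σ.setNat a (List.ofFn fun q => (idx q).eval σ) (e.eval σ)
  | .setReal a idx e, σ => σ.setReal a (List.ofFn fun q => (idx q).eval σ) (e.eval σ)
  | .seq A B, σ => B.exec (A.exec σ)
  | .ite b A B, σ => open Classical in if b.holds σ then A.exec σ else B.exec σ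
  | .while _ _, σ => σ
  | .simplify _ _ _, σ => σ

/-- A bound on the number of steps of a program without loops and calls. -/
def Program.steps : Program → ℕ
  | .skip => 1
  | .setNat _ idx e => 1 + ∑ q, (idx q).cost + e.cost
  | .setReal _ idx e => 1 + ∑ q, (idx q).cost + e.cost
  | .seq A B => A.steps + B.steps
  | .ite b A B => b.cost + max A.steps B.steps
  | .while _ _ => 0
  | .simplify _ _ _ => 0

/-- The program has no loops and no calls. -/
def Program.Straight : Program → Prop
  | .skip => True
  | .setNat _ _ _ => True
  | .setReal _ _ _ => True
  | .seq A B => A.Straight ∧ B.Straight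
  | .ite _ A B => A.Straight ∧ B.Straight
  | .while _ _ => False
  | .simplify _ _ _ => False

/-- Verification of loop-free code becomes evaluation of `exec`. The bound `steps` takes the maximum
over branches, so it depends on the program alone and can enter the constants of the time bounds. -/
theorem Ok.straight {d ℓ : ℕ} {S : Subroutine d ℓ} {A : Program} {Q : Store → Prop} {σ : Store}
    (hA : A.Straight) (h : Q (A.exec σ)) : Ok S A σ A.steps Q := by
  suffices ∀ σ, ∃ T ≤ A.steps, Runs S A σ (A.exec σ) T by
    obtain ⟨T, h₁, h₂⟩ := this σ
    exact ⟨_, T, h₂, h₁, h⟩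
  clear h σ
  induction A with
  | skip => exact fun σ => ⟨1, le_rfl, .skip σ⟩
  | setNat a idx e => exact fun σ => ⟨_, le_rfl, .setNat σ a idx e⟩
  | setReal a idx e => exact fun σ => ⟨_, le_rfl, .setReal σ a idx e⟩
  | seq A B ihA ihB =>
    intro σ
    obtain ⟨T₁, h₁, h₂⟩ := ihA hA.1 σ
    obtain ⟨T₂, h₃, h₄⟩ := ihB hA.2 (A.exec σ)
    exact ⟨T₁ + T₂, add_le_add h₁ h₃, .seq h₂ h₄⟩
  | ite b A B ihA ihB =>
    intro σ
    by_cases hb : b.holds σ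
    · obtain ⟨T₁, h₁, h₂⟩ := ihA hA.1 σ
      refine ⟨b.cost + T₁, Nat.add_le_add_left (h₁.trans (le_max_left _ _)) _, ?_⟩
      rw [Program.exec, if_pos hb]
      exact .iteTrue hb h₂
    · obtain ⟨T₁, h₁, h₂⟩ := ihB hA.2 σ
      refine ⟨b.cost + T₁, Nat.add_le_add_left (h₁.trans (le_max_right _ _)) _, ?_⟩
      rw [Program.exec, if_neg hb]
      exact .iteFalse hb h₂
  | _ => exact hA.elim

/-! ### Array accesses with up to three indices -/

/-- Scalar variable. -/
def NExpr.var (a : ℕ) : NExpr := .read a ![]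

/-- Array element. -/
def NExpr.read1 (a : ℕ) (x : NExpr) : NExpr := .read a ![x]

/-- Array element. -/
def NExpr.read3 (a : ℕ) (x y z : NExpr) : NExpr := .read a ![x, y, z]

/-- Scalar variable. -/
def RExpr.var (a : ℕ) : RExpr := .read a ![]

/-- Array element. -/
def RExpr.read1 (a : ℕ) (x : NExpr) : RExpr := .read a ![x]

/-- Array element. -/
def RExpr.read2 (a : ℕ) (x y : NExpr) : RExpr := .read a ![x, y]

/-- The smaller one of two numbers. -/
def NExpr.min (x y : NExpr) : NExpr := .sub x (.sub x y)

@[simp]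
theorem NExpr.eval_var (σ : Store) (a : ℕ) : (NExpr.var a).eval σ = σ.nat a [] := by
  simp [NExpr.var, NExpr.eval]

@[simp]
theorem NExpr.eval_read1 (σ : Store) (a : ℕ) (x : NExpr) :
    (NExpr.read1 a x).eval σ = σ.nat a [x.eval σ] := by
  simp [NExpr.read1, NExpr.eval]

@[simp]
theorem NExpr.eval_read3 (σ : Store) (a : ℕ) (x y z : NExpr) :
    (NExpr.read3 a x y z).eval σ = σ.nat a [x.eval σ, y.eval σ, z.eval σ] := by
  simp [NExpr.read3, NExpr.eval]

@[simp]
theorem RExpr.eval_var (σ : Store) (a : ℕ) : (RExpr.var a).eval σ = σ.real a [] := by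
  simp [RExpr.var, RExpr.eval]

@[simp]
theorem RExpr.eval_read1 (σ : Store) (a : ℕ) (x : NExpr) :
    (RExpr.read1 a x).eval σ = σ.real a [x.eval σ] := by
  simp [RExpr.read1, RExpr.eval]

@[simp]
theorem RExpr.eval_read2 (σ : Store) (a : ℕ) (x y : NExpr) :
    (RExpr.read2 a x y).eval σ = σ.real a [x.eval σ, y.eval σ] := by
  simp [RExpr.read2, RExpr.eval]

@[simp]
theorem NExpr.eval_min (σ : Store) (x y : NExpr) :
    (NExpr.min x y).eval σ = Min.min (x.eval σ) (y.eval σ) := by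
  simp only [NExpr.min, NExpr.eval]
  omega

/-- Assignment to a scalar variable. -/
def Program.assign (a : ℕ) (e : NExpr) : Program := .setNat a ![] e

/-- Assignment to an array element. -/
def Program.setNat1 (a : ℕ) (x : NExpr) (e : NExpr) : Program := .setNat a ![x] e

/-- Assignment to an array element. -/
def Program.setNat3 (a : ℕ) (x y z : NExpr) (e : NExpr) : Program := .setNat a ![x, y, z] e

/-- Assignment to an array element. -/
def Program.setReal1 (a : ℕ) (x : NExpr) (e : RExpr) : Program := .setReal a ![x] e

/-- Assignment to an array element. -/
def Program.setReal2 (a : ℕ) (x y : NExpr) (e : RExpr) : Program := .setReal a ![x, y] e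

/-- Assignment to an array element. -/
def Program.setReal3 (a : ℕ) (x y z : NExpr) (e : RExpr) : Program := .setReal a ![x, y, z] e

section Exec

variable (σ : Store) (a : ℕ) (x y z : NExpr)

@[simp]
theorem Program.exec_assign (e : NExpr) :
    (Program.assign a e).exec σ = σ.setNat a [] (e.eval σ) := by
  simp [Program.assign, Program.exec]

@[simp]
theorem Program.exec_setNat1 (e : NExpr) :
    (Program.setNat1 a x e).exec σ = σ.setNat a [x.eval σ] (e.eval σ) := by
  simp [Program.setNat1, Program.exec]

@[simp]
theorem Program.exec_setNat3 (e : NExpr) :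
    (Program.setNat3 a x y z e).exec σ =
      σ.setNat a [x.eval σ, y.eval σ, z.eval σ] (e.eval σ) := by
  simp [Program.setNat3, Program.exec]

@[simp]
theorem Program.exec_setReal1 (e : RExpr) :
    (Program.setReal1 a x e).exec σ = σ.setReal a [x.eval σ] (e.eval σ) := by
  simp [Program.setReal1, Program.exec]

@[simp]
theorem Program.exec_setReal2 (e : RExpr) :
    (Program.setReal2 a x y e).exec σ = σ.setReal a [x.eval σ, y.eval σ] (e.eval σ) := by
  simp [Program.setReal2, Program.exec]

@[simp]
theorem Program.exec_setReal3 (e : RExpr) :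
    (Program.setReal3 a x y z e).exec σ =
      σ.setReal a [x.eval σ, y.eval σ, z.eval σ] (e.eval σ) := by
  simp [Program.setReal3, Program.exec]

end Exec

/-! ### Loops -/

/-- `for i < N do A`. -/
def Program.forLoop (i : ℕ) (N : NExpr) (A : Program) : Program :=
  .seq (.assign i (.lit 0))
    (.while (.natLt (.var i) N) (.seq A (.assign i (.add (.var i) (.lit 1)))))

theorem Runs.assign {d ℓ : ℕ} (S : Subroutine d ℓ) (σ : Store) (a : ℕ) (e : NExpr) :
    Runs S (.assign a e) σ (σ.setNat a [] (e.eval σ)) (1 + e.cost) := by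
  unfold Program.assign
  simpa using Runs.setNat (S := S) σ a ![] e

/-- The loop rule. The invariant must not depend on the loop variable. -/
theorem Ok.forLoop {d ℓ : ℕ} {S : Subroutine d ℓ} {A : Program} {i : ℕ} {N : NExpr} {σ₀ : Store}
    {K c : ℕ} (Inv : ℕ → Store → Prop) (hi : i ∉ A.natWrites)
    (hN : ∀ σ, Frame (i :: A.natWrites) A.realWrites σ₀ σ → N.eval σ = K)
    (hInv : ∀ k σ x, Inv k σ → Inv k (σ.setNat i [] x)) (h0 : Inv 0 σ₀)
    (step : ∀ k < K, ∀ σ, Frame (i :: A.natWrites) A.realWrites σ₀ σ → σ.nat i [] = k → Inv k σ →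
      Ok S A σ c (Inv (k + 1))) :
    Ok S (.forLoop i N A) σ₀ (K * (c + N.cost + 6) + N.cost + 4) (Inv K) := by
  have sub₁ : A.natWrites ⊆ i :: A.natWrites := List.subset_cons_self _ _
  -- Induction on the number `k` of remaining passes. Besides the body, a pass pays `N.cost + 2` for
  -- the test and 4 for the increment. The failing test at the end pays `N.cost + 2`, and the
  -- initialization of the loop variable 2.
  have main : ∀ k ≤ K, ∀ σ, Frame (i :: A.natWrites) A.realWrites σ₀ σ → σ.nat i [] = K - k →
      Inv (K - k) σ → Ok S (.while (.natLt (.var i) N)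
        (.seq A (.assign i (.add (.var i) (.lit 1))))) σ (k * (c + N.cost + 6) + N.cost + 2)
        (Inv K) := by
    intro k
    induction k with
    | zero =>
      intro _ σ hf hσ hI
      refine ⟨σ, _, .whileFalse ?_, ?_, hI⟩
      · simp [BExpr.holds, hN σ hf, hσ]
      · simp [BExpr.cost, NExpr.cost, NExpr.var]
        omega
    | succ k ih =>
      intro hk σ hf hσ hI
      obtain ⟨τ, t, r₁, r₂, r₃⟩ := step (K - (k + 1)) (by omega) σ hf hσ hI
      have hf' := hf.trans (r₁.frame.mono sub₁ (List.Subset.refl _))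
      have hτ : τ.nat i [] = K - (k + 1) := by rw [r₁.frame.nat i hi, hσ]
      have run : Runs S (.seq A (.assign i (.add (.var i) (.lit 1)))) σ
          (τ.setNat i [] (K - k)) (t + 4) := by
        have h := Runs.assign S τ i (.add (.var i) (.lit 1))
        have e : (NExpr.add (.var i) (.lit 1)).eval τ = K - k := by
          simp only [NExpr.eval, NExpr.eval_var, hτ]
          omega
        rw [e] at h
        exact .seq r₁ h
      have e : K - (k + 1) + 1 = K - k := by omega
      rw [e] at r₃
      obtain ⟨υ, t', s₁, s₂, s₃⟩ := ih (by omega) (τ.setNat i [] (K - k))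
        (hf'.trans (Frame.setNat τ (List.mem_cons_self) _ _ _)) (by simp) (hInv _ _ _ r₃)
      refine ⟨υ, _, .whileTrue ?_ run s₁, ?_, s₃⟩
      · simp only [BExpr.holds, NExpr.eval_var, hN σ hf, hσ]
        omega
      · simp [BExpr.cost, NExpr.cost, NExpr.var]
        rw [Nat.succ_mul]
        omega
  have hf₀ : Frame (i :: A.natWrites) A.realWrites σ₀ (σ₀.setNat i [] 0) :=
    Frame.setNat σ₀ List.mem_cons_self _ _ _
  obtain ⟨τ, t, r₁, r₂, r₃⟩ := main K le_rfl (σ₀.setNat i [] 0) hf₀ (by simp)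
    (by simpa using hInv 0 _ _ h0)
  exact ⟨τ, 2 + t, .seq (Runs.assign S σ₀ i (.lit 0)) r₁, by omega, r₃⟩

theorem not_mem_of_elem {a : ℕ} {l : List ℕ} (h : List.elem a l = false) : a ∉ l := by
  simpa using h

/-! ### Time bounds -/

theorem add_bound {a b A B X : ℕ} (ha : a ≤ A * X) (hb : b ≤ B * X) : a + b ≤ (A + B) * X := by
  rw [Nat.add_mul]
  exact Nat.add_le_add ha hb

@[simp]
theorem NExpr.cost_var (a : ℕ) : (NExpr.var a).cost = 1 := rfl

/-- As `K` and `X` are at least 1, all overhead is absorbed into a multiple of `K * X`. The bound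
keeps the form constant times product, so nested loops can be chained. -/
theorem loop_bound {K c κ C X : ℕ} (hc : c ≤ C * X) (hX : 1 ≤ X) (hK : 1 ≤ K) :
    K * (c + κ + 6) + κ + 4 ≤ (C + 2 * κ + 10) * (K * X) := by
  have h₁ : 1 ≤ K * X := Nat.mul_le_mul hK hX
  have h₂ : K ≤ K * X := Nat.le_mul_of_pos_right K hX
  have h₃ : K * c ≤ C * (K * X) := by
    calc K * c ≤ K * (C * X) := Nat.mul_le_mul_left K hc
      _ = C * (K * X) := by ring
  nlinarith

/-- The loop rule, with a time bound in the form of a product. -/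
theorem Ok.loop {d ℓ : ℕ} {S : Subroutine d ℓ} {A : Program} {i : ℕ} {N : NExpr} {σ₀ : Store}
    {K C X : ℕ} (Inv : ℕ → Store → Prop) (hX : 1 ≤ X) (hK : 1 ≤ K) (hi : i ∉ A.natWrites)
    (hN : ∀ σ, Frame (i :: A.natWrites) A.realWrites σ₀ σ → N.eval σ = K)
    (hInv : ∀ k σ x, Inv k σ → Inv k (σ.setNat i [] x)) (h0 : Inv 0 σ₀)
    (step : ∀ k < K, ∀ σ, Frame (i :: A.natWrites) A.realWrites σ₀ σ → σ.nat i [] = k → Inv k σ →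
      Ok S A σ (C * X) (Inv (k + 1))) :
    Ok S (.forLoop i N A) σ₀ ((C + 2 * N.cost + 10) * (K * X)) (Inv K) :=
  (Ok.forLoop Inv hi hN hInv h0 step).mono (loop_bound le_rfl hX hK) fun _ h => h

/-! ### Squared distances in programs -/

/-- The sum of `f 0, …, f (d - 1)`. -/
def RExpr.sum : ℕ → (ℕ → RExpr) → RExpr
  | 0, _ => .lit 0
  | d + 1, f => .add (RExpr.sum d f) (f d)

theorem RExpr.eval_sum (σ : Store) (d : ℕ) (f : ℕ → RExpr) :
    (RExpr.sum d f).eval σ = ∑ c ∈ Finset.range d, (f c).eval σ := by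
  induction d with
  | zero => simp [RExpr.sum, RExpr.eval]
  | succ d ih => rw [RExpr.sum, RExpr.eval, ih, Finset.sum_range_succ]

/-- An edge of a curve and a point, given by expressions. -/
structure EdgeExpr where
  pt : ℕ → RExpr
  fst : ℕ → RExpr
  snd : ℕ → RExpr
  lo : RExpr
  hi : RExpr

namespace EdgeExpr

variable (E : EdgeExpr)

/-- The expression for `slope`. -/
def slope (c : ℕ) : RExpr := .div (.sub (E.snd c) (E.fst c)) (.sub E.hi E.lo)

/-- The expression for `offset`. -/
def offset (c : ℕ) : RExpr := .sub (.sub (E.fst c) (E.pt c)) (.mul E.lo (E.slope c))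

/-- The expression for `quadA`. -/
def quadA (d : ℕ) : RExpr := .sum d fun c => .mul (E.slope c) (E.slope c)

/-- The expression for `quadB`. -/
def quadB (d : ℕ) : RExpr := .sum d fun c => .mul (E.offset c) (E.slope c)

/-- The tolerated distance `3 Δ`. -/
def tol : RExpr := .mul (.lit 3) (.var 0)

/-- The expression for `quadC`. -/
def quadC (d : ℕ) : RExpr := .sub (.sum d fun c => .mul (E.offset c) (E.offset c)) (.mul tol tol)

/-- The expression for `quad`. -/
def quad (d : ℕ) (x : RExpr) : RExpr :=
  .add (.add (.mul (.mul (E.quadA d) x) x) (.mul (.mul (.lit 2) (E.quadB d)) x)) (E.quadC d)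

/-- The first root of `quad`. -/
def root (d : ℕ) : RExpr :=
  .div (.sub (.sub (.lit 0) (E.quadB d))
    (.sqrt (.sub (.mul (E.quadB d) (E.quadB d)) (.mul (E.quadA d) (E.quadC d))))) (E.quadA d)

/-- `t[x, y] := firstNear …` -/
def firstNear (d : ℕ) (c : RExpr) (t : ℕ) (x y : NExpr) : Program :=
  .ite (.and (.realLe c E.hi) (.realLe (E.quad d c) (.lit 0))) (.setReal2 t x y c)
    (.ite (.and (.and (.realLt (.lit 0) (E.quadA d))
        (.realLe (.mul (E.quadA d) (E.quadC d)) (.mul (E.quadB d) (E.quadB d))))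
        (.and (.realLe c (E.root d)) (.realLe (E.root d) E.hi)))
      (.setReal2 t x y (E.root d)) (.setReal2 t x y (.add E.hi (.lit 1))))

/-- The values of the expressions. -/
structure Eval (d : ℕ) (σ : Store) (δ : ℝ) (A P₀ P₁ : ℕ → ℝ) (k₀ k₁ : ℝ) : Prop where
  pt : ∀ c < d, (E.pt c).eval σ = A c
  fst : ∀ c < d, (E.fst c).eval σ = P₀ c
  snd : ∀ c < d, (E.snd c).eval σ = P₁ c
  lo : E.lo.eval σ = k₀
  hi : E.hi.eval σ = k₁
  tol : 3 * σ.real 0 [] = δ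

variable {E} {d : ℕ} {σ : Store} {δ : ℝ} {A P₀ P₁ : ℕ → ℝ} {k₀ k₁ : ℝ}

theorem Eval.slope (h : E.Eval d σ δ A P₀ P₁ k₀ k₁) {c : ℕ} (hc : c < d) :
    (E.slope c).eval σ = Subtraj.slope P₀ P₁ k₀ k₁ c := by
  simp [EdgeExpr.slope, RExpr.eval, Subtraj.slope, h.fst c hc, h.snd c hc, h.lo, h.hi]

theorem Eval.offset (h : E.Eval d σ δ A P₀ P₁ k₀ k₁) {c : ℕ} (hc : c < d) :
    (E.offset c).eval σ = Subtraj.offset A P₀ P₁ k₀ k₁ c := by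
  simp [EdgeExpr.offset, RExpr.eval, Subtraj.offset, h.fst c hc, h.pt c hc, h.lo, h.slope hc]

theorem Eval.quadA (h : E.Eval d σ δ A P₀ P₁ k₀ k₁) :
    (E.quadA d).eval σ = Subtraj.quadA d P₀ P₁ k₀ k₁ := by
  rw [EdgeExpr.quadA, RExpr.eval_sum, Subtraj.quadA]
  refine Finset.sum_congr rfl fun c hc => ?_
  rw [RExpr.eval, h.slope (Finset.mem_range.1 hc)]

theorem Eval.quadB (h : E.Eval d σ δ A P₀ P₁ k₀ k₁) :
    (E.quadB d).eval σ = Subtraj.quadB d A P₀ P₁ k₀ k₁ := by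
  rw [EdgeExpr.quadB, RExpr.eval_sum, Subtraj.quadB]
  refine Finset.sum_congr rfl fun c hc => ?_
  rw [RExpr.eval, h.slope (Finset.mem_range.1 hc), h.offset (Finset.mem_range.1 hc)]

theorem Eval.quadC (h : E.Eval d σ δ A P₀ P₁ k₀ k₁) :
    (E.quadC d).eval σ = Subtraj.quadC d δ A P₀ P₁ k₀ k₁ := by
  have e : EdgeExpr.tol.eval σ = δ := by simp [EdgeExpr.tol, RExpr.eval, h.tol]
  rw [EdgeExpr.quadC, RExpr.eval, RExpr.eval_sum, Subtraj.quadC, RExpr.eval, e]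
  congr 1
  refine Finset.sum_congr rfl fun c hc => ?_
  rw [RExpr.eval, h.offset (Finset.mem_range.1 hc)]

theorem Eval.quad (h : E.Eval d σ δ A P₀ P₁ k₀ k₁) (x : RExpr) :
    (E.quad d x).eval σ = Subtraj.quad d δ A P₀ P₁ k₀ k₁ (x.eval σ) := by
  simp [EdgeExpr.quad, RExpr.eval, Subtraj.quad, h.quadA, h.quadB, h.quadC]

theorem Eval.firstNear (h : E.Eval d σ δ A P₀ P₁ k₀ k₁) (c : RExpr) (t : ℕ) (x y : NExpr) :
    (E.firstNear d c t x y).exec σ = σ.setReal t [x.eval σ, y.eval σ]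
      (Subtraj.firstNear d δ A P₀ P₁ k₀ k₁ (c.eval σ)) := by
  have hr : (E.root d).eval σ = (0 - Subtraj.quadB d A P₀ P₁ k₀ k₁ -
      √(Subtraj.quadB d A P₀ P₁ k₀ k₁ * Subtraj.quadB d A P₀ P₁ k₀ k₁ -
        Subtraj.quadA d P₀ P₁ k₀ k₁ * Subtraj.quadC d δ A P₀ P₁ k₀ k₁)) /
      Subtraj.quadA d P₀ P₁ k₀ k₁ := by
    simp [EdgeExpr.root, RExpr.eval, h.quadA, h.quadB, h.quadC]
  simp only [EdgeExpr.firstNear, Program.exec, BExpr.holds, h.quad, h.hi, RExpr.eval, h.quadA,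
    h.quadB, h.quadC, hr, Program.exec_setReal2, Nat.cast_zero, Nat.cast_one]
  rw [Subtraj.firstNear, firstRoot]
  simp only [Subtraj.quad, apply_ite (σ.setReal t [x.eval σ, y.eval σ])]
  congr

theorem straight_firstNear (c : RExpr) (t : ℕ) (x y : NExpr) :
    (E.firstNear d c t x y).Straight := by
  simp [EdgeExpr.firstNear, Program.Straight, Program.setReal2]

end EdgeExpr

/-! ### The input of the algorithm -/

/-- An input of the algorithm. -/
structure Input (d : ℕ) where
  n : ℕ
  m : ℕ
  ℓ : ℕ
  ℓ_pos : 0 < ℓ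
  P : Trajectory d n m
  Δ : ℝ
  Δ_nonneg : 0 ≤ Δ
  T : ℕ
  S : Subroutine d ℓ
  computes : S.Computes P T

namespace Input

variable {d : ℕ} (I : Input d)

/-- The distance tolerated by the algorithm. -/
def δ : ℝ := 3 * I.Δ

theorem m_pos : 1 ≤ I.m := by
  have := I.P.two_le
  omega

/-- The memory contains the input, completed by the knot `1` behind the last vertex, the numbers of
the edges that contain the breakpoints, and the knots of the centers. -/
structure Loaded (σ : Store) : Prop where
  n : σ.nat 0 [] = I.n
  m : σ.nat 1 [] = I.m
  ℓ : σ.nat 2 [] = I.ℓ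
  col : ∀ j < I.m, σ.nat 4 [j] = I.P.col j
  tol : 3 * σ.real 0 [] = I.δ
  vertex : ∀ e, ∀ c < d, σ.real 1 [min e (I.n - 1), c] = coord (vtx I.P.vertex e) c
  xs : ∀ e ≤ I.n, σ.real 2 [e] = I.P.xs e
  time : ∀ j < I.m, σ.real 3 [j] = I.P.time j
  ys : ∀ v ≤ I.ℓ, σ.real 5 [v] = v

variable {I}

/-- The two disjointness conditions are Boolean computations on array names, so that they can be
discharged by `rfl` for concrete programs. -/
theorem Loaded.frame {σ τ : Store} (h : I.Loaded σ) {ns rs : List ℕ} (hf : Frame ns rs σ τ)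
    (h₁ : [0, 1, 2, 4].all (fun a => !ns.elem a) = true)
    (h₂ : [0, 1, 2, 3, 5].all (fun a => !rs.elem a) = true) : I.Loaded τ := by
  replace h₁ : ∀ a ∈ [0, 1, 2, 4], a ∉ ns := by simpa using h₁
  replace h₂ : ∀ a ∈ [0, 1, 2, 3, 5], a ∉ rs := by simpa using h₂
  have n₀ := hf.nat 0 (h₁ 0 (by simp))
  have n₁ := hf.nat 1 (h₁ 1 (by simp))
  have n₂ := hf.nat 2 (h₁ 2 (by simp))
  have n₄ := hf.nat 4 (h₁ 4 (by simp))
  have r₀ := hf.real 0 (h₂ 0 (by simp))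
  have r₁ := hf.real 1 (h₂ 1 (by simp))
  have r₂ := hf.real 2 (h₂ 2 (by simp))
  have r₃ := hf.real 3 (h₂ 3 (by simp))
  have r₅ := hf.real 5 (h₂ 5 (by simp))
  constructor
  · rw [n₀]; exact h.n
  · rw [n₁]; exact h.m
  · rw [n₂]; exact h.ℓ
  · rw [n₄]; exact h.col
  · rw [r₀]; exact h.tol
  · rw [r₁]; exact h.vertex
  · rw [r₂]; exact h.xs
  · rw [r₃]; exact h.time
  · rw [r₅]; exact h.ys

variable (I)

/-- The real array `10` contains the vertices of `q`. -/
def Scratch (q : PolyCurve d I.ℓ) (σ : Store) : Prop :=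
  ∀ v, ∀ c < d, σ.real 10 [min v (I.ℓ - 1), c] = coord (vtx q v) c

variable {I}

theorem Scratch.frame {q : PolyCurve d I.ℓ} {σ τ : Store} (h : I.Scratch q σ) {ns rs : List ℕ}
    (hf : Frame ns rs σ τ) (hr : List.elem 10 rs = false) : I.Scratch q τ := by
  unfold Scratch
  rw [hf.real 10 (not_mem_of_elem hr)]
  exact h

end Input

/-- The vertex `e` of the trajectory. -/
def trajVertex (e : NExpr) (c : ℕ) : RExpr :=
  .read2 1 (.min e (.sub (.var 0) (.lit 1))) (.lit c)

/-- The vertex `v` of the center in the real array `10`. -/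
def centerVertex (v : NExpr) (c : ℕ) : RExpr :=
  .read2 10 (.min v (.sub (.var 2) (.lit 1))) (.lit c)

/-- The edge `e` of the trajectory and the vertex `v` of the center. -/
def trajEdge (e v : NExpr) : EdgeExpr where
  pt := centerVertex v
  fst := trajVertex e
  snd := trajVertex (.add e (.lit 1))
  lo := .read1 2 e
  hi := .read1 2 (.add e (.lit 1))

/-- The edge `v` of the center and the vertex `e` of the trajectory. -/
def centerEdge (e v : NExpr) : EdgeExpr where
  pt := trajVertex e
  fst := centerVertex v
  snd := centerVertex (.add v (.lit 1))
  lo := .read1 5 v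
  hi := .read1 5 (.add v (.lit 1))

section Edges

variable {d : ℕ} {I : Input d} {σ : Store} {q : PolyCurve d I.ℓ}

theorem eval_trajVertex (h : I.Loaded σ) (e : NExpr) {c : ℕ} (hc : c < d) :
    (trajVertex e c).eval σ = coord (vtx I.P.vertex (e.eval σ)) c := by
  simp [trajVertex, NExpr.eval, h.n, h.vertex _ c hc]

theorem eval_centerVertex (h : I.Loaded σ) (hq : I.Scratch q σ) (v : NExpr) {c : ℕ} (hc : c < d) :
    (centerVertex v c).eval σ = coord (vtx q (v.eval σ)) c := by
  simp [centerVertex, NExpr.eval, h.ℓ, hq _ c hc]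

theorem eval_trajEdge (h : I.Loaded σ) (hq : I.Scratch q σ) (e v : NExpr)
    (he : e.eval σ < I.n) :
    (trajEdge e v).Eval d σ I.δ (coord (vtx q (v.eval σ)))
      (coord (vtx I.P.vertex (e.eval σ))) (coord (vtx I.P.vertex (e.eval σ + 1)))
      (I.P.xs (e.eval σ)) (I.P.xs (e.eval σ + 1)) := by
  refine ⟨fun c hc => eval_centerVertex h hq _ hc, fun c hc => eval_trajVertex h _ hc,
    fun c hc => eval_trajVertex h _ hc, ?_, ?_, h.tol⟩
  · simp [trajEdge, h.xs _ he.le]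
  · simp [trajEdge, NExpr.eval, h.xs _ he]

theorem eval_centerEdge (h : I.Loaded σ) (hq : I.Scratch q σ) (e v : NExpr)
    (hv : v.eval σ < I.ℓ) :
    (centerEdge e v).Eval d σ I.δ (coord (vtx I.P.vertex (e.eval σ)))
      (coord (vtx q (v.eval σ))) (coord (vtx q (v.eval σ + 1)))
      (v.eval σ : ℕ) (v.eval σ + 1 : ℕ) := by
  refine ⟨fun c hc => eval_trajVertex h _ hc, fun c hc => eval_centerVertex h hq _ hc,
    fun c hc => eval_centerVertex h hq _ hc, ?_, ?_, h.tol⟩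
  · simp [centerEdge, h.ys _ hv.le]
  · simp [centerEdge, NExpr.eval, h.ys _ hv]

end Edges

/-! ### The reachability tables -/

/-- `e + 1`. -/
def NExpr.succ (e : NExpr) : NExpr := .add e (.lit 1)

@[simp]
theorem NExpr.eval_succ (σ : Store) (e : NExpr) : e.succ.eval σ = e.eval σ + 1 := rfl

/-- Computes the entry of the table `left` behind the cell. -/
def cellRight (d : ℕ) : Program :=
  .ite (.realLe (.read2 12 (.var 13) (.var 14)) (.read1 2 (NExpr.var 13).succ))
    ((centerEdge (NExpr.var 13).succ (.var 14)).firstNear d (.read1 5 (.var 14)) 11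
      (NExpr.var 13).succ (.var 14))
    ((centerEdge (NExpr.var 13).succ (.var 14)).firstNear d (.read2 11 (.var 13) (.var 14)) 11
      (NExpr.var 13).succ (.var 14))

/-- Computes the entry of the table `bot` above the cell. -/
def cellTop (d : ℕ) : Program :=
  .ite (.realLe (.read2 11 (.var 13) (.var 14)) (.read1 5 (NExpr.var 14).succ))
    ((trajEdge (.var 13) (NExpr.var 14).succ).firstNear d (.read1 2 (.var 13)) 12
      (.var 13) (NExpr.var 14).succ)
    ((trajEdge (.var 13) (NExpr.var 14).succ).firstNear d (.read2 12 (.var 13) (.var 14)) 12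
      (.var 13) (NExpr.var 14).succ)

/-- Computes the entry of the table `bot` at the bottom of the column. -/
def columnBase (d : ℕ) : Program :=
  .ite (.and (.natEq (.var 13) (.read1 4 (.var 12)))
      (.realLe ((trajEdge (.var 13) (.lit 0)).quad d (.read1 3 (.var 12))) (.lit 0)))
    (.setReal2 12 (.var 13) (.lit 0) (.read1 3 (.var 12)))
    (.setReal2 12 (.var 13) (.lit 0) (.add (.read1 2 (NExpr.var 13).succ) (.lit 1)))

/-- Computes the tables for the start at the breakpoint in the natural variable `12`. -/
def tables (d : ℕ) : Program :=
  .seq (.forLoop 14 (.var 2)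
      (.setReal2 11 (.lit 0) (.var 14) (.add (.read1 5 (NExpr.var 14).succ) (.lit 1))))
    (.forLoop 13 (.var 0)
      (.seq (columnBase d) (.forLoop 14 (.var 2) (.seq (cellRight d) (cellTop d)))))

section Tables

variable {d : ℕ} {I : Input d} {σ : Store} {q : PolyCurve d I.ℓ} {i e v : ℕ}

theorem exec_cellRight (h : I.Loaded σ) (hq : I.Scratch q σ) (he : e < I.n) (hv : v < I.ℓ)
    (h13 : σ.nat 13 [] = e) (h14 : σ.nat 14 [] = v)
    (hL : σ.real 11 [e, v] = (I.P.diagram q I.δ i).left e v)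
    (hB : σ.real 12 [e, v] = (I.P.diagram q I.δ i).bot e v) :
    (cellRight d).exec σ = σ.setReal 11 [e + 1, v] ((I.P.diagram q I.δ i).left (e + 1) v) := by
  have E := eval_centerEdge h hq (NExpr.var 13).succ (.var 14) (by simpa [h14] using hv)
  rw [FreeSpace.left_succ]
  simp only [cellRight, Program.exec, BExpr.holds, E.firstNear, RExpr.eval_read1, RExpr.eval_read2,
    NExpr.eval_var, NExpr.eval_succ, h13, h14, hL, hB, h.xs (e + 1) he, h.ys v hv.le]
  split_ifs with h₁ h₂ h₂
  · rfl
  · exact absurd h₁ h₂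
  · exact absurd h₂ h₁
  · rfl

theorem exec_cellTop (h : I.Loaded σ) (hq : I.Scratch q σ) (he : e < I.n) (hv : v < I.ℓ)
    (h13 : σ.nat 13 [] = e) (h14 : σ.nat 14 [] = v)
    (hL : σ.real 11 [e, v] = (I.P.diagram q I.δ i).left e v)
    (hB : σ.real 12 [e, v] = (I.P.diagram q I.δ i).bot e v) :
    (cellTop d).exec σ = σ.setReal 12 [e, v + 1] ((I.P.diagram q I.δ i).bot e (v + 1)) := by
  have E := eval_trajEdge h hq (.var 13) (NExpr.var 14).succ (by simpa [h13] using he)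
  rw [FreeSpace.bot_succ]
  simp only [cellTop, Program.exec, BExpr.holds, E.firstNear, RExpr.eval_read1, RExpr.eval_read2,
    NExpr.eval_var, NExpr.eval_succ, h13, h14, hL, hB, h.xs e he.le, h.ys (v + 1) hv]
  split_ifs with h₁ h₂ h₂
  · rfl
  · exact absurd h₁ h₂
  · exact absurd h₂ h₁
  · rfl

theorem exec_columnBase (h : I.Loaded σ) (hq : I.Scratch q σ) (he : e < I.n) (hi : i < I.m)
    (h13 : σ.nat 13 [] = e) (h12 : σ.nat 12 [] = i) :
    (columnBase d).exec σ = σ.setReal 12 [e, 0] ((I.P.diagram q I.δ i).bot e 0) := by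
  have E := eval_trajEdge h hq (.var 13) (.lit 0) (by simpa [h13] using he)
  rw [FreeSpace.bot_zero]
  simp only [columnBase, Program.exec, BExpr.holds, E.quad, RExpr.eval_read1,
    NExpr.eval_var, NExpr.eval_read1, NExpr.eval_succ, h13, h12, h.xs (e + 1) he, h.col i hi,
    h.time i hi, RExpr.eval, NExpr.eval, Nat.cast_zero, Program.exec_setReal2, Nat.cast_one]
  simp only [Trajectory.diagram, Trajectory.edgeQuad]
  rw [← apply_ite (σ.setReal 12 [e, 0])]
  congr

/-- Cells are visited column by column from bottom to top, so the entries of the left and bottom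
side are present when a cell is handled. Only the values on the top line are reported, because
`Near` reads nothing else of the table. -/
theorem ok_tables (d : ℕ) : ∃ C, ∀ (I : Input d) (q : PolyCurve d I.ℓ) (σ : Store) (i : ℕ),
    I.Loaded σ → I.Scratch q σ → i < I.m → σ.nat 12 [] = i →
    Ok I.S (tables d) σ (C * (I.n * I.ℓ)) fun τ =>
      ∀ e < I.n, τ.real 12 [e, I.ℓ] = (I.P.diagram q I.δ i).bot e I.ℓ := by
  refine ⟨(Program.steps (.setReal2 11 (.lit 0) (.var 14)
      (.add (.read1 5 (NExpr.var 14).succ) (.lit 1))) + 2 * 1 + 10) +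
    (((columnBase d).steps + ((cellRight d).steps + (cellTop d).steps + 2 * 1 + 10)) + 2 * 1 + 10),
    fun I q σ i h hq hi h12 => ?_⟩
  have hn : 1 ≤ I.n := I.P.n_pos
  have hℓ : 1 ≤ I.ℓ := I.ℓ_pos
  set D := I.P.diagram q I.δ i with hD
  have first := Ok.loop (S := I.S) (i := 14) (N := .var 2) (σ₀ := σ) (K := I.ℓ) (X := 1)
    (A := .setReal2 11 (.lit 0) (.var 14) (.add (.read1 5 (NExpr.var 14).succ) (.lit 1)))
    (C := Program.steps (.setReal2 11 (.lit 0) (.var 14)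
      (.add (.read1 5 (NExpr.var 14).succ) (.lit 1))))
    (fun k τ => ∀ v < k, τ.real 11 [0, v] = D.left 0 v) le_rfl hℓ (not_mem_of_elem rfl)
    (fun τ hf => by
      rw [NExpr.eval_var, (h.frame hf rfl rfl).ℓ])
    (fun _ _ _ h => h) (fun v hv => absurd hv (Nat.not_lt_zero v))
    (fun k hk τ hf h14 hI => by
      have hτ := h.frame hf rfl rfl
      rw [mul_one]
      refine .straight trivial fun v hv => ?_
      simp only [Program.exec_setReal2, NExpr.eval_var, h14, Store.setReal_real_self, NExpr.eval]
      split_ifs with hc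
      · obtain rfl : v = k := by simpa using hc
        rw [D.left_zero]
        change _ = ((v + 1 : ℕ) : ℝ) + 1
        simp [RExpr.eval, h14, hτ.ys _ hk]
      · exact hI v (by
          have : v ≠ k := by simpa using hc
          omega))
  have inner : ∀ e < I.n, ∀ τ, I.Loaded τ → I.Scratch q τ → τ.nat 13 [] = e →
      (∀ v < I.ℓ, τ.real 11 [e, v] = D.left e v) → τ.real 12 [e, 0] = D.bot e 0 →
      (∀ e' < e, τ.real 12 [e', I.ℓ] = D.bot e' I.ℓ) →
      Ok I.S (.forLoop 14 (.var 2) (.seq (cellRight d) (cellTop d))) τ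
        (((cellRight d).steps + (cellTop d).steps + 2 * 1 + 10) * (I.ℓ * 1)) fun υ =>
        (∀ v < I.ℓ, υ.real 11 [e + 1, v] = D.left (e + 1) v) ∧
          ∀ e' < e + 1, υ.real 12 [e', I.ℓ] = D.bot e' I.ℓ := by
    intro e he τ hτ hqτ h13 hL hB hB'
    refine (Ok.loop (C := (cellRight d).steps + (cellTop d).steps)
      (fun k υ => (∀ v < I.ℓ, υ.real 11 [e, v] = D.left e v) ∧
        (∀ v < k, υ.real 11 [e + 1, v] = D.left (e + 1) v) ∧ υ.real 12 [e, k] = D.bot e k ∧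
        ∀ e' < e, υ.real 12 [e', I.ℓ] = D.bot e' I.ℓ) le_rfl hℓ (not_mem_of_elem rfl)
      (fun υ hf => by rw [NExpr.eval_var, (hτ.frame hf rfl rfl).ℓ])
      (fun _ _ _ h => h) ⟨hL, fun v hv => absurd hv (Nat.not_lt_zero v), hB, hB'⟩ ?_).mono le_rfl
      fun υ hυ => ⟨hυ.2.1, fun e' he' => ?_⟩
    · intro v hv υ hf h14 ⟨i₁, i₂, i₃, i₄⟩
      have l₁ := hτ.frame hf rfl rfl
      have q₁ := hqτ.frame hf rfl
      have c₁ : υ.nat 13 [] = e := by rw [hf.nat 13 (not_mem_of_elem rfl), h13]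
      -- The second half of the cell runs after the first has written to column `e + 1` of the table
      -- `left`; the entries of column `e` that it reads are unchanged.
      have l₂ : I.Loaded (υ.setReal 11 [e + 1, v] (D.left (e + 1) v)) :=
        l₁.frame (Frame.setReal (rs := [11]) _ List.mem_cons_self [] _ _) rfl rfl
      have q₂ : I.Scratch q (υ.setReal 11 [e + 1, v] (D.left (e + 1) v)) :=
        q₁.frame (Frame.setReal (rs := [11]) _ List.mem_cons_self [] _ _) rfl
      rw [mul_one]
      refine .straight ⟨⟨EdgeExpr.straight_firstNear _ _ _ _, EdgeExpr.straight_firstNear _ _ _ _⟩,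
        EdgeExpr.straight_firstNear _ _ _ _, EdgeExpr.straight_firstNear _ _ _ _⟩ ?_
      rw [Program.exec, exec_cellRight l₁ q₁ he hv c₁ h14 (i₁ v hv) i₃,
        exec_cellTop l₂ q₂ he hv c₁ h14 (by simpa using i₁ v hv) (by simpa using i₃)]
      refine ⟨fun w hw => ?_, fun w hw => ?_, by simp [hD], fun e' he' => ?_⟩
      · simpa using i₁ w hw
      · rcases Nat.lt_succ_iff_lt_or_eq.1 hw with hw | rfl
        · simpa [hw.ne] using i₂ w hw
        · simp
      · simpa [he'.ne] using i₄ e' he'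
    · rcases Nat.lt_succ_iff_lt_or_eq.1 he' with h | rfl
      · exact hυ.2.2.2 e' h
      · exact hυ.2.2.1
  refine (first.seq fun τ hf hτ => Ok.loop (X := I.ℓ)
    (C := (columnBase d).steps + ((cellRight d).steps + (cellTop d).steps + 2 * 1 + 10))
    (fun e υ => (∀ v < I.ℓ, υ.real 11 [e, v] = D.left e v) ∧
      ∀ e' < e, υ.real 12 [e', I.ℓ] = D.bot e' I.ℓ) hℓ hn (not_mem_of_elem rfl)
      (fun υ hg => by rw [NExpr.eval_var, ((h.frame hf rfl rfl).frame hg rfl rfl).n])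
      (fun _ _ _ h => h) ⟨hτ, fun e he => absurd he (Nat.not_lt_zero e)⟩ ?_).mono ?_
      fun υ hυ => hυ.2
  · intro e he υ hg h13 ⟨i₁, i₂⟩
    have l₁ := (h.frame hf rfl rfl).frame hg rfl rfl
    have q₁ := (hq.frame hf rfl).frame hg rfl
    have c₁ : υ.nat 12 [] = i := by
      rw [hg.nat 12 (not_mem_of_elem rfl), hf.nat 12 (not_mem_of_elem rfl), h12]
    have hb : Ok I.S (columnBase d) υ (columnBase d).steps fun ω =>
        ω = υ.setReal 12 [e, 0] (D.bot e 0) :=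
      .straight ⟨trivial, trivial⟩ (exec_columnBase l₁ q₁ he hi h13 c₁)
    refine (hb.seq fun ω hh hω => inner e he ω (l₁.frame hh rfl rfl) (q₁.frame hh rfl)
      (by rw [hh.nat 13 (not_mem_of_elem rfl), h13]) ?_ ?_ ?_).mono ?_ fun _ h => h
    · intro v hv
      rw [hω]
      simpa using i₁ v hv
    · simp [hω, hD]
    · intro e' he'
      rw [hω]
      simpa [he'.ne] using i₂ e' he'
    · rw [mul_one]
      exact add_bound (Nat.le_mul_of_pos_right _ hℓ) (by rw [mul_one])
  · rw [NExpr.cost_var, NExpr.cost_var, mul_one]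
    exact add_bound (Nat.mul_le_mul_left _ (by rw [mul_one]; exact Nat.le_mul_of_pos_left _ hn)) le_rfl

end Tables

/-! ### Loops over pairs of breakpoints -/

/-- Runs `A` for all pairs `a < b` of breakpoints, held by the variables `10` and `11`. -/
def Program.forPairs (A : Program) : Program :=
  .forLoop 10 (.var 1) (.forLoop 11 (.var 1) (.ite (.natLt (.var 10) (.var 11)) A .skip))

/-- The invariant is indexed by the position in the lexicographic scan of all `m²` pairs; pairs with
`b ≤ a` only advance the position. In the constant, 4 pays for the comparison and `skip`, and each
of the two loops adds 12. -/
theorem Ok.forPairs {d ℓ : ℕ} {S : Subroutine d ℓ} {A : Program} {σ₀ : Store} {m C X : ℕ}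
    (Inv : ℕ → ℕ → Store → Prop) (hX : 1 ≤ X) (hm : 1 ≤ m)
    (hA : [1, 10, 11].all (fun a => !A.natWrites.elem a) = true) (hσ : σ₀.nat 1 [] = m)
    (hInv : ∀ a b σ τ, Frame [10, 11] [] σ τ → Inv a b σ → Inv a b τ)
    (h0 : Inv 0 0 σ₀) (hrow : ∀ a σ, Inv a m σ → Inv (a + 1) 0 σ)
    (hskip : ∀ a b σ, b ≤ a → Inv a b σ → Inv a (b + 1) σ)
    (step : ∀ a b, a < b → b < m → ∀ σ, Frame (10 :: 11 :: A.natWrites) A.realWrites σ₀ σ →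
      σ.nat 10 [] = a → σ.nat 11 [] = b → Inv a b σ → Ok S A σ (C * X) (Inv a (b + 1))) :
    Ok S (.forPairs A) σ₀ ((C + 28) * (m * (m * X))) (Inv m 0) := by
  replace hA : ∀ a ∈ [1, 10, 11], a ∉ A.natWrites := by simpa using hA
  have w1 := hA 1 (by simp)
  have w10 := hA 10 (by simp)
  have w11 := hA 11 (by simp)
  have sub : ∀ {σ τ : Store} {B : Program}, B.natWrites ⊆ 10 :: 11 :: A.natWrites →
      B.realWrites ⊆ A.realWrites →
      Frame (10 :: B.natWrites) B.realWrites σ τ →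
        Frame (10 :: 11 :: A.natWrites) A.realWrites σ τ := fun h₁ h₂ h =>
    h.mono (List.cons_subset.2 ⟨List.mem_cons_self, h₁⟩) h₂
  have s₁ : (Program.forLoop 11 (.var 1) (.ite (.natLt (.var 10) (.var 11)) A .skip)).natWrites ⊆
      10 :: 11 :: A.natWrites := by
    simp [Program.forLoop, Program.natWrites, Program.assign]
  have s₂ : (Program.forLoop 11 (.var 1) (.ite (.natLt (.var 10) (.var 11)) A .skip)).realWrites ⊆
      A.realWrites := by
    simp [Program.forLoop, Program.realWrites, Program.assign]
  refine (Ok.loop (X := m * X) (C := C + 16) (fun a => Inv a 0) (Nat.mul_pos hm hX) hm ?_ ?_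
    (fun k σ x => hInv k 0 _ _ (Frame.setNat σ (by simp) _ _ _)) h0 ?_).mono ?_ fun _ h => h
  · simp [Program.forLoop, Program.natWrites, Program.assign, w10]
  · intro σ hf
    rw [NExpr.eval_var, (sub s₁ s₂ hf).nat 1 (by simp [w1]), hσ]
  · intro a ha σ hf h10 hI
    have hf' := sub s₁ s₂ hf
    have r₁ : Program.natWrites (.ite (.natLt (.var 10) (.var 11)) A .skip) = A.natWrites :=
      List.append_nil _
    have r₂ : Program.realWrites (.ite (.natLt (.var 10) (.var 11)) A .skip) = A.realWrites :=
      List.append_nil _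
    refine (Ok.loop (X := X) (C := C + 4) (Inv a) hX hm ?_ ?_
      (fun k σ x => hInv a k _ _ (Frame.setNat σ (by simp) _ _ _)) hI ?_).mono ?_ fun _ h => hrow _ _ h
    · rw [r₁]
      exact w11
    · intro τ hg
      rw [r₁] at hg
      rw [NExpr.eval_var, hg.nat 1 (by simp [w1]), hf'.nat 1 (by simp [w1]), hσ]
    · intro b hb τ hg h11 hJ
      rw [r₁, r₂] at hg
      have g10 : τ.nat 10 [] = a := by rw [hg.nat 10 (by simp [w10]), h10]
      have hg' := hf'.trans (hg.mono (List.subset_cons_self _ _) (List.Subset.refl _))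
      refine (Ok.ite (T := C * X + 1) (fun hab => ?_) (fun hab => ?_)).mono ?_ fun _ h => h
      · simp only [BExpr.holds, NExpr.eval_var, g10, h11] at hab
        exact (step a b hab hb τ hg' g10 h11 hJ).mono (Nat.le_succ _) fun _ h => h
      · simp only [BExpr.holds, NExpr.eval_var, g10, h11] at hab
        exact (Ok.straight (A := .skip) trivial (hskip a b τ (not_lt.1 hab) hJ)).mono
          (Nat.le_add_left _ _) fun _ h => h
      · have : (BExpr.natLt (.var 10) (.var 11)).cost = 3 := rfl
        rw [this]
        nlinarith
    · rw [NExpr.cost_var]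
  · rw [NExpr.cost_var]

/-! ### The sets covered by the candidates -/

namespace Input

variable {d : ℕ} (I : Input d)

open Classical in
/-- The last breakpoint `j' < j` such that the subcurve from the breakpoint `i` to `j'` is near `q`,
or `prev` if the latter is larger. -/
def reach (q : PolyCurve d I.ℓ) (i prev : ℕ) : ℕ → ℕ
  | 0 => prev
  | j + 1 => if (i < j ∧ reach q i prev j < j) ∧ I.P.Near q I.δ i j then j else reach q i prev j

/-- The last breakpoint `j` for which a subcurve from a breakpoint `i' < i` to `j` is near `q`,
or `0`. -/
def far (q : PolyCurve d I.ℓ) : ℕ → ℕ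
  | 0 => 0
  | i + 1 => I.reach q i (far q i) I.m

end Input

/-- Updates the entry of the array `20` by the breakpoint in the variable `15`. -/
def reachStep (d : ℕ) : Program :=
  .ite (.and (.and (.natLt (.var 12) (.var 15))
      (.natLt (.read3 20 (.var 10) (.var 11) (NExpr.var 12).succ) (.var 15)))
      (.and (.realLe (.read2 12 (.read1 4 (.var 15)) (.var 2)) (.read1 3 (.var 15)))
        (.realLe ((trajEdge (.read1 4 (.var 15)) (.var 2)).quad d (.read1 3 (.var 15))) (.lit 0))))
    (.setNat3 20 (.var 10) (.var 11) (NExpr.var 12).succ (.var 15)) .skip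

/-- Handles the subcurves that start at the breakpoint in the variable `12`. -/
def farStep (d : ℕ) : Program :=
  .seq (tables d)
    (.seq (.setNat3 20 (.var 10) (.var 11) (NExpr.var 12).succ
        (.read3 20 (.var 10) (.var 11) (.var 12)))
      (.forLoop 15 (.var 1) (reachStep d)))

/-- Computes `far` for the center in the real array `10`. -/
def farLoop (d : ℕ) : Program :=
  .seq (.setNat3 20 (.var 10) (.var 11) (.lit 0) (.lit 0)) (.forLoop 12 (.var 1) (farStep d))

/-- Computes the simplifications of all subcurves and the sets covered by them. -/
def coverage (d : ℕ) : Program :=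
  .forPairs (.seq (.simplify (.var 10) (.var 11) 10) (farLoop d))

section Coverage

variable {d : ℕ}

theorem exec_reachStep {I : Input d} {σ : Store} {q : PolyCurve d I.ℓ} {a b i j : ℕ}
    (h : I.Loaded σ) (hq : I.Scratch q σ) (h10 : σ.nat 10 [] = a) (h11 : σ.nat 11 [] = b)
    (h12 : σ.nat 12 [] = i) (h15 : σ.nat 15 [] = j) (hj : j < I.m) {prev : ℕ}
    (hB : ∀ e < I.n, σ.real 12 [e, I.ℓ] = (I.P.diagram q I.δ i).bot e I.ℓ)
    (hM : σ.nat 20 [a, b, i + 1] = I.reach q i prev j) :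
    (reachStep d).exec σ = σ.setNat 20 [a, b, i + 1] (I.reach q i prev (j + 1)) := by
  have e15 : (NExpr.read1 4 (.var 15)).eval σ = I.P.col j := by simp [h15, h.col j hj]
  have E := eval_trajEdge h hq (.read1 4 (.var 15)) (.var 2) (by rw [e15]; exact I.P.col_lt j)
  rw [e15] at E
  rw [Input.reach]
  -- Writing back the old value does nothing, so the branch without an update also has the form of a
  -- write.
  have same : σ = σ.setNat 20 [a, b, i + 1] (I.reach q i prev j) := by
    refine Store.ext' ?_ rfl
    funext a' x'
    by_cases ha : a' = 20
    · subst ha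
      rw [Store.setNat_nat_self]
      split_ifs with hx
      · rw [hx, hM]
      · rfl
    · rw [Store.setNat_nat_of_ne _ ha]
  rw [reachStep, Program.exec]
  set B : BExpr := .and (.and (.natLt (.var 12) (.var 15))
      (.natLt (.read3 20 (.var 10) (.var 11) (NExpr.var 12).succ) (.var 15)))
      (.and (.realLe (.read2 12 (.read1 4 (.var 15)) (.var 2)) (.read1 3 (.var 15)))
        (.realLe ((trajEdge (.read1 4 (.var 15)) (.var 2)).quad d (.read1 3 (.var 15))) (.lit 0)))
    with hB'
  have key : B.holds σ ↔ (i < j ∧ I.reach q i prev j < j) ∧ I.P.Near q I.δ i j := by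
    simp only [hB', BExpr.holds, NExpr.eval_var, NExpr.eval_read3,
      NExpr.eval_succ, h10, h11, h12, h15, hM, RExpr.eval_read2, RExpr.eval_read1, e15, h.ℓ,
      hB _ (I.P.col_lt j), h.time j hj, E.quad, RExpr.eval, Nat.cast_zero]
    rfl
  by_cases hc : (i < j ∧ I.reach q i prev j < j) ∧ I.P.Near q I.δ i j
  · rw [if_pos (key.2 hc), if_pos hc]
    simp [h10, h11, h12, h15]
  · rw [if_neg (mt key.1 hc), if_neg hc, ← same, Program.exec]

/-- One reachability table for the start `i` answers the test for every end `j` in constant time.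
Hence a start costs `n ℓ + m` and not `m n ℓ`. -/
theorem ok_farStep (d : ℕ) : ∃ C, ∀ (I : Input d) (q : PolyCurve d I.ℓ) (σ : Store) (a b i : ℕ),
    I.Loaded σ → I.Scratch q σ → i < I.m → σ.nat 10 [] = a → σ.nat 11 [] = b → σ.nat 12 [] = i →
    σ.nat 20 [a, b, i] = I.far q i →
    Ok I.S (farStep d) σ (C * (I.n * I.ℓ + I.m)) fun τ =>
      ∀ x, τ.nat 20 x = if x = [a, b, i + 1] then I.far q (i + 1) else σ.nat 20 x := by
  obtain ⟨C, hC⟩ := ok_tables d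
  refine ⟨C + (Program.steps (.setNat3 20 (.var 10) (.var 11) (NExpr.var 12).succ
    (.read3 20 (.var 10) (.var 11) (.var 12))) + ((reachStep d).steps + 2 * 1 + 10)),
    fun I q σ a b i h hq hi h10 h11 h12 hM => ?_⟩
  have hm := I.m_pos
  refine ((hC I q σ i h hq hi h12).seq fun τ hf hB => Ok.seq (Ok.straight (A := .setNat3 20 _ _ _ _)
    (Q := fun υ => υ = τ.setNat 20 [a, b, i + 1] (I.far q i)) trivial ?_) fun υ hg hυ =>
    Ok.loop (X := 1) (C := (reachStep d).steps)
      (fun j ω => ∀ x, ω.nat 20 x = if x = [a, b, i + 1] then I.reach q i (I.far q i) j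
        else σ.nat 20 x) le_rfl hm (not_mem_of_elem rfl) ?_ ?_ ?_ ?_).mono ?_ fun _ h => h
  · simp [hf.nat 10 (not_mem_of_elem rfl), hf.nat 11 (not_mem_of_elem rfl),
      hf.nat 12 (not_mem_of_elem rfl), hf.nat 20 (not_mem_of_elem rfl), h10, h11, h12, hM]
  · intro ω hh
    rw [NExpr.eval_var, (((h.frame hf rfl rfl).frame hg rfl rfl).frame hh rfl rfl).m]
  · intro k ω x hω y
    simpa using hω y
  · intro x
    rw [hυ, Store.setNat_nat_self, hf.nat 20 (not_mem_of_elem rfl)]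
    rfl
  · intro j hj ω hh h15 hω
    have l₁ := ((h.frame hf rfl rfl).frame hg rfl rfl).frame hh rfl rfl
    have q₁ := ((hq.frame hf rfl).frame hg rfl).frame hh rfl
    have c : ∀ k, List.elem k [10, 11, 12] = true → ω.nat k = σ.nat k := by
      intro k hk
      have : k = 10 ∨ k = 11 ∨ k = 12 := by simpa using hk
      rcases this with rfl | rfl | rfl <;>
      rw [hh.nat _ (not_mem_of_elem rfl), hg.nat _ (not_mem_of_elem rfl),
        hf.nat _ (not_mem_of_elem rfl)]
    have hB' : ∀ e < I.n, ω.real 12 [e, I.ℓ] = (I.P.diagram q I.δ i).bot e I.ℓ := by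
      rw [hh.real 12 (not_mem_of_elem rfl), hg.real 12 (not_mem_of_elem rfl)]
      exact hB
    rw [mul_one]
    refine .straight ⟨trivial, trivial⟩ fun x => ?_
    rw [exec_reachStep l₁ q₁ (by rw [c 10 rfl, h10]) (by rw [c 11 rfl, h11]) (by rw [c 12 rfl, h12])
      h15 hj hB' ((hω _).trans (if_pos rfl)), Store.setNat_nat_self, hω]
    split_ifs <;> rfl
  · have : 1 ≤ I.n * I.ℓ + I.m := by omega
    rw [NExpr.cost_var, mul_one]
    exact add_bound (Nat.mul_le_mul_left _ (Nat.le_add_right _ _))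
      (add_bound (Nat.le_mul_of_pos_right _ this) (Nat.mul_le_mul_left _ (by omega)))

theorem ok_farLoop (d : ℕ) : ∃ C, ∀ (I : Input d) (q : PolyCurve d I.ℓ) (σ : Store) (a b : ℕ),
    I.Loaded σ → I.Scratch q σ → σ.nat 10 [] = a → σ.nat 11 [] = b →
    Ok I.S (farLoop d) σ (C * (I.m * (I.n * I.ℓ + I.m))) fun τ =>
      (∀ i ≤ I.m, τ.nat 20 [a, b, i] = I.far q i) ∧
        ∀ a' b' i, ¬ (a' = a ∧ b' = b) → τ.nat 20 [a', b', i] = σ.nat 20 [a', b', i] := by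
  obtain ⟨C, hC⟩ := ok_farStep d
  refine ⟨Program.steps (.setNat3 20 (.var 10) (.var 11) (.lit 0) (.lit 0)) + (C + 2 * 1 + 10),
    fun I q σ a b h hq h10 h11 => ?_⟩
  have hm := I.m_pos
  have pos : 1 ≤ I.n * I.ℓ + I.m := by omega
  refine (Ok.seq (Ok.straight (A := .setNat3 20 _ _ _ _)
    (Q := fun υ => υ = σ.setNat 20 [a, b, 0] 0) trivial ?_) fun τ hf hτ =>
    Ok.loop (X := I.n * I.ℓ + I.m) (C := C)
      (fun k ω => (∀ i ≤ k, ω.nat 20 [a, b, i] = I.far q i) ∧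
        ∀ a' b' i, ¬ (a' = a ∧ b' = b) → ω.nat 20 [a', b', i] = σ.nat 20 [a', b', i])
      pos hm (not_mem_of_elem rfl) ?_ ?_ ?_ ?_).mono ?_ fun _ h => h
  · simp [h10, h11, NExpr.eval]
  · intro ω hg
    rw [NExpr.eval_var, ((h.frame hf rfl rfl).frame hg rfl rfl).m]
  · intro k ω x hω
    simpa using hω
  · rw [hτ]
    refine ⟨fun i hi => ?_, fun a' b' i hne => ?_⟩
    · obtain rfl : i = 0 := by omega
      simp [Input.far]
    · simp only [Store.setNat_nat_self]
      rw [if_neg (by simp only [List.cons.injEq]; tauto)]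
  · intro i hi ω hg h12 ⟨i₁, i₂⟩
    have l₁ := (h.frame hf rfl rfl).frame hg rfl rfl
    have q₁ := (hq.frame hf rfl).frame hg rfl
    refine (hC I q ω a b i l₁ q₁ hi ?_ ?_ h12 (i₁ i le_rfl)).mono le_rfl fun υ hυ =>
      ⟨fun i' hi' => ?_, fun a' b' i' hne => ?_⟩
    · rw [hg.nat 10 (not_mem_of_elem rfl), hf.nat 10 (not_mem_of_elem rfl), h10]
    · rw [hg.nat 11 (not_mem_of_elem rfl), hf.nat 11 (not_mem_of_elem rfl), h11]
    · rw [hυ]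
      split_ifs with hx
      · simp only [List.cons.injEq, and_true, true_and] at hx
        rw [hx]
      · refine i₁ i' ?_
        have : i' ≠ i + 1 := by simpa using hx
        omega
    · rw [hυ, if_neg (by simp only [List.cons.injEq]; tauto), i₂ a' b' i' hne]
  · rw [NExpr.cost_var]
    exact add_bound (Nat.le_mul_of_pos_right _ (Nat.mul_pos hm pos)) le_rfl

theorem scratch_setCurve (I : Input d) (σ : Store) (q : PolyCurve d I.ℓ) :
    I.Scratch q (σ.setCurve 10 q) := by
  intro v c hc
  have hℓ := I.ℓ_pos
  have : 10 = 10 ∧ min v (I.ℓ - 1) < I.ℓ ∧ c < d := ⟨rfl, by omega, hc⟩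
  refine (dif_pos this).trans ?_
  rw [coord, dif_pos hc, vtx, dif_pos hℓ]

theorem ok_simplify {I : Input d} {σ : Store} {x y : NExpr} {a b : ℕ} (hx : x.eval σ = a)
    (hy : y.eval σ = b) (hab : a < b) (hb : b < I.m) (t : ℕ) :
    Ok I.S (.simplify x y t) σ ((1 + x.cost + y.cost + d) * (I.ℓ + I.T)) fun τ =>
      τ = σ.setCurve t (I.S.answer a b) := by
  have run := Runs.simplify (S := I.S) σ x y t
  rw [hx, hy] at run
  refine ⟨_, _, run, ?_, rfl⟩
  have hT : I.S.time a b ≤ I.T := (I.computes ⟨a, hab.trans hb⟩ ⟨b, hb⟩ hab).2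
  have hℓ := I.ℓ_pos
  nlinarith [Nat.zero_le (x.cost * I.T), Nat.zero_le (y.cost * I.T), Nat.zero_le (d * I.T),
    Nat.mul_le_mul_left x.cost hℓ, Nat.mul_le_mul_left y.cost hℓ]

/-- For each candidate only its values `far` are kept; the curve itself is overwritten. A selected
candidate is computed again for the output, which yields the same curve because the subroutine is
deterministic. -/
theorem ok_coverage (d : ℕ) : ∃ C, ∀ (I : Input d) (σ : Store), I.Loaded σ →
    Ok I.S (coverage d) σ
      (C * (I.m * (I.m * (I.ℓ + I.T + I.m * (I.n * I.ℓ + I.m))))) fun τ =>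
      ∀ a b, a < b → b < I.m → ∀ i ≤ I.m, τ.nat 20 [a, b, i] = I.far (I.S.answer a b) i := by
  obtain ⟨C, hC⟩ := ok_farLoop d
  refine ⟨(1 + 1 + 1 + d) + C + 28, fun I σ h => ?_⟩
  have hm := I.m_pos
  have hℓ := I.ℓ_pos
  refine (Ok.forPairs (X := I.ℓ + I.T + I.m * (I.n * I.ℓ + I.m)) (C := (1 + 1 + 1 + d) + C)
    (fun a b τ => ∀ a' b', a' < b' → b' < I.m → (a' < a ∨ a' = a ∧ b' < b) → ∀ i ≤ I.m,
      τ.nat 20 [a', b', i] = I.far (I.S.answer a' b') i) (by omega) hm rfl h.m ?_ ?_ ?_ ?_ ?_).mono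
    le_rfl ?_
  · intro a b τ υ hf hτ
    rw [hf.nat 20 (not_mem_of_elem rfl)]
    exact hτ
  · intro a' b' _ _ hlt
    omega
  · intro a τ hτ a' b' h₁ h₂ h₃
    exact hτ a' b' h₁ h₂ (by omega)
  · intro a b τ hba hτ a' b' h₁ h₂ h₃
    exact hτ a' b' h₁ h₂ (by omega)
  · intro a b hab hb τ hf h10 h11 hI
    have l₁ := h.frame hf rfl rfl
    refine ((ok_simplify (a := a) (b := b) (by simp [h10]) (by simp [h11]) hab hb 10).seq
      (R := fun ω => (∀ i ≤ I.m, ω.nat 20 [a, b, i] = I.far (I.S.answer a b) i) ∧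
        ∀ a' b' i, ¬ (a' = a ∧ b' = b) → ω.nat 20 [a', b', i] = τ.nat 20 [a', b', i])
      fun υ hg hυ => (hC I (I.S.answer a b) υ a b (l₁.frame hg rfl rfl) ?_ ?_ ?_).mono le_rfl
        fun ω hω => ?_).mono ?_ ?_
    · rw [hυ]
      exact scratch_setCurve I τ _
    · rw [hg.nat 10 (not_mem_of_elem rfl), h10]
    · rw [hg.nat 11 (not_mem_of_elem rfl), h11]
    · rwa [hg.nat 20 (not_mem_of_elem rfl)] at hω
    · rw [NExpr.cost_var, NExpr.cost_var]
      exact add_bound (Nat.mul_le_mul_left _ (Nat.le_add_right _ _))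
        (Nat.mul_le_mul_left _ (Nat.le_add_left _ _))
    · intro ω hω a' b' h₁ h₂ h₃ i hi
      by_cases hc : a' = a ∧ b' = b
      · rw [hc.1, hc.2]
        exact hω.1 i hi
      · rw [hω.2 a' b' i hc]
        exact hI a' b' h₁ h₂ (by omega) i hi
  · intro τ hτ a b hab hb
    exact hτ a b hab hb (by omega)

end Coverage

/-! ### Preparation of the memory -/

/-- Tests whether the edge in the variable `13` starts before the breakpoint in the variable `15`. -/
def colStep : Program :=
  .ite (.realLe (.read1 2 (.var 13)) (.read1 3 (.var 15))) (.setNat1 4 (.var 15) (.var 13)) .skip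

/-- Completes the input. -/
def setup : Program :=
  .seq (.setReal1 2 (.var 0) (.lit 1))
    (.seq (.forLoop 14 (.var 2)
        (.setReal1 5 (NExpr.var 14).succ (.add (.read1 5 (.var 14)) (.lit 1))))
      (.forLoop 15 (.var 1) (.forLoop 13 (.var 0) colStep)))

section Setup

variable {d : ℕ}

theorem coord_vtx_of_lt {n : ℕ} (p : Fin n → Pt d) {e c : ℕ} (he : e < n) (hc : c < d) :
    coord (vtx p e) c = p ⟨e, he⟩ ⟨c, hc⟩ := by
  have h : 0 < n := by omega
  have e' : (⟨min e (n - 1), by omega⟩ : Fin n) = ⟨e, he⟩ := Fin.ext (min_eq_left (by omega))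
  rw [coord, dif_pos hc, vtx, dif_pos h, e']

theorem ok_setup : ∃ C, ∀ {d : ℕ} (I : Input d),
    Ok I.S setup (inputStore I.P I.ℓ I.Δ) (C * (I.ℓ + I.m * I.n)) I.Loaded := by
  refine ⟨Program.steps (.setReal1 2 (.var 0) (.lit 1)) + ((Program.steps (.setReal1 5
    (NExpr.var 14).succ (.add (.read1 5 (.var 14)) (.lit 1))) + 2 * 1 + 10) +
    (colStep.steps + 2 * 1 + 10 + 2 * 1 + 10)), fun I => ?_⟩
  have hm := I.m_pos
  have hℓ : 1 ≤ I.ℓ := I.ℓ_pos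
  have hn : 1 ≤ I.n := I.P.n_pos
  set σ := inputStore I.P I.ℓ I.Δ with hσ
  have first : Ok I.S (.setReal1 2 (.var 0) (.lit 1)) σ
      (Program.steps (.setReal1 2 (.var 0) (.lit 1))) fun τ => ∀ e ≤ I.n, τ.real 2 [e] = I.P.xs e := by
    refine .straight trivial fun e he => ?_
    simp only [Program.exec_setReal1, NExpr.eval_var, Store.setReal_real_self, RExpr.eval]
    have h0 : σ.nat 0 [] = I.n := rfl
    rw [h0, Trajectory.xs, knot]
    rcases he.lt_or_eq with h | rfl
    · have : σ.real 2 [e] = if h : e < I.n then I.P.param ⟨e, h⟩ else 0 := rfl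
      rw [if_neg (by simpa using h.ne), dif_pos h, this, dif_pos h]
    · rw [if_pos rfl, dif_neg (lt_irrefl _), Nat.cast_one]
  refine (first.seq fun τ hf hxs => (Ok.loop (X := 1) (K := I.ℓ) (C := Program.steps (.setReal1 5
    (NExpr.var 14).succ (.add (.read1 5 (.var 14)) (.lit 1))))
    (fun k υ => ∀ v ≤ k, υ.real 5 [v] = v) le_rfl hℓ (not_mem_of_elem rfl) ?_ (fun _ _ _ h => h)
    ?_ ?_).seq fun υ hg hys => (Ok.loop (X := I.n * 1) (K := I.m) (C := colStep.steps + 2 * 1 + 10)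
    (fun k ω => (∀ j < k, ω.nat 4 [j] = I.P.col j) ∧ ∀ j, k ≤ j → ω.nat 4 [j] = 0) (by omega) hm
    (not_mem_of_elem rfl) ?_ ?_ ?_ ?_).frame.mono le_rfl fun ω hω => ?_).mono ?_ fun _ h => h
  · intro υ hg
    rw [NExpr.eval_var, hg.nat 2 (not_mem_of_elem rfl), hf.nat 2 (not_mem_of_elem rfl)]
    rfl
  · intro v hv
    obtain rfl : v = 0 := by omega
    rw [hf.real 5 (not_mem_of_elem rfl), Nat.cast_zero]
    rfl
  · intro k hk υ hg h14 hI
    rw [mul_one]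
    refine .straight trivial fun v hv => ?_
    simp only [Program.exec_setReal1, Store.setReal_real_self, NExpr.eval_succ, NExpr.eval_var, h14,
      RExpr.eval, RExpr.eval_read1, hI k le_rfl]
    split_ifs with hc
    · obtain rfl : v = k + 1 := by simpa using hc
      push_cast
      rfl
    · refine hI v ?_
      have : v ≠ k + 1 := by simpa using hc
      omega
  · intro ω hh
    rw [NExpr.eval_var, hh.nat 1 (not_mem_of_elem rfl), hg.nat 1 (not_mem_of_elem rfl),
      hf.nat 1 (not_mem_of_elem rfl)]
    rfl
  · intro k ω x hω
    simpa using hω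
  · rw [hg.nat 4 (not_mem_of_elem rfl), hf.nat 4 (not_mem_of_elem rfl)]
    exact ⟨fun j hj => absurd hj (Nat.not_lt_zero j), fun j _ => rfl⟩
  · intro j hj ω hh h15 ⟨i₁, i₂⟩
    classical
    -- Edges are scanned upwards and later hits overwrite earlier ones, so the entry is the greatest
    -- hit among the edges seen. With truncated subtraction the search bound `k - 1` is 0 both
    -- before and after edge 0, in accordance with the initial entry 0.
    refine (Ok.loop (X := 1) (K := I.n) (C := colStep.steps)
      (fun k ρ => (ρ.nat 4 [j] =
        Nat.findGreatest (fun e => I.P.xs e ≤ I.P.time j) (k - 1)) ∧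
          ∀ j', j' ≠ j → ρ.nat 4 [j'] = ω.nat 4 [j']) le_rfl hn (not_mem_of_elem rfl)
      ?_ ?_ ?_ ?_).mono ?_ fun ρ hρ => ⟨fun j' hj' => ?_, fun j' hj' => ?_⟩
    · intro ρ hk
      rw [NExpr.eval_var, hk.nat 0 (not_mem_of_elem rfl), hh.nat 0 (not_mem_of_elem rfl),
        hg.nat 0 (not_mem_of_elem rfl), hf.nat 0 (not_mem_of_elem rfl)]
      rfl
    · intro k ρ x hρ
      simpa using hρ
    · refine ⟨?_, fun _ _ => rfl⟩
      rw [i₂ j le_rfl, Nat.findGreatest_zero]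
    · intro e he ρ hk h13 ⟨j₁, j₂⟩
      have k15 : ρ.nat 15 [] = j := by rw [hk.nat 15 (not_mem_of_elem rfl), h15]
      have kx : ρ.real 2 [e] = I.P.xs e := by
        rw [hk.real 2 (not_mem_of_elem rfl), hh.real 2 (not_mem_of_elem rfl),
          hg.real 2 (not_mem_of_elem rfl)]
        exact hxs e he.le
      have kt : ρ.real 3 [j] = I.P.time j := by
        rw [hk.real 3 (not_mem_of_elem rfl), hh.real 3 (not_mem_of_elem rfl),
          hg.real 3 (not_mem_of_elem rfl), hf.real 3 (not_mem_of_elem rfl)]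
        rfl
      rw [mul_one]
      refine .straight ⟨trivial, trivial⟩ ?_
      simp only [colStep, Program.exec, BExpr.holds, RExpr.eval_read1, NExpr.eval_var, h13, k15, kx,
        kt, Program.exec_setNat1]
      split_ifs with hc
      · refine ⟨?_, fun j' hj' => ?_⟩
        · rw [Store.setNat_nat_self, if_pos rfl, Nat.add_sub_cancel]
          exact (Nat.findGreatest_eq hc).symm
        · rw [Store.setNat_nat_self, if_neg (by simpa using hj'), j₂ j' hj']
      · refine ⟨?_, j₂⟩
        rw [j₁, Nat.add_sub_cancel]
        rcases e with _ | e
        · rfl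
        · rw [Nat.findGreatest_of_not hc, Nat.add_sub_cancel]
    · rw [NExpr.cost_var]
    · by_cases h : j' = j
      · rw [h, hρ.1]
        unfold Trajectory.col
        congr!
      · rw [hρ.2 j' h]
        exact i₁ j' (by omega)
    · rw [hρ.2 j' (by omega)]
      exact i₂ j' (by omega)
  · obtain ⟨hh, hcol, -⟩ := hω
    have nat : ∀ k, List.elem k [0, 1, 2] = true → ω.nat k = σ.nat k := by
      intro k hk
      have : k = 0 ∨ k = 1 ∨ k = 2 := by simpa using hk
      rcases this with rfl | rfl | rfl <;>
      rw [hh.nat _ (not_mem_of_elem rfl), hg.nat _ (not_mem_of_elem rfl),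
        hf.nat _ (not_mem_of_elem rfl)]
    have real : ∀ k, List.elem k [0, 1, 3] = true → ω.real k = σ.real k := by
      intro k hk
      have : k = 0 ∨ k = 1 ∨ k = 3 := by simpa using hk
      rcases this with rfl | rfl | rfl <;>
      rw [hh.real _ (not_mem_of_elem rfl), hg.real _ (not_mem_of_elem rfl),
        hf.real _ (not_mem_of_elem rfl)]
    constructor
    · rw [nat 0 rfl]; rfl
    · rw [nat 1 rfl]; rfl
    · rw [nat 2 rfl]; rfl
    · exact hcol
    · rw [real 0 rfl]; rfl
    · intro e c hc
      have he : min e (I.n - 1) < I.n := by omega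
      rw [real 1 rfl]
      refine (dif_pos (⟨he, hc⟩ : min e (I.n - 1) < I.n ∧ c < _)).trans ?_
      rw [coord, dif_pos hc, vtx, dif_pos I.P.n_pos]
    · rw [hh.real 2 (not_mem_of_elem rfl), hg.real 2 (not_mem_of_elem rfl)]
      exact hxs
    · intro j _
      rw [real 3 rfl]
      rfl
    · rw [hh.real 5 (not_mem_of_elem rfl)]
      exact hys
  · rw [NExpr.cost_var, NExpr.cost_var]
    have : 1 ≤ I.ℓ + I.m * I.n := by omega
    refine add_bound (Nat.le_mul_of_pos_right _ this) (add_bound ?_ ?_)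
    · exact Nat.mul_le_mul_left _ (by omega)
    · exact Nat.mul_le_mul_left _ (by rw [mul_one]; exact Nat.le_add_left _ _)

end Setup

/-! ### The greedy algorithm -/

namespace Input

variable {d : ℕ} (I : Input d)

/-- The element `e`, which stands for the interval between the breakpoints `e` and `e + 1`, is
covered by the simplification of the subcurve between the breakpoints `a` and `b`. -/
def Covers (a b e : ℕ) : Prop := e < I.far (I.S.answer a b) (e + 1)

open Classical in
/-- The number of elements in `U` that are covered by a candidate. -/
def gain (U : ℕ → Prop) (a b : ℕ) : ℕ := Nat.count (fun e => U e ∧ I.Covers a b e) (I.m - 1)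

open Classical in
/-- The best one of the candidates `(a, 0), …, (a, b - 1)` and a given one, with its gain. -/
def rowBest (U : ℕ → Prop) (a : ℕ) (s : ℕ × ℕ × ℕ) : ℕ → ℕ × ℕ × ℕ
  | 0 => s
  | b + 1 => if a < b ∧ (rowBest U a s b).1 < I.gain U a b then (I.gain U a b, a, b)
    else rowBest U a s b

/-- The best one of the candidates in the first rows, with its gain. -/
def best (U : ℕ → Prop) : ℕ → ℕ × ℕ × ℕ
  | 0 => (0, 0, 1)
  | a + 1 => I.rowBest U a (best U a) I.m

/-- The elements that are not covered after some rounds. -/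
def Uncovered : ℕ → ℕ → Prop
  | 0, _ => True
  | r + 1, e => Uncovered r e ∧
      ¬ I.Covers (I.best (Uncovered r) I.m).2.1 (I.best (Uncovered r) I.m).2.2 e

/-- The candidate selected in a round, with its gain. -/
def pick (r : ℕ) : ℕ × ℕ × ℕ := I.best (I.Uncovered r) I.m

/-- The number of selected candidates. -/
def rounds : ℕ → ℕ
  | 0 => 0
  | r + 1 => if 0 < (I.pick r).1 then r + 1 else rounds r

/-- The selected centers. -/
def center (r : ℕ) : PolyCurve d I.ℓ := I.S.answer (I.pick r).2.1 (I.pick r).2.2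

theorem rowBest_lt (U : ℕ → Prop) (a : ℕ) {s : ℕ × ℕ × ℕ} (hs : s.2.1 < s.2.2 ∧ s.2.2 < I.m) {b : ℕ}
    (hb : b ≤ I.m) : (I.rowBest U a s b).2.1 < (I.rowBest U a s b).2.2 ∧
      (I.rowBest U a s b).2.2 < I.m := by
  induction b with
  | zero => exact hs
  | succ b ih =>
    rw [rowBest]
    split_ifs with h
    · exact ⟨h.1, hb⟩
    · exact ih (by omega)

/-- The default pair `(0, 1)` is legal because `m ≥ 2`. Hence the subroutine may be called even in a
round in which no candidate gains anything. -/
theorem best_lt (U : ℕ → Prop) (a : ℕ) :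
    (I.best U a).2.1 < (I.best U a).2.2 ∧ (I.best U a).2.2 < I.m := by
  induction a with
  | zero => exact ⟨zero_lt_one, I.P.two_le⟩
  | succ a ih => exact I.rowBest_lt U a ih le_rfl

/-- The natural variables `23`, `24`, `25` contain a candidate and its gain. -/
def Holds (s : ℕ × ℕ × ℕ) (σ : Store) : Prop :=
  σ.nat 23 [] = s.1 ∧ σ.nat 24 [] = s.2.1 ∧ σ.nat 25 [] = s.2.2

/-- The array `20` contains the coverage of all candidates. -/
def CoverageTable (σ : Store) : Prop :=
  ∀ a b, a < b → b < I.m → ∀ i ≤ I.m, σ.nat 20 [a, b, i] = I.far (I.S.answer a b) i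

/-- The array `22` marks the elements outside of `U`. -/
def Marks (U : ℕ → Prop) (σ : Store) : Prop := ∀ e < I.m - 1, σ.nat 22 [e] = 0 ↔ U e

end Input

/-- The expression `m - 1`. -/
def lastElem : NExpr := .sub (.var 1) (.lit 1)

/-- Counts the element in the variable `13` if the current candidate gains it. -/
def countStep : Program :=
  .ite (.and (.natEq (.read1 22 (.var 13)) (.lit 0))
      (.natLt (.var 13) (.read3 20 (.var 10) (.var 11) (NExpr.var 13).succ)))
    (.assign 21 (NExpr.var 21).succ) .skip

/-- Replaces the best candidate by the current one if that is better. -/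
def compare : Program :=
  .ite (.natLt (.var 23) (.var 21))
    (.seq (.assign 23 (.var 21)) (.seq (.assign 24 (.var 10)) (.assign 25 (.var 11)))) .skip

/-- Finds the best candidate. -/
def choose : Program :=
  .seq (.seq (.assign 23 (.lit 0)) (.seq (.assign 24 (.lit 0)) (.assign 25 (.lit 1))))
    (.forPairs (.seq (.assign 21 (.lit 0)) (.seq (.forLoop 13 lastElem countStep) compare)))

/-- Marks the element in the variable `13` if the best candidate covers it. -/
def markStep : Program :=
  .ite (.natLt (.var 13) (.read3 20 (.var 24) (.var 25) (NExpr.var 13).succ))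
    (.setNat1 22 (.var 13) (.lit 1)) .skip

/-- Copies a coordinate to the output. -/
def copyStep : Program :=
  .setReal3 4 (.var 16) (.var 14) (.var 17) (.read2 10 (.var 14) (.var 17))

/-- Outputs the best candidate. -/
def emit (d : ℕ) : Program :=
  .seq (.simplify (.var 24) (.var 25) 10) (.forLoop 14 (.var 2) (.forLoop 17 (.lit d) copyStep))

/-- Counts the round in the variable `16` if it makes progress. -/
def countRound : Program := .ite (.natLt (.lit 0) (.var 23)) (.assign 3 (NExpr.var 16).succ) .skip

/-- A round of the greedy algorithm. -/
def round (d : ℕ) : Program :=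
  .seq choose (.seq countRound (.seq (.forLoop 13 lastElem markStep) (emit d)))

/-- The greedy algorithm. -/
def greedy (d : ℕ) : Program := .forLoop 16 (.var 1) (round d)

/-- The whole algorithm. -/
def algorithm (d : ℕ) : Program := .seq setup (.seq (coverage d) (greedy d))

section Greedy

theorem Input.Loaded.lastElem {d : ℕ} {I : Input d} {σ : Store} (h : I.Loaded σ) :
    lastElem.eval σ = I.m - 1 := by
  simp [Subtraj.lastElem, NExpr.eval, h.m]

theorem lastElem_cost : lastElem.cost = 3 := rfl

/-- The gain of each of the at most `m²` candidates is counted afresh over the `m - 1` elements.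
Testing one element costs a single comparison with the coverage table, so a round stays within `m³`.
-/
theorem ok_choose : ∃ C, ∀ {d : ℕ} (I : Input d) (σ : Store) (U : ℕ → Prop), I.Loaded σ →
    I.CoverageTable σ → I.Marks U σ →
    Ok I.S choose σ (C * (I.m * (I.m * I.m))) (Input.Holds (I.best U I.m)) := by
  refine ⟨Program.steps (.seq (.assign 23 (.lit 0)) (.seq (.assign 24 (.lit 0)) (.assign 25 (.lit 1)))) +
    ((Program.steps (.assign 21 (.lit 0)) + ((countStep.steps + 2 * 3 + 10) + compare.steps)) + 28),
    fun I σ U h hM hD => ?_⟩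
  have hm := I.m_pos
  have hm2 := I.P.two_le
  have init : Ok I.S (.seq (.assign 23 (.lit 0)) (.seq (.assign 24 (.lit 0)) (.assign 25 (.lit 1)))) σ
      (Program.steps (.seq (.assign 23 (.lit 0)) (.seq (.assign 24 (.lit 0)) (.assign 25 (.lit 1)))))
      (Input.Holds (0, 0, 1)) := by
    refine .straight ⟨trivial, trivial, trivial⟩ ?_
    simp [Program.exec, Input.Holds, NExpr.eval]
  refine (init.seq fun τ hf hτ => Ok.forPairs (X := I.m) (m := I.m)
    (C := Program.steps (.assign 21 (.lit 0)) + ((countStep.steps + 2 * 3 + 10) + compare.steps))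
    (fun a b => Input.Holds (I.rowBest U a (I.best U a) b)) hm hm rfl
    (h.frame hf rfl rfl).m ?_ hτ (fun _ _ h => h) ?_ ?_).mono ?_ fun _ h => h
  · intro a b υ ω hg hυ
    unfold Input.Holds
    rw [hg.nat 23 (not_mem_of_elem rfl), hg.nat 24 (not_mem_of_elem rfl),
      hg.nat 25 (not_mem_of_elem rfl)]
    exact hυ
  · intro a b υ hba hυ
    rw [Input.rowBest, if_neg (by omega)]
    exact hυ
  · intro a b hab hb υ hg h10 h11 hυ
    classical
    have l₁ := (h.frame hf rfl rfl).frame hg rfl rfl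
    have c20 : υ.nat 20 = σ.nat 20 := by
      rw [hg.nat 20 (not_mem_of_elem rfl), hf.nat 20 (not_mem_of_elem rfl)]
    have c22 : υ.nat 22 = σ.nat 22 := by
      rw [hg.nat 22 (not_mem_of_elem rfl), hf.nat 22 (not_mem_of_elem rfl)]
    refine ((Ok.straight (A := .assign 21 (.lit 0)) (Q := fun ω => ω.nat 21 [] = 0) trivial ?_).seq
      fun ω hh h21 => (Ok.loop (X := 1) (K := I.m - 1) (C := countStep.steps)
        (fun k ρ => ρ.nat 21 [] = Nat.count (fun e => U e ∧ I.Covers a b e) k) le_rfl (by omega)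
        (not_mem_of_elem rfl) ?_ ?_ ?_ ?_).seq fun ρ hk h21' => Ok.straight (A := compare)
        ⟨⟨trivial, trivial, trivial⟩, trivial⟩ ?_).mono ?_ fun _ h => h
    · simp [NExpr.eval]
    · intro ρ hk
      rw [((l₁.frame hh rfl rfl).frame hk rfl rfl).lastElem]
    · intro k ρ x hρ
      simpa using hρ
    · rw [h21, Nat.count_zero]
    · intro e he ρ hk h13 hρ
      have k10 : ρ.nat 10 [] = a := by
        rw [hk.nat 10 (not_mem_of_elem rfl), hh.nat 10 (not_mem_of_elem rfl), h10]
      have k11 : ρ.nat 11 [] = b := by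
        rw [hk.nat 11 (not_mem_of_elem rfl), hh.nat 11 (not_mem_of_elem rfl), h11]
      have k20 : ρ.nat 20 [a, b, e + 1] = I.far (I.S.answer a b) (e + 1) := by
        rw [hk.nat 20 (not_mem_of_elem rfl), hh.nat 20 (not_mem_of_elem rfl), c20]
        exact hM a b hab hb _ (by omega)
      have k22 : ρ.nat 22 [e] = 0 ↔ U e := by
        rw [hk.nat 22 (not_mem_of_elem rfl), hh.nat 22 (not_mem_of_elem rfl), c22]
        exact hD e he
      have key : (BExpr.and (.natEq (.read1 22 (.var 13)) (.lit 0))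
          (.natLt (.var 13) (.read3 20 (.var 10) (.var 11) (NExpr.var 13).succ))).holds ρ ↔
          U e ∧ I.Covers a b e := by
        simp only [BExpr.holds, NExpr.eval_read1, NExpr.eval_var, NExpr.eval_read3,
          NExpr.eval_succ, h13, k10, k11, k20, NExpr.eval, k22]
        rfl
      rw [mul_one]
      refine .straight ⟨trivial, trivial⟩ ?_
      rw [countStep, Program.exec, Nat.count_succ]
      by_cases hc : U e ∧ I.Covers a b e
      · rw [if_pos (key.2 hc), if_pos hc]
        simp [hρ]
      · rw [if_neg (mt key.1 hc), if_neg hc, Program.exec, hρ, add_zero]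
    · have e21 : ρ.nat 21 [] = I.gain U a b := h21'
      obtain ⟨s₁, s₂, s₃⟩ := hυ
      have c : ∀ x, List.elem x [10, 11, 23, 24, 25] = true → ρ.nat x = υ.nat x := by
        intro x hx
        have : x = 10 ∨ x = 11 ∨ x = 23 ∨ x = 24 ∨ x = 25 := by simpa using hx
        rcases this with rfl | rfl | rfl | rfl | rfl <;>
        rw [hk.nat _ (not_mem_of_elem rfl), hh.nat _ (not_mem_of_elem rfl)]
      rw [Input.rowBest]
      simp only [compare, Program.exec, BExpr.holds, NExpr.eval_var, e21, c 23 rfl, s₁, hab,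
        true_and]
      split_ifs with hc
      · simp [Input.Holds, e21, c 10 rfl, c 11 rfl, h10, h11]
      · exact ⟨by rw [c 23 rfl, s₁], by rw [c 24 rfl, s₂], by rw [c 25 rfl, s₃]⟩
    · rw [lastElem_cost, mul_one]
      exact add_bound (Nat.le_mul_of_pos_right _ hm) (add_bound
        (Nat.mul_le_mul_left _ (Nat.sub_le _ _)) (Nat.le_mul_of_pos_right _ hm))
  · exact add_bound (Nat.le_mul_of_pos_right _ (Nat.mul_pos hm (Nat.mul_pos hm hm))) le_rfl

theorem ok_mark : ∃ C, ∀ {d : ℕ} (I : Input d) (σ : Store) (r : ℕ), I.Loaded σ →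
    I.CoverageTable σ → I.Marks (I.Uncovered r) σ → Input.Holds (I.pick r) σ →
    Ok I.S (.forLoop 13 lastElem markStep) σ (C * I.m) (I.Marks (I.Uncovered (r + 1))) := by
  refine ⟨markStep.steps + 2 * 3 + 10, fun I σ r h hM hD hp => ?_⟩
  have hm := I.P.two_le
  have lt := I.best_lt (I.Uncovered r) I.m
  obtain ⟨-, p₁, p₂⟩ := hp
  refine (Ok.loop (X := 1) (K := I.m - 1) (C := markStep.steps)
    (fun k τ => (∀ e < k, τ.nat 22 [e] = 0 ↔ I.Uncovered (r + 1) e) ∧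
      ∀ e, k ≤ e → τ.nat 22 [e] = σ.nat 22 [e]) le_rfl (by omega) (not_mem_of_elem rfl) ?_ ?_
    ⟨fun e he => absurd he (Nat.not_lt_zero e), fun _ _ => rfl⟩ ?_).mono ?_ fun _ h => h.1
  · intro τ hf
    rw [(h.frame hf rfl rfl).lastElem]
  · intro k τ x hτ
    simpa using hτ
  · intro e he τ hf h13 ⟨i₁, i₂⟩
    have k24 : τ.nat 24 [] = (I.pick r).2.1 := by rw [hf.nat 24 (not_mem_of_elem rfl), p₁]
    have k25 : τ.nat 25 [] = (I.pick r).2.2 := by rw [hf.nat 25 (not_mem_of_elem rfl), p₂]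
    have k20 : τ.nat 20 [(I.pick r).2.1, (I.pick r).2.2, e + 1] =
        I.far (I.S.answer (I.pick r).2.1 (I.pick r).2.2) (e + 1) := by
      rw [hf.nat 20 (not_mem_of_elem rfl)]
      exact hM _ _ lt.1 lt.2 _ (by omega)
    have key : (BExpr.natLt (.var 13) (.read3 20 (.var 24) (.var 25) (NExpr.var 13).succ)).holds τ ↔
        I.Covers (I.pick r).2.1 (I.pick r).2.2 e := by
      simp only [BExpr.holds, NExpr.eval_var, NExpr.eval_read3, NExpr.eval_succ, h13, k24, k25, k20]
      rfl
    rw [mul_one]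
    refine .straight ⟨trivial, trivial⟩ ?_
    rw [markStep, Program.exec]
    have hU : I.Uncovered (r + 1) e ↔ σ.nat 22 [e] = 0 ∧
        ¬ I.Covers (I.pick r).2.1 (I.pick r).2.2 e := by
      rw [hD e he]
      rfl
    by_cases hc : I.Covers (I.pick r).2.1 (I.pick r).2.2 e
    · rw [if_pos (key.2 hc), Program.exec_setNat1, NExpr.eval_var, h13]
      refine ⟨fun e' he' => ?_, fun e' he' => ?_⟩
      · rw [Store.setNat_nat_self]
        split_ifs with h'
        · obtain rfl : e' = e := by simpa using h'
          simp [hU, hc, NExpr.eval]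
        · have : e' ≠ e := by simpa using h'
          exact i₁ e' (by omega)
      · rw [Store.setNat_nat_self, if_neg (by simp; omega)]
        exact i₂ e' (by omega)
    · rw [if_neg (mt key.1 hc), Program.exec]
      refine ⟨fun e' he' => ?_, fun e' he' => i₂ e' (by omega)⟩
      rcases Nat.lt_succ_iff_lt_or_eq.1 he' with h' | rfl
      · exact i₁ e' h'
      · rw [i₂ e' le_rfl, hU]
        simp [hc]
  · rw [lastElem_cost, mul_one]
    exact Nat.mul_le_mul_left _ (Nat.sub_le _ _)

theorem ok_emit (d : ℕ) : ∃ C, ∀ (I : Input d) (σ : Store) (r : ℕ), I.Loaded σ →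
    Input.Holds (I.pick r) σ → σ.nat 16 [] = r →
    Ok I.S (emit d) σ (C * (I.ℓ + I.T)) fun τ =>
      (∀ v < I.ℓ, ∀ c < d, τ.real 4 [r, v, c] = coord (vtx (I.center r) v) c) ∧
        ∀ r' v c, r' ≠ r → τ.real 4 [r', v, c] = σ.real 4 [r', v, c] := by
  refine ⟨1 + 1 + 1 + d + (d * (copyStep.steps + 1 + 6) + 1 + 4 + 2 * 1 + 10),
    fun I σ r h hp h16 => ?_⟩
  have hℓ := I.ℓ_pos
  have lt := I.best_lt (I.Uncovered r) I.m
  refine ((ok_simplify (I := I) (x := .var 24) (y := .var 25)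
    (by rw [NExpr.eval_var]; exact hp.2.1) (by rw [NExpr.eval_var]; exact hp.2.2) lt.1 lt.2 10).seq fun τ hf hτ => Ok.loop (X := 1) (K := I.ℓ)
    (C := d * (copyStep.steps + 1 + 6) + 1 + 4)
    (fun k υ => (∀ v < k, ∀ c < d, υ.real 4 [r, v, c] = coord (vtx (I.center r) v) c) ∧
      ∀ r' v c, r' ≠ r → υ.real 4 [r', v, c] = σ.real 4 [r', v, c]) le_rfl hℓ
    (not_mem_of_elem rfl) ?_ (fun _ _ _ h => h) ?_ ?_).mono ?_ fun _ h => h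
  · intro υ hg
    rw [NExpr.eval_var, ((h.frame hf rfl rfl).frame hg rfl rfl).ℓ]
  · refine ⟨fun v hv => absurd hv (Nat.not_lt_zero v), fun _ _ _ _ => ?_⟩
    rw [hf.real 4 (not_mem_of_elem rfl)]
  · intro v hv υ hg h14 ⟨i₁, i₂⟩
    rw [mul_one]
    refine (Ok.forLoop (c := copyStep.steps) (K := d)
      (fun k ω => (∀ v' < v, ∀ c < d, ω.real 4 [r, v', c] = coord (vtx (I.center r) v') c) ∧
        (∀ c < k, ω.real 4 [r, v, c] = coord (vtx (I.center r) v) c) ∧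
        ∀ r' v c, r' ≠ r → ω.real 4 [r', v, c] = σ.real 4 [r', v, c])
      (not_mem_of_elem rfl) (fun _ _ => rfl) (fun _ _ _ h => h)
      ⟨i₁, fun c hc => absurd hc (Nat.not_lt_zero c), i₂⟩ ?_).mono le_rfl
      fun ω hω => ⟨fun v' hv' => ?_, hω.2.2⟩
    · intro c hc ω hh h17 ⟨j₁, j₂, j₃⟩
      have k16 : ω.nat 16 [] = r := by
        rw [hh.nat 16 (not_mem_of_elem rfl), hg.nat 16 (not_mem_of_elem rfl),
          hf.nat 16 (not_mem_of_elem rfl), h16]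
      have k14 : ω.nat 14 [] = v := by rw [hh.nat 14 (not_mem_of_elem rfl), h14]
      have k10 : ω.real 10 [v, c] = coord (vtx (I.center r) v) c := by
        rw [hh.real 10 (not_mem_of_elem rfl), hg.real 10 (not_mem_of_elem rfl), hτ]
        have := scratch_setCurve I σ (I.center r) v c hc
        rwa [min_eq_left (by omega)] at this
      refine .straight trivial ?_
      simp only [copyStep, Program.exec_setReal3, NExpr.eval_var, k16, k14, h17, RExpr.eval_read2, k10,
        Store.setReal_real_self]
      refine ⟨fun v' hv' c' hc' => ?_, fun c' hc' => ?_, fun r' v' c' hr' => ?_⟩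
      · rw [if_neg (by simp; omega)]
        exact j₁ v' hv' c' hc'
      · split_ifs with hx
        · obtain rfl : c' = c := by simpa using hx
          rfl
        · have : c' ≠ c := by simpa using hx
          exact j₂ c' (by omega)
      · rw [if_neg (by simp [hr'])]
        exact j₃ r' v' c' hr'
    · rcases Nat.lt_succ_iff_lt_or_eq.1 hv' with h' | rfl
      · exact hω.1 v' h'
      · exact hω.2.1
  · simp only [NExpr.cost_var, mul_one]
    exact add_bound le_rfl (Nat.mul_le_mul_left _ (Nat.le_add_right _ _))

/-- The memory after some rounds of the greedy algorithm. -/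
structure Input.AfterRounds {d : ℕ} (I : Input d) (r : ℕ) (σ : Store) : Prop where
  marks : I.Marks (I.Uncovered r) σ
  count : σ.nat 3 [] = I.rounds r
  out : ∀ r' < r, ∀ v < I.ℓ, ∀ c < d, σ.real 4 [r', v, c] = coord (vtx (I.center r') v) c

/-- All `m` rounds are executed and each writes a center. The output count stops at the last round
with positive gain, so the centers written after it do not belong to the output. -/
theorem ok_greedy (d : ℕ) : ∃ C, ∀ (I : Input d) (σ : Store), I.Loaded σ →
    I.CoverageTable σ → I.AfterRounds 0 σ →
    Ok I.S (greedy d) σ (C * (I.m * (I.m * (I.m * I.m) + (I.ℓ + I.T)))) (I.AfterRounds I.m) := by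
  obtain ⟨C₁, hC₁⟩ := ok_choose
  obtain ⟨C₂, hC₂⟩ := ok_mark
  obtain ⟨C₃, hC₃⟩ := ok_emit d
  refine ⟨C₁ + (countRound.steps + (C₂ + C₃)) + 2 * 1 + 10, fun I σ h hM h0 => ?_⟩
  have hm := I.m_pos
  have hℓ := I.ℓ_pos
  refine (Ok.loop (X := I.m * (I.m * I.m) + (I.ℓ + I.T)) (K := I.m)
    (C := C₁ + (countRound.steps + (C₂ + C₃))) I.AfterRounds (by omega) hm (not_mem_of_elem rfl)
    ?_ ?_ h0 ?_).mono ?_ fun _ h => h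
  · intro τ hf
    rw [NExpr.eval_var, (h.frame hf rfl rfl).m]
  · rintro k τ x ⟨h₁, h₂, h₃⟩
    exact ⟨by simpa [Input.Marks] using h₁, by simpa using h₂, h₃⟩
  · rintro r hr τ hf h16 ⟨h₁, h₂, h₃⟩
    have l₁ := h.frame hf rfl rfl
    have m₁ : I.CoverageTable τ := by
      unfold Input.CoverageTable
      rw [hf.nat 20 (not_mem_of_elem rfl)]
      exact hM
    refine ((hC₁ I τ (I.Uncovered r) l₁ m₁ h₁).seq fun υ hg hp =>
      (Ok.straight (A := countRound) (Q := fun ω => ω.nat 3 [] = I.rounds (r + 1))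
        ⟨trivial, trivial⟩ ?_).seq fun ω hh hc =>
        (hC₂ I ω r ((l₁.frame hg rfl rfl).frame hh rfl rfl) ?_ ?_ ?_).seq fun ρ hk hD =>
          (hC₃ I ρ r (((l₁.frame hg rfl rfl).frame hh rfl rfl).frame hk rfl rfl) ?_ ?_).frame.mono
            le_rfl fun π hπ => ⟨?_, ?_, ?_⟩).mono ?_ fun _ h => h
    · have k3 : υ.nat 3 [] = I.rounds r := by rw [hg.nat 3 (not_mem_of_elem rfl), h₂]
      have k16 : υ.nat 16 [] = r := by rw [hg.nat 16 (not_mem_of_elem rfl), h16]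
      have k23 : υ.nat 23 [] = (I.pick r).1 := hp.1
      simp only [countRound, Program.exec, BExpr.holds, NExpr.eval_var, NExpr.eval, k23, k16,
        Input.rounds, Program.exec_assign, NExpr.eval_succ]
      split_ifs
      · simp
      · exact k3
    · unfold Input.CoverageTable
      rw [hh.nat 20 (not_mem_of_elem rfl), hg.nat 20 (not_mem_of_elem rfl)]
      exact m₁
    · unfold Input.Marks
      rw [hh.nat 22 (not_mem_of_elem rfl), hg.nat 22 (not_mem_of_elem rfl)]
      exact h₁
    · unfold Input.Holds
      rw [hh.nat 23 (not_mem_of_elem rfl), hh.nat 24 (not_mem_of_elem rfl),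
        hh.nat 25 (not_mem_of_elem rfl)]
      exact hp
    · unfold Input.Holds
      rw [hk.nat 23 (not_mem_of_elem rfl), hk.nat 24 (not_mem_of_elem rfl),
        hk.nat 25 (not_mem_of_elem rfl), hh.nat 23 (not_mem_of_elem rfl),
        hh.nat 24 (not_mem_of_elem rfl), hh.nat 25 (not_mem_of_elem rfl)]
      exact hp
    · rw [hk.nat 16 (not_mem_of_elem rfl), hh.nat 16 (not_mem_of_elem rfl),
        hg.nat 16 (not_mem_of_elem rfl), h16]
    · have b₁ : I.m ≤ I.m * (I.m * I.m) := Nat.le_mul_of_pos_right _ (Nat.mul_pos hm hm)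
      exact add_bound (Nat.mul_le_mul_left _ (Nat.le_add_right _ _)) (add_bound
        (Nat.le_mul_of_pos_right _ (by omega)) (add_bound (Nat.mul_le_mul_left _ (by omega))
          (Nat.mul_le_mul_left _ (Nat.le_add_left _ _))))
    · unfold Input.Marks
      rw [hπ.1.nat 22 (not_mem_of_elem rfl)]
      exact hD
    · rw [hπ.1.nat 3 (not_mem_of_elem rfl), hk.nat 3 (not_mem_of_elem rfl), hc]
    · intro r' hr' v hv c hc'
      rcases Nat.lt_succ_iff_lt_or_eq.1 hr' with h' | rfl
      · rw [hπ.2.2 r' v c h'.ne, hk.real 4 (not_mem_of_elem rfl), hh.real 4 (not_mem_of_elem rfl),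
          hg.real 4 (not_mem_of_elem rfl)]
        exact h₃ r' h' v hv c hc'
      · exact hπ.2.1 v hv c hc'
  · rw [NExpr.cost_var]

end Greedy

namespace Input

variable {d : ℕ} (I : Input d)

/-! ### The covered elements -/

theorem le_reach (q : PolyCurve d I.ℓ) (i prev j : ℕ) : prev ≤ I.reach q i prev j := by
  induction j with
  | zero => exact le_rfl
  | succ j ih =>
    rw [reach]
    split_ifs with h
    · exact ih.trans h.1.2.le
    · exact ih

theorem le_reach_of_near {q : PolyCurve d I.ℓ} {i j : ℕ} (prev : ℕ) (hij : i < j)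
    (h : I.P.Near q I.δ i j) {k : ℕ} (hk : j < k) : j ≤ I.reach q i prev k := by
  induction k with
  | zero => omega
  | succ k ih =>
    rw [reach]
    rcases Nat.lt_succ_iff_lt_or_eq.1 hk with hk' | rfl
    · split_ifs
      · exact hk'.le
      · exact ih hk'
    · split_ifs with h'
      · exact le_rfl
      · by_contra hlt
        exact h' ⟨⟨hij, not_le.1 hlt⟩, h⟩

theorem near_of_lt_reach {q : PolyCurve d I.ℓ} {i prev k e : ℕ} (he : e < I.reach q i prev k) :
    e < prev ∨ ∃ j < k, i < j ∧ e < j ∧ I.P.Near q I.δ i j := by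
  induction k with
  | zero => exact .inl he
  | succ k ih =>
    rw [reach] at he
    split_ifs at he with h
    · exact .inr ⟨k, Nat.lt_succ_self k, h.1.1, he, h.2⟩
    · exact (ih he).imp_right fun ⟨j, hj, h'⟩ => ⟨j, hj.trans (Nat.lt_succ_self k), h'⟩

theorem lt_far_iff (q : PolyCurve d I.ℓ) (e k : ℕ) :
    e < I.far q k ↔ ∃ i < k, ∃ j < I.m, i < j ∧ e < j ∧ I.P.Near q I.δ i j := by
  induction k with
  | zero => simp [far]
  | succ k ih =>
    rw [far]
    constructor
    · intro h
      rcases I.near_of_lt_reach h with h | h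
      · obtain ⟨i, hi, h⟩ := ih.1 h
        exact ⟨i, hi.trans (Nat.lt_succ_self k), h⟩
      · exact ⟨k, Nat.lt_succ_self k, h⟩
    · rintro ⟨i, hi, j, hj, hij, he, h⟩
      rcases Nat.lt_succ_iff_lt_or_eq.1 hi with hi | rfl
      · exact (ih.2 ⟨i, hi, j, hj, hij, he, h⟩).trans_le (I.le_reach _ _ _ _)
      · exact he.trans_le (I.le_reach_of_near _ hij h hj)

/-- An interval contains the element `e` exactly if it starts at `i ≤ e` and ends at `j > e`. Among
the near intervals with `i ≤ e` the one reaching furthest decides, so a single stored number per `e`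
suffices. -/
theorem covers_iff (a b e : ℕ) :
    I.Covers a b e ↔ ∃ i ≤ e, ∃ j < I.m, e < j ∧ I.P.Near (I.S.answer a b) I.δ i j := by
  rw [Covers, lt_far_iff]
  constructor
  · rintro ⟨i, hi, j, hj, -, he, h⟩
    exact ⟨i, Nat.lt_succ_iff.1 hi, j, hj, he, h⟩
  · rintro ⟨i, hi, j, hj, he, h⟩
    exact ⟨i, Nat.lt_succ_iff.2 hi, j, hj, hi.trans_lt he, he, h⟩

/-! ### The best candidate -/

theorem le_rowBest (U : ℕ → Prop) (a : ℕ) (s : ℕ × ℕ × ℕ) (b : ℕ) :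
    s.1 ≤ (I.rowBest U a s b).1 := by
  induction b with
  | zero => exact le_rfl
  | succ b ih =>
    rw [rowBest]
    split_ifs with h
    · exact ih.trans h.2.le
    · exact ih

theorem gain_le_rowBest (U : ℕ → Prop) {a b : ℕ} (s : ℕ × ℕ × ℕ) (hab : a < b) {k : ℕ} (hk : b < k) :
    I.gain U a b ≤ (I.rowBest U a s k).1 := by
  induction k with
  | zero => omega
  | succ k ih =>
    rw [rowBest]
    rcases Nat.lt_succ_iff_lt_or_eq.1 hk with hk' | rfl
    · split_ifs with h
      · exact (ih hk').trans h.2.le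
      · exact ih hk'
    · split_ifs with h
      · exact le_rfl
      · by_contra hlt
        exact h ⟨hab, not_le.1 hlt⟩

theorem rowBest_le_gain (U : ℕ → Prop) (a : ℕ) {s : ℕ × ℕ × ℕ} (hs : s.1 ≤ I.gain U s.2.1 s.2.2)
    (b : ℕ) : (I.rowBest U a s b).1 ≤ I.gain U (I.rowBest U a s b).2.1 (I.rowBest U a s b).2.2 := by
  induction b with
  | zero => exact hs
  | succ b ih =>
    rw [rowBest]
    split_ifs
    · exact le_rfl
    · exact ih

theorem gain_le_best (U : ℕ → Prop) {a b : ℕ} (hab : a < b) (hb : b < I.m) {k : ℕ} (hk : a < k) :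
    I.gain U a b ≤ (I.best U k).1 := by
  induction k with
  | zero => omega
  | succ k ih =>
    rw [best]
    rcases Nat.lt_succ_iff_lt_or_eq.1 hk with hk' | rfl
    · exact (ih hk').trans (I.le_rowBest _ _ _ _)
    · exact I.gain_le_rowBest _ _ hab hb

theorem best_le_gain (U : ℕ → Prop) (k : ℕ) :
    (I.best U k).1 ≤ I.gain U (I.best U k).2.1 (I.best U k).2.2 := by
  induction k with
  | zero => exact Nat.zero_le _
  | succ k ih => exact I.rowBest_le_gain _ _ ih _

/-! ### The number of rounds -/

open Classical in
/-- The number of elements that are not covered after some rounds. -/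
def left (r : ℕ) : ℕ := Nat.count (I.Uncovered r) (I.m - 1)

theorem left_succ_add_gain (r : ℕ) :
    I.left (r + 1) + I.gain (I.Uncovered r) (I.pick r).2.1 (I.pick r).2.2 = I.left r := by
  classical
  simp only [left, gain, Nat.count_eq_card_filter_range]
  rw [← Finset.card_filter_add_card_filter_not (s := (Finset.range (I.m - 1)).filter (I.Uncovered r))
    (fun e => I.Covers (I.pick r).2.1 (I.pick r).2.2 e), Finset.filter_filter, Finset.filter_filter,
    add_comm]
  congr! 3

theorem left_succ_add_pick_le (r : ℕ) : I.left (r + 1) + (I.pick r).1 ≤ I.left r := by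
  rw [← I.left_succ_add_gain r]
  exact Nat.add_le_add_left (I.best_le_gain _ _) _

theorem exists_uncovered_of_left_pos {r : ℕ} : 0 < I.left r ↔ ∃ e < I.m - 1, I.Uncovered r e := by
  classical
  rw [left, Nat.count_eq_card_filter_range, Finset.card_pos]
  simp [Finset.Nonempty]

theorem lt_rounds {r k : ℕ} (hr : 0 < (I.pick r).1) (hk : r < k) : r < I.rounds k := by
  induction k with
  | zero => omega
  | succ k ih =>
    rw [rounds]
    rcases Nat.lt_succ_iff_lt_or_eq.1 hk with hk' | rfl
    · split_ifs
      · omega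
      · exact ih hk'
    · rw [if_pos hr]
      exact Nat.lt_succ_self r

theorem rounds_eq (k : ℕ) : I.rounds k = 0 ∨ ∃ r < k, I.rounds k = r + 1 ∧ 0 < (I.pick r).1 := by
  induction k with
  | zero => exact .inl rfl
  | succ k ih =>
    rw [rounds]
    split_ifs with h
    · exact .inr ⟨k, Nat.lt_succ_self k, rfl, h⟩
    · exact ih.imp_right fun ⟨r, hr, h'⟩ => ⟨r, hr.trans (Nat.lt_succ_self k), h'⟩

/-- A set of candidates that cover all elements. -/
structure IsCover (K : Finset (ℕ × ℕ)) : Prop where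
  lt : ∀ ab ∈ K, ab.1 < ab.2 ∧ ab.2 < I.m
  covers : ∀ e < I.m - 1, ∃ ab ∈ K, I.Covers ab.1 ab.2 e

variable {I} {K : Finset (ℕ × ℕ)}

theorem IsCover.card_pos (hK : I.IsCover K) : 0 < K.card := by
  have := I.P.two_le
  obtain ⟨ab, h, -⟩ := hK.covers 0 (by omega)
  exact Finset.card_pos.2 ⟨ab, h⟩

/-- Pigeonhole: the uncovered elements are shared among the candidates of `K`, and none of these
gains more than the greedy choice. -/
theorem IsCover.left_le (hK : I.IsCover K) (r : ℕ) : I.left r ≤ K.card * (I.pick r).1 := by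
  classical
  have h : (Finset.range (I.m - 1)).filter (I.Uncovered r) ⊆ K.biUnion fun ab =>
      (Finset.range (I.m - 1)).filter fun e => I.Uncovered r e ∧ I.Covers ab.1 ab.2 e := by
    intro e he
    obtain ⟨h₁, h₂⟩ := Finset.mem_filter.1 he
    obtain ⟨ab, hab, hc⟩ := hK.covers e (Finset.mem_range.1 h₁)
    exact Finset.mem_biUnion.2 ⟨ab, hab, Finset.mem_filter.2 ⟨h₁, h₂, hc⟩⟩
  rw [left, Nat.count_eq_card_filter_range]
  refine (Finset.card_le_card h).trans (Finset.card_biUnion_le_card_mul _ _ _ fun ab hab => ?_)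
  have hlt := hK.lt ab hab
  have := I.gain_le_best (I.Uncovered r) hlt.1 hlt.2 (hlt.1.trans hlt.2)
  rwa [gain, Nat.count_eq_card_filter_range] at this

theorem IsCover.pick_pos (hK : I.IsCover K) {r : ℕ} (h : 0 < I.left r) : 0 < (I.pick r).1 := by
  by_contra h0
  have := hK.left_le r
  rw [Nat.eq_zero_of_not_pos h0] at this
  omega

/-- As long as elements are left, a round removes at least one of the initial `m - 1`. So the fixed
number of `m` rounds is enough. -/
theorem IsCover.left_eq_zero (hK : I.IsCover K) : I.left I.m = 0 := by
  classical
  have key : ∀ r, I.left r ≤ I.m - 1 - r := by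
    intro r
    induction r with
    | zero => exact Nat.count_le _
    | succ r ih =>
      have h₁ := I.left_succ_add_pick_le r
      rcases Nat.eq_zero_or_pos (I.left r) with h | h
      · omega
      · have := hK.pick_pos h
        omega
  have := key I.m
  omega

/-- In the round in which `e` gets covered something was still uncovered, so that round has positive
gain and its center is part of the output. -/
theorem IsCover.exists_center (hK : I.IsCover K) {e : ℕ} (he : e < I.m - 1) :
    ∃ r < I.rounds I.m, I.Covers (I.pick r).2.1 (I.pick r).2.2 e := by
  have key : ∀ k, ¬ I.Uncovered k e → ∃ r < k, I.Uncovered r e ∧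
      I.Covers (I.pick r).2.1 (I.pick r).2.2 e := by
    intro k
    induction k with
    | zero => exact fun h => absurd trivial h
    | succ k ih =>
      intro h
      by_cases hk : I.Uncovered k e
      · refine ⟨k, Nat.lt_succ_self k, hk, ?_⟩
        by_contra hc
        exact h ⟨hk, hc⟩
      · obtain ⟨r, hr, h'⟩ := ih hk
        exact ⟨r, hr.trans (Nat.lt_succ_self k), h'⟩
  obtain ⟨r, hr, hU, hc⟩ := key I.m fun h => by
    have := I.exists_uncovered_of_left_pos.2 ⟨e, he, h⟩
    rw [hK.left_eq_zero] at this
    exact lt_irrefl 0 this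
  exact ⟨r, I.lt_rounds (hK.pick_pos (I.exists_uncovered_of_left_pos.2 ⟨e, he, hU⟩)) hr, hc⟩

/-- By `left_le` a round removes at least the fraction `1/|K|` of what is left, and `1 - 1/|K| ≤
exp(-1/|K|)`. -/
theorem IsCover.left_le_exp (hK : I.IsCover K) (r : ℕ) :
    (I.left r : ℝ) ≤ I.m * Real.exp (-(r / K.card)) := by
  classical
  have hk : (0 : ℝ) < K.card := Nat.cast_pos.2 hK.card_pos
  induction r with
  | zero =>
    have : I.left 0 ≤ I.m := (Nat.count_le _).trans (Nat.sub_le _ _)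
    simpa using this
  | succ r ih =>
    have h₁ : (I.left (r + 1) : ℝ) + (I.pick r).1 ≤ I.left r := by
      exact_mod_cast I.left_succ_add_pick_le r
    have h₂ : (I.left r : ℝ) / K.card ≤ (I.pick r).1 := by
      rw [div_le_iff₀' hk]
      exact_mod_cast hK.left_le r
    have h₃ : 1 - 1 / (K.card : ℝ) ≤ Real.exp (-(1 / K.card)) := Real.one_sub_le_exp_neg _
    calc (I.left (r + 1) : ℝ) ≤ I.left r * (1 - 1 / K.card) := by
          rw [mul_sub, mul_one, mul_one_div]
          linarith
      _ ≤ I.left r * Real.exp (-(1 / K.card)) := by gcongr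
      _ ≤ I.m * Real.exp (-(r / K.card)) * Real.exp (-(1 / K.card)) := by gcongr
      _ = I.m * Real.exp (-((r + 1 : ℕ) / K.card)) := by
          rw [mul_assoc, ← Real.exp_add]
          congr 2
          push_cast
          ring

/-- Before the last productive round `r` at least one element is left, so the exponential bound
gives `r ≤ |K| log m`. The number of rounds is `r + 1`, and `|K| log m ≥ log 2 ≥ 1/2` turns the
additional 1 into the factor 3. -/
theorem IsCover.rounds_le (hK : I.IsCover K) : (I.rounds I.m : ℝ) ≤ 3 * (K.card * Real.log I.m) := by
  have hk : (1 : ℝ) ≤ K.card := Nat.one_le_cast.2 hK.card_pos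
  have hm : (2 : ℝ) ≤ I.m := by exact_mod_cast I.P.two_le
  have hlog : 1 / 2 ≤ Real.log I.m :=
    (by linarith [Real.log_two_gt_d9] : (1 : ℝ) / 2 ≤ Real.log 2).trans
      (Real.log_le_log two_pos hm)
  have hkl : 1 / 2 ≤ K.card * Real.log I.m := by nlinarith
  rcases I.rounds_eq I.m with h | ⟨r, -, h, hp⟩
  · rw [h, Nat.cast_zero]
    linarith
  · have h₁ : (1 : ℝ) ≤ I.left r := by
      have := I.left_succ_add_pick_le r
      exact_mod_cast (by omega : 1 ≤ I.left r)
    have h₂ := Real.log_le_log one_pos (h₁.trans (hK.left_le_exp r))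
    rw [Real.log_one, Real.log_mul (by linarith) (Real.exp_pos _).ne', Real.log_exp] at h₂
    have h₃ : (r : ℝ) ≤ K.card * Real.log I.m := by
      rw [← div_le_iff₀' (by linarith)]
      linarith
    rw [h]
    push_cast
    linarith

end Input

/-! ### Covers and the cost function -/

namespace Trajectory

variable {d n m ℓ : ℕ} (P : Trajectory d n m)

theorem exists_time_le {x : ℝ} (hx : 0 ≤ x) (hx' : x ≤ 1) :
    ∃ e < m - 1, P.time e ≤ x ∧ x ≤ P.time (e + 1) := by
  classical
  have hm := P.two_le
  have h0 : P.time 0 ≤ x := by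
    rw [time, dif_pos (by omega), P.bp_first]
    exact hx
  -- The search stops at `m - 2` so that `e + 1` is still a breakpoint; in that extreme case it is
  -- the last one, at the parameter 1.
  set e := Nat.findGreatest (fun e => P.time e ≤ x) (m - 2) with he
  have hle : e ≤ m - 2 := Nat.findGreatest_le _
  refine ⟨e, by omega, Nat.findGreatest_spec (P := fun e => P.time e ≤ x) (Nat.zero_le _) h0, ?_⟩
  rcases hle.lt_or_eq with h | h
  · exact (not_le.1 (Nat.findGreatest_is_greatest (P := fun e => P.time e ≤ x) (k := e + 1)
      (Nat.lt_succ_self e) h)).le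
  · have h1 : e + 1 = m - 1 := by omega
    rw [h1, time, dif_pos (by omega), P.bp_last]
    exact hx'

/-- All pairs that are near some center are used at once: the elementary intervals exhaust `[0, 1]`,
and each is contained in one of these intervals. -/
theorem phi_le_of_near {C : Set (PolyCurve d ℓ)} (hℓ : 0 < ℓ) {δ : ℝ} (hδ : 0 ≤ δ)
    (h : ∀ e < m - 1, ∃ q ∈ C, ∃ i ≤ e, ∃ j < m, e < j ∧ P.Near q δ i j) :
    P.phi C ≤ ENNReal.ofReal δ := by
  classical
  set I : Finset (Fin m × Fin m) := Finset.univ.filter fun ij =>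
    ij.1 < ij.2 ∧ ∃ q ∈ C, P.Near q δ ij.1 ij.2 with hI
  have hcover : P.IsIntervalCover I := by
    refine ⟨fun ij hij => (Finset.mem_filter.1 hij).2.1, Set.Subset.antisymm ?_ ?_⟩
    · rintro x ⟨hx, hx'⟩
      obtain ⟨e, he, h₁, h₂⟩ := P.exists_time_le hx hx'
      obtain ⟨q, hq, i, hi, j, hj, hej, hn⟩ := h e he
      have him : i < m := by omega
      refine Set.mem_iUnion₂.2 ⟨(⟨i, him⟩, ⟨j, hj⟩), Finset.mem_filter.2 ⟨Finset.mem_univ _,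
        Fin.mk_lt_mk.2 (hi.trans_lt hej), q, hq, hn⟩, ?_, ?_⟩
      · refine le_trans ?_ h₁
        rw [time, dif_pos (by omega)]
        exact P.bp_strictMono.monotone (Fin.mk_le_mk.2 hi)
      · refine h₂.trans ?_
        rw [time, dif_pos (by omega)]
        exact P.bp_strictMono.monotone (Fin.mk_le_mk.2 hej)
    · refine Set.iUnion₂_subset fun ij _ x hx => ⟨?_, ?_⟩
      · rw [← P.bp_first]
        exact (P.bp_strictMono.monotone (Fin.mk_le_mk.2 (Nat.zero_le _))).trans hx.1
      · rw [← P.bp_last]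
        exact hx.2.trans (P.bp_strictMono.monotone (Fin.mk_le_mk.2 (by omega)))
  refine iInf₂_le_of_le I hcover (iSup₂_le fun ij hij => ?_)
  obtain ⟨-, hlt, q, hq, hn⟩ := Finset.mem_filter.1 hij
  exact iInf₂_le_of_le q hq (P.frechetDist_le_of_near q hℓ hδ hlt hn)

theorem exists_cover_of_phi_le {C : Finset (PolyCurve d ℓ)} {Δ : ℝ}
    (h : P.phi (C : Set (PolyCurve d ℓ)) ≤ ENNReal.ofReal Δ) {e : ℕ} (he : e < m - 1) :
    ∃ i j : Fin m, ↑i ≤ e ∧ e < ↑j ∧ ∃ q ∈ C, frechetDist (P.sub i j) q.toCurve ≤ ENNReal.ofReal Δ := by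
  classical
  -- There are finitely many families of pairs, so the infimum is attained; families that are not
  -- covers have the value `∞`.
  obtain ⟨I, hI⟩ := exists_eq_ciInf_of_finite (f := fun I : Finset (Fin m × Fin m) =>
    ⨅ _ : P.IsIntervalCover I, ⨆ ij ∈ I, ⨅ q ∈ (C : Set (PolyCurve d ℓ)),
      frechetDist (P.sub ij.1 ij.2) q.toCurve)
  have hle := hI.le.trans h
  by_cases hc : P.IsIntervalCover I
  swap
  · rw [iInf_neg hc] at hle
    exact absurd hle (not_le.2 ENNReal.ofReal_lt_top)
  rw [iInf_pos hc] at hle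
  have ht : P.time e < P.time (e + 1) := P.time_lt (Nat.lt_succ_self e) (by omega)
  -- An interval between breakpoints that contains the midpoint of an elementary interval contains
  -- the whole of it.
  have hmem : (P.time e + P.time (e + 1)) / 2 ∈ Set.Icc (0 : ℝ) 1 := by
    have h₁ := P.time_mem e
    have h₂ := P.time_mem (e + 1)
    constructor <;> linarith
  rw [hc.2] at hmem
  obtain ⟨⟨i, j⟩, hij, hx₁, hx₂⟩ := Set.mem_iUnion₂.1 hmem
  refine ⟨i, j, ?_, ?_, ?_⟩
  · by_contra hlt
    have : P.time (e + 1) ≤ P.bp i := by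
      rw [time, dif_pos (by omega)]
      exact P.bp_strictMono.monotone (Fin.mk_le_mk.2 (by omega))
    simp only at hx₁
    linarith
  · by_contra hlt
    have : P.bp j ≤ P.time e := by
      rw [time, dif_pos (by omega)]
      exact P.bp_strictMono.monotone (Fin.mk_le_mk.2 (by omega))
    simp only at hx₂
    linarith
  · by_contra hno
    push Not at hno
    -- Since `C` is finite, strict inequalities for all centers give a strict inequality for the
    -- infimum. This includes the empty `C`, whose infimum is `∞`.
    have := (Finset.lt_inf_iff (s := C) (f := fun q => frechetDist (P.sub i j) q.toCurve)
      ENNReal.ofReal_lt_top).2 hno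
    rw [Finset.inf_eq_iInf] at this
    exact absurd (this.trans_le ((le_iSup₂_of_le (f := fun ij (_ : ij ∈ I) =>
      ⨅ q ∈ (C : Set (PolyCurve d ℓ)), frechetDist (P.sub ij.1 ij.2) q.toCurve) (i, j) hij
        le_rfl).trans hle)) (lt_irrefl _)

end Trajectory

/-! ### From good centers to few candidates -/

namespace Input

variable {d : ℕ} (I : Input d)

/-- This is the source of the factor 3. The chain `P[t_i, t_j]`, `h`, `P[t_a, t_b]`, simplification
has three links of length at most `Δ`, the last one because the simplification is no worse than its
competitor `h`. -/
theorem near_answer {h : PolyCurve d I.ℓ} {a b i j : Fin I.m} (hab : a < b) (hij : i < j)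
    (h₁ : frechetDist (I.P.sub a b) h.toCurve ≤ ENNReal.ofReal I.Δ)
    (h₂ : frechetDist (I.P.sub i j) h.toCurve ≤ ENNReal.ofReal I.Δ) :
    I.P.Near (I.S.answer a b) I.δ i j := by
  have hΔ := I.Δ_nonneg
  refine I.P.near_of_frechetDist_le _ I.ℓ_pos (by rw [δ]; positivity) hij ?_
  have h₃ := ((I.computes a b hab).1 h).trans h₁
  have h₄ := (frechetDist_triangle (I.P.sub i j) h.toCurve (I.P.sub a b)).trans
    (add_le_add h₂ ((frechetDist_comm _ _).trans_le h₁))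
  refine ((frechetDist_triangle _ (I.P.sub a b) _).trans (add_le_add h₄ h₃)).trans_eq ?_
  rw [← ENNReal.ofReal_add hΔ hΔ, ← ENNReal.ofReal_add (add_nonneg hΔ hΔ) hΔ, δ]
  congr 1
  ring

/-- Each center is replaced by one subcurve within `Δ` of it, whose simplification inherits
everything the center covers by `near_answer`. A center that is near no subcurve covers nothing and
gets the arbitrary pair `(0, 1)`. -/
theorem exists_isCover {H : Finset (PolyCurve d I.ℓ)}
    (hH : I.P.phi (H : Set (PolyCurve d I.ℓ)) ≤ ENNReal.ofReal I.Δ) :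
    ∃ K, I.IsCover K ∧ K.card ≤ H.card := by
  classical
  have hm := I.P.two_le
  have : ∀ h : PolyCurve d I.ℓ, ∃ ab : Fin I.m × Fin I.m, ab.1 < ab.2 ∧
      ∀ i j : Fin I.m, i < j → frechetDist (I.P.sub i j) h.toCurve ≤ ENNReal.ofReal I.Δ →
        frechetDist (I.P.sub ab.1 ab.2) h.toCurve ≤ ENNReal.ofReal I.Δ := by
    intro h
    by_cases hg : ∃ ab : Fin I.m × Fin I.m, ab.1 < ab.2 ∧
        frechetDist (I.P.sub ab.1 ab.2) h.toCurve ≤ ENNReal.ofReal I.Δ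
    · obtain ⟨ab, hab, h'⟩ := hg
      exact ⟨ab, hab, fun _ _ _ _ => h'⟩
    · exact ⟨(⟨0, by omega⟩, ⟨1, by omega⟩), Fin.mk_lt_mk.2 zero_lt_one,
        fun i j hij h' => absurd ⟨(i, j), hij, h'⟩ hg⟩
  choose rep hlt hrep using this
  refine ⟨H.image fun h => ((rep h).1, (rep h).2), ⟨?_, ?_⟩, Finset.card_image_le⟩
  · intro ab hab
    obtain ⟨h, -, rfl⟩ := Finset.mem_image.1 hab
    exact ⟨hlt h, (rep h).2.2⟩
  · intro e he
    obtain ⟨i, j, hi, hj, h, hh, hd⟩ := I.P.exists_cover_of_phi_le hH he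
    have hij : i < j := Fin.lt_def.2 (by omega)
    exact ⟨_, Finset.mem_image_of_mem _ hh, (I.covers_iff _ _ _).2 ⟨i, hi, j, j.2, hj,
      I.near_answer (hlt h) hij (hrep h i j hij hd) hd⟩⟩

theorem mem_outputCenters_iff {σ : Store} (h : I.AfterRounds I.m σ) (q : PolyCurve d I.ℓ) :
    q ∈ outputCenters d I.ℓ σ ↔ ∃ r < I.rounds I.m, q = I.center r := by
  have hr : I.rounds I.m ≤ I.m := by
    rcases I.rounds_eq I.m with h | ⟨r, hr, h, -⟩ <;> omega
  have key : ∀ r < I.rounds I.m, (fun v : Fin I.ℓ => WithLp.toLp 2 fun c : Fin d =>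
      σ.real 4 [r, (v : ℕ), (c : ℕ)]) = I.center r := by
    intro r hr'
    funext v
    ext c
    change σ.real 4 [r, (v : ℕ), (c : ℕ)] = _
    rw [h.out r (by omega) v v.2 c c.2, coord_vtx_of_lt _ v.2 c.2]
  constructor
  · rintro ⟨r, rfl⟩
    have hr' : (r : ℕ) < I.rounds I.m := by
      rw [← h.count]
      exact r.2
    exact ⟨r, hr', key r hr'⟩
  · rintro ⟨r, hr', rfl⟩
    exact ⟨⟨r, by rw [outputCount, h.count]; exact hr'⟩, key r hr'⟩

end Input

set_option maxHeartbeats 2000000 in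
theorem ok_algorithm (d : ℕ) : ∃ C, ∀ I : Input d, Ok I.S (algorithm d) (inputStore I.P I.ℓ I.Δ)
    (C * (I.m ^ 3 * I.n * I.ℓ + I.m ^ 4 + I.m ^ 2 * I.T)) (I.AfterRounds I.m) := by
  obtain ⟨C₁, hC₁⟩ := ok_setup
  obtain ⟨C₂, hC₂⟩ := ok_coverage d
  obtain ⟨C₃, hC₃⟩ := ok_greedy d
  refine ⟨C₁ * 2 + (C₂ * 2 + C₃ * 2), fun I => ((hC₁ I).seq fun σ hf hσ =>
    (hC₂ I σ hσ).seq fun τ hg hτ => hC₃ I τ (hσ.frame hg rfl rfl) hτ ⟨?_, ?_, ?_⟩).mono ?_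
      fun _ h => h⟩
  · intro e _
    rw [hg.nat 22 (not_mem_of_elem rfl), hf.nat 22 (not_mem_of_elem rfl)]
    exact iff_of_true rfl trivial
  · rw [hg.nat 3 (not_mem_of_elem rfl), hf.nat 3 (not_mem_of_elem rfl)]
    rfl
  · exact fun r hr => absurd hr (Nat.not_lt_zero r)
  -- Setup costs `ℓ + m n`, coverage `m² (ℓ + T + m (n ℓ + m))` and the greedy rounds `m (m³ + ℓ +
  -- T)`, up to constants. As `m`, `n`, `ℓ` are positive, every term is dominated by one of the
  -- three in the claim.
  · have hm := I.m_pos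
    have hn : 1 ≤ I.n := I.P.n_pos
    have hℓ : 1 ≤ I.ℓ := I.ℓ_pos
    generalize I.m = m, I.n = n, I.ℓ = ℓ, I.T = T at *
    have hm₁ : m ≤ m ^ 3 := Nat.le_self_pow (by norm_num) m
    have hm₂ : m ≤ m ^ 2 := Nat.le_self_pow (by norm_num) m
    have hm₃ : m ^ 2 ≤ m ^ 3 := Nat.pow_le_pow_right hm (by norm_num)
    have hm₄ : 1 ≤ m ^ 3 := Nat.one_le_pow _ _ hm
    have b₁ : ℓ ≤ m ^ 3 * n * ℓ := Nat.le_mul_of_pos_left _ (Nat.mul_pos hm₄ hn)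
    have b₂ : m * n ≤ m ^ 3 * n * ℓ :=
      (Nat.mul_le_mul_right n hm₁).trans (Nat.le_mul_of_pos_right _ hℓ)
    have b₃ : m ^ 2 * ℓ ≤ m ^ 3 * n * ℓ :=
      Nat.mul_le_mul_right ℓ (hm₃.trans (Nat.le_mul_of_pos_right _ hn))
    have b₄ : m * ℓ ≤ m ^ 3 * n * ℓ :=
      Nat.mul_le_mul_right ℓ (hm₁.trans (Nat.le_mul_of_pos_right _ hn))
    have b₅ : m * T ≤ m ^ 2 * T := Nat.mul_le_mul_right T hm₂
    refine add_bound ?_ (add_bound ?_ ?_)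
    · rw [mul_assoc]
      refine Nat.mul_le_mul_left _ ?_
      omega
    · rw [mul_assoc]
      refine Nat.mul_le_mul_left _ ?_
      have : m * (m * (ℓ + T + m * (n * ℓ + m))) =
        m ^ 2 * ℓ + m ^ 2 * T + m ^ 3 * n * ℓ + m ^ 4 := by ring
      omega
    · rw [mul_assoc]
      refine Nat.mul_le_mul_left _ ?_
      have : m * (m * (m * m) + (ℓ + T)) = m ^ 4 + m * ℓ + m * T := by ring
      omega

end Subtraj

end

theorem mainTheorem3 :
    ∃ c : ℝ, ∀ d : ℕ, ∃ (A : Subtraj.Program) (C : ℝ),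
      ∀ (n m ℓ : ℕ) (_ : 1 ≤ ℓ) (P : Subtraj.Trajectory d n m) (Δ : ℝ) (_ : 0 ≤ Δ)
        (TS : ℕ → ℕ → ℕ) (S : Subtraj.Subroutine d ℓ) (_ : S.Computes P (TS n ℓ))
        (k : ℕ) (Hstar : Finset (Subtraj.PolyCurve d ℓ)) (_ : Hstar.card = k)
        (_ : P.phi (Hstar : Set (Subtraj.PolyCurve d ℓ)) ≤ ENNReal.ofReal Δ),
        ∃ (σ : Subtraj.Store) (T : ℕ),
          Subtraj.Runs S A (Subtraj.inputStore P ℓ Δ) σ T ∧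
          (T : ℝ) ≤ C * ((m : ℝ) ^ 3 * n * ℓ + (m : ℝ) ^ 4 + (m : ℝ) ^ 2 * TS n ℓ) ∧
          (Subtraj.outputCount σ : ℝ) ≤ c * (k * Real.log m) ∧
          (∀ h ∈ Subtraj.outputCenters d ℓ σ,
            ∃ i j : Fin m, i < j ∧ Subtraj.IsSimplification (P.sub i j) h) ∧
          P.phi (Subtraj.outputCenters d ℓ σ) ≤ ENNReal.ofReal (3 * Δ) := by
  refine ⟨3, fun d => ?_⟩
  obtain ⟨C, hC⟩ := Subtraj.ok_algorithm d
  refine ⟨Subtraj.algorithm d, C, fun n m ℓ hℓ P Δ hΔ TS S hS k Hstar hk hH => ?_⟩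
  let I : Subtraj.Input d := ⟨n, m, ℓ, hℓ, P, Δ, hΔ, TS n ℓ, S, hS⟩
  obtain ⟨σ, T, hrun, hT, hσ⟩ := hC I
  -- The set `H*` and its size `k` enter only the analysis; the program never uses them.
  obtain ⟨K, hK, hKH⟩ := I.exists_isCover hH
  refine ⟨σ, T, hrun, ?_, ?_, ?_, ?_⟩
  · exact_mod_cast hT
  · rw [Subtraj.outputCount, hσ.count]
    refine hK.rounds_le.trans ?_
    have : (K.card : ℝ) ≤ k := by exact_mod_cast hKH.trans_eq hk
    have hlog := Real.log_natCast_nonneg m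
    exact mul_le_mul_of_nonneg_left (mul_le_mul_of_nonneg_right this hlog) (by norm_num)
  · intro h hh
    obtain ⟨r, -, rfl⟩ := (I.mem_outputCenters_iff hσ h).1 hh
    obtain ⟨h₁, h₂⟩ := I.best_lt (I.Uncovered r) I.m
    have hlt : (⟨_, h₁.trans h₂⟩ : Fin m) < ⟨_, h₂⟩ := Fin.mk_lt_mk.2 h₁
    exact ⟨_, _, hlt, (hS _ _ hlt).1⟩
  · refine P.phi_le_of_near hℓ (by positivity) fun e he => ?_
    obtain ⟨r, hr, hc⟩ := hK.exists_center he
    exact ⟨I.center r, (I.mem_outputCenters_iff hσ _).2 ⟨r, hr, rfl⟩, (I.covers_iff _ _ _).1 hc⟩
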